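/- **Setup.** Let $\Omega$ be a finite set of $N=|\Omega|$ single-particle states, with fermionic annihilation and creation operators $\psi_a,\psi_a^\dagger$ ($a\in\Omega$) acting on the $2^N$-dimensional Fock space and satisfying the canonical anticommutation relations. Let $h=(h_{ab})$ be a Hermitian matrix, $H_0=\sum_{a,b}h_{ab}\psi_a^\dagger\psi_b$, and $V=\sum_{P\in\mathcal P}v_P\Psi_P$, where $\mathcal P$ is a finite list of multi-indices $P=(P^+,P^-)\in\Omega^{m_P}\times\Omega^{m_P}$ with $m_P\ge 1$, $v_P\in\mathbb C$, and $\Psi_P=\psi^\dagger_{P^+(1)}\cdots\psi^\dagger_{P^+(m_P)}\psi_{P^-(1)}\cdots\psi_{P^-(m_P)}$. For $\beta\ge 0$ put $Z=\mathrm{Tr}\,e^{-\beta(H_0+V)}$, $Z_0=\mathrm{Tr}\,e^{-\beta H_0}$, $\langle A\rangle_0=\mathrm{Tr}(Ae^{-\beta H_0})/Z_0$ and $A(\tau)=e^{\tau H_0}Ae^{-\tau H_0}$. Let $$\mathcal E(\{P_i,\tau_i\}_{i\in[s]})=\langle\mathcal T(\Psi_{P_1}(\tau_1)\cdots\Psi_{P_s}(\tau_s))\rangle_0,$$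 where $\mathcal T$ orders the factors by non-increasing time (equal times, a null set, by label), and $$\mathcal E_c(\{P_i,\tau_i\}_{i\in[s]})=\sum_{\Pi}(-1)^{|\Pi|-1}(|\Pi|-1)!\prod_{B\in\Pi}\mathcal E(\{P_i,\tau_i\}_{i\in B}),$$ the sum running over all set partitions $\Pi$ of $[s]=\{1,\dots,s\}$. The non-interacting Green's function is $g_\tau(a,b)=-\langle\psi_b^\dagger\psi_a(\tau)\rangle_0$ for $\tau<0$ and $g_\tau(a,b)=\langle\psi_a(\tau)\psi_b^\dagger\rangle_0$ for $\tau\ge 0$. **Theorem.** There are absolute constants $C,K>0$ such that the following holds for all data as above. Assume that * $\sum_{b\in\Omega}|g_\tau(a,b)|\le L_g$ for all $\tau\in[-\beta,\beta]$ and $a\in\Omega$ (the Green's function is $L_g$-summable); * $\sum_{P\in\mathcal P,\,P^-\ni x}|v_P|\le L_V/2$ and $\sum_{P\in\mathcal P,\,P^+\ni x}|v_P|\le L_V/2$ for all $x\in\Omega$ (the potential is $L_V$-summable); * $m_P\le M$ for all $P\in\mathcal P$ (interactions are at most $M$-body). Then, for every $s\ge 1$, the functions $\mathcal E_c$ are integrable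 on $[0,\beta]^s$ and $$\frac1{s!}\sum_{P_1,\dots,P_s\in\mathcal P}|v_{P_1}\cdots v_{P_s}|\int_{[0,\beta]^s}\bigl|\mathcal E_c(\{P_i,\tau_i\}_{i\in[s]})\bigr|\,d\tau_1\cdots d\tau_s\le N\bigl(C\beta M2^{2M}L_gL_V\bigr)^s .$$ Consequently, if $C\beta M2^{2M}L_VL_g<0.99$, then for all $0<\epsilon<1$ and all integers $S\ge 0$ the truncation error $$\mathrm{err}_S=\Bigl|\log(Z/Z_0)-\sum_{s=1}^S\frac{(-1)^s}{s!}\sum_{P_1,\dots,P_s\in\mathcal P}v_{P_1}\cdots v_{P_s}\int_{[0,\beta]^s}\mathcal E_c(\{P_i,\tau_i\}_{i\in[s]})\,d\tau_1\cdots d\tau_s\Bigr|$$ satisfies $\mathrm{err}_S\le N\epsilon$ whenever $S\ge K\log(1/\epsilon)$, and $\mathrm{err}_S\le\epsilon$ whenever $S\ge K\log(N/\epsilon)$ (for $N=0$ the error is $0$ for every $S$). Here $\log(Z/Z_0)$ is the ordinary logarithm of a positive number if $V$ is Hermitian; in general it is a suitable number $\ell\in\mathbb C$, independent of $\epsilon$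 and $S$, with $e^\ell=Z/Z_0$. -/

import Mathlib

/-!
Fermions with a finite set `Ω` of single-particle states, realised on the Fock space with
orthonormal basis indexed by the occupied sets `S : Finset Ω`; operators are matrices in this
basis. The linear order on `Ω` only fixes the signs of the Jordan–Wigner representation.
-/

noncomputable section

namespace Fermion

variable {Ω : Type} [Fintype Ω] [LinearOrder Ω]

/-- Operators on the Fock space of `Ω`. -/
abbrev FockOp (Ω : Type) : Type := Matrix (Finset Ω) (Finset Ω) ℂ

/-- The annihilation operator `ψ_a`: it sends the basis vector of `S` to
`(-1) ^ #{b ∈ S | b < a}` times the basis vector of `S \ {a}` if `a ∈ S`, and to `0` otherwise. -/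
def annihilate (a : Ω) : FockOp Ω := fun T S =>
  if a ∈ S ∧ T = S.erase a then (-1) ^ (S.filter (fun b => b < a)).card else 0

/-- The creation operator `ψ_a†`. -/
def create (a : Ω) : FockOp Ω := (annihilate a).conjTranspose

/-- The label of an interaction term: `m ≥ 1`, an ordered list `P⁺` of `m` states for the creation
operators and an ordered list `P⁻` of `m` states for the annihilation operators. -/
structure MultiIndex (Ω : Type) where
  m : ℕ
  one_le_m : 1 ≤ m
  plus : Fin m → Ω
  minus : Fin m → Ω

/-- `Ψ_P = ψ†_{P⁺(1)} ⋯ ψ†_{P⁺(m)} ψ_{P⁻(1)} ⋯ ψ_{P⁻(m)}`. -/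
def monomial (P : MultiIndex Ω) : FockOp Ω :=
  (List.ofFn fun j => create (P.plus j)).prod * (List.ofFn fun j => annihilate (P.minus j)).prod

/-- The free Hamiltonian `H₀ = ∑ h_{ab} ψ_a† ψ_b`. -/
def freeHam (h : Matrix Ω Ω ℂ) : FockOp Ω :=
  ∑ a, ∑ b, h a b • (create a * annihilate b)

/-- The potential `V = ∑ v_P Ψ_P`, the list of interaction terms being indexed by `ι`. -/
def potential {ι : Type} [Fintype ι] (v : ι → ℂ) (P : ι → MultiIndex Ω) : FockOp Ω :=
  ∑ i, v i • monomial (P i)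

/-- `Tr e^{-β H}`. -/
def partitionFunction (β : ℝ) (H : FockOp Ω) : ℂ :=
  (NormedSpace.exp ((-β : ℂ) • H)).trace

/-- The free thermal expectation `⟨A⟩₀ = Tr (A e^{-β H₀}) / Z₀`. -/
def freeExpect (h : Matrix Ω Ω ℂ) (β : ℝ) (A : FockOp Ω) : ℂ :=
  (A * NormedSpace.exp ((-β : ℂ) • freeHam h)).trace / partitionFunction β (freeHam h)

/-- Imaginary-time evolution `A(τ) = e^{τ H₀} A e^{-τ H₀}`. -/
def evolve (h : Matrix Ω Ω ℂ) (τ : ℝ) (A : FockOp Ω) : FockOp Ω :=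
  NormedSpace.exp ((τ : ℂ) • freeHam h) * A * NormedSpace.exp ((-τ : ℂ) • freeHam h)

/-- The time-ordered non-interacting Green's function `g_τ(a, b)`. -/
def green (h : Matrix Ω Ω ℂ) (β τ : ℝ) (a b : Ω) : ℂ :=
  if τ < 0 then -freeExpect h β (create b * evolve h τ (annihilate a))
  else freeExpect h β (evolve h τ (annihilate a) * create b)

/-- The Green's function is `L`-summable. -/
def GreenSummable (h : Matrix Ω Ω ℂ) (β L : ℝ) : Prop :=
  ∀ τ ∈ Set.Icc (-β) β, ∀ a, ∑ b, ‖green h β τ a b‖ ≤ L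

open Classical in
/-- The potential is `L`-summable. -/
def PotentialSummable {ι : Type} [Fintype ι] (v : ι → ℂ) (P : ι → MultiIndex Ω) (L : ℝ) : Prop :=
  (∀ x, ∑ i with x ∈ Set.range (P i).minus, ‖v i‖ ≤ L / 2) ∧
    ∀ y, ∑ i with y ∈ Set.range (P i).plus, ‖v i‖ ≤ L / 2

/-- The moment `ℰ({P_i, τ_i}) = ⟨𝒯(Ψ_{P_1}(τ_1) ⋯ Ψ_{P_n}(τ_n))⟩₀`: the factors are multiplied
in the order of non-increasing time (equal times in the order of their labels). -/
def moment (h : Matrix Ω Ω ℂ) (β : ℝ) {n : ℕ} (P : Fin n → MultiIndex Ω) (τ : Fin n → ℝ) : ℂ :=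
  let σ : Equiv.Perm (Fin n) := Tuple.sort fun i => -τ i
  freeExpect h β (List.ofFn fun k => evolve h (τ (σ k)) (monomial (P (σ k)))).prod

/-- The cumulant `ℰ_c({P_i, τ_i})`, a sum over all partitions of the index set. -/
def cumulant (h : Matrix Ω Ω ℂ) (β : ℝ) {s : ℕ} (P : Fin s → MultiIndex Ω) (τ : Fin s → ℝ) : ℂ :=
  ∑ π : Finpartition (Finset.univ : Finset (Fin s)),
    (-1) ^ (π.parts.card - 1) * ((π.parts.card - 1).factorial : ℂ) *
      ∏ B ∈ π.parts, moment h β (fun k => P (B.orderEmbOfFin rfl k))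
        (fun k => τ (B.orderEmbOfFin rfl k))

/-- The box `[0, β]^s`. -/
def timeBox (β : ℝ) (s : ℕ) : Set (Fin s → ℝ) := Set.Icc (fun _ => 0) (fun _ => β)

/-- The `s`-th order term of the cumulant expansion of `log (Z / Z₀)`. -/
def cumulantTerm {ι : Type} [Fintype ι] (h : Matrix Ω Ω ℂ) (v : ι → ℂ) (P : ι → MultiIndex Ω)
    (β : ℝ) (s : ℕ) : ℂ :=
  (-1) ^ s / (s.factorial : ℂ) * ∑ p : Fin s → ι, (∏ k, v (p k)) *
    ∫ τ in timeBox β s, cumulant h β (fun k => P (p k)) τ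

/-- The `s`-th order term with absolute values inside the sum and the integral. -/
def absCumulantTerm {ι : Type} [Fintype ι] (h : Matrix Ω Ω ℂ) (v : ι → ℂ) (P : ι → MultiIndex Ω)
    (β : ℝ) (s : ℕ) : ℝ :=
  1 / (s.factorial : ℝ) * ∑ p : Fin s → ι, ‖∏ k, v (p k)‖ *
    ∫ τ in timeBox β s, ‖cumulant h β (fun k => P (p k)) τ‖

end Fermion

end

/-! The proof combines three mechanisms: determinants of propagators bounded by one however large
they are, an expansion of the cumulants in trees, and summability of the Green's function and the
potential along each tree.

Wick's theorem (`thermal_wick`, `moment_eq_det`) writes a moment as a product of vertex signs times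
the determinant of the time-ordered propagators. To isolate the cumulant, a cluster is grown from
the vertex 0: all couplings between the cluster X and its complement are multiplied by t. At t = 0
the determinant factorises; the derivative in t produces one contraction joining X to a new vertex
and replaces one row of the determinant by a unit vector. Iteration gives `detOn_eq_sum_clus`, which
has the form of the recursion between moments and cumulants. That recursion has only one solution
(`eq_cumul_of_recursion`), so the cluster sums are the cumulants up to the vertex signs.

Once all lines of a tree are extracted, there remains a determinant of propagators multiplied
entrywise by a positive semidefinite weight matrix with unit diagonal. The weights are inner
products of unit vectors; with these vectors placed in extra copies of the system, the determinant
is, up to a sign, again a free expectation of a time-ordered product of contractions on a larger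
Fock space. A multi-factor Hölder inequality for traces, proved with the three lines theorem, bounds
it by one (`norm_det_propagator_le_one`). Hence no factorial in the number of fields appears.

In the tree sum, each line costs at most λ = M² L_g L_V after summation over the label of the new
vertex, and the interpolation integrals compensate for the number of trees: in total (s-1)! e^s
λ^(s-1) (`sum_agree_treeSum_le`), and the factorial is cancelled by 1/s!. The root contributes N L_V
/ 2. So the s-th order is at most N (e β M² L_g L_V)^s (`absCumulantTerm_le`), which is stronger
than the bound claimed.

For the logarithm, the Dyson series expands the partition function with potential zV, divided by Z₀,
into a power series A(z) whose coefficients are integrated moments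
(`tendsto_partitionFunction_series`). The integrated recursion `momentSum_succ` says A' = B' A for
the series B of integrated cumulants. Hence A e^{-B} is constant on [0, 1], ℓ = B(1) is a logarithm
of Z/Z₀, and the truncation error is a geometric tail. -/

noncomputable section

namespace Fermion

/-! ### The canonical anticommutation relations in the Jordan–Wigner representation. -/

section
set_option linter.unusedSimpArgs false

open Matrix

variable {Ω : Type} [LinearOrder Ω]

/-- The Jordan–Wigner sign of `a` relative to the occupied set `S`. -/
def jwSign (a : Ω) (S : Finset Ω) : ℂ := (-1) ^ (S.filter (fun b => b < a)).card

theorem jwSign_mul_self (a : Ω) (S : Finset Ω) : jwSign a S * jwSign a S = 1 := by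
  rw [jwSign, ← mul_pow]; simp

theorem jwSign_erase_self (a : Ω) (S : Finset Ω) : jwSign a (S.erase a) = jwSign a S := by
  unfold jwSign
  congr 2
  ext x
  simp only [Finset.mem_filter, Finset.mem_erase]
  exact ⟨fun h => ⟨h.1.2, h.2⟩, fun h => ⟨⟨h.2.ne, h.1⟩, h.2⟩⟩

theorem jwSign_insert_self (a : Ω) (S : Finset Ω) : jwSign a (insert a S) = jwSign a S := by
  unfold jwSign
  rw [Finset.filter_insert, if_neg (lt_irrefl a)]

theorem jwSign_insert_of_lt {a b : Ω} {S : Finset Ω} (hb : b ∉ S) (h : b < a) :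
    jwSign a (insert b S) = -jwSign a S := by
  unfold jwSign
  rw [Finset.filter_insert, if_pos h, Finset.card_insert_of_notMem (by simp [hb]), pow_succ]
  ring

theorem jwSign_insert_of_gt {a b : Ω} {S : Finset Ω} (h : a < b) :
    jwSign a (insert b S) = jwSign a S := by
  unfold jwSign
  rw [Finset.filter_insert, if_neg h.not_gt]

theorem jwSign_erase_of_lt {a b : Ω} {S : Finset Ω} (hb : b ∈ S) (h : b < a) :
    jwSign a (S.erase b) = -jwSign a S := by
  conv_rhs => rw [← Finset.insert_erase hb, jwSign_insert_of_lt (Finset.notMem_erase b S) h]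
  simp

theorem jwSign_erase_of_gt {a b : Ω} {S : Finset Ω} (hb : b ∈ S) (h : a < b) :
    jwSign a (S.erase b) = jwSign a S := by
  conv_rhs => rw [← Finset.insert_erase hb, jwSign_insert_of_gt h]

variable [Fintype Ω]

/-- The basis vector of the occupied set `S`. -/
def fockBasis (S : Finset Ω) : Finset Ω → ℂ := Pi.single S 1

theorem annihilate_mulVec_single (a : Ω) (S : Finset Ω) :
    annihilate a *ᵥ fockBasis S =
      if a ∈ S then jwSign a S • fockBasis (S.erase a) else 0 := by
  ext T
  unfold fockBasis
  rw [mulVec_single_one]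
  by_cases ha : a ∈ S
  · by_cases hT : T = S.erase a
    · subst hT; simp [annihilate, col, ha, jwSign]
    · simp [annihilate, col, ha, hT]
  · simp [annihilate, col, ha]

theorem create_mulVec_single (a : Ω) (S : Finset Ω) :
    create a *ᵥ fockBasis S =
      if a ∈ S then 0 else jwSign a S • fockBasis (insert a S) := by
  ext T
  unfold fockBasis
  rw [mulVec_single_one]
  have key : (a ∈ T ∧ S = T.erase a) ↔ (a ∉ S ∧ T = insert a S) := by
    constructor
    · rintro ⟨h, rfl⟩; simp [Finset.insert_erase h]
    · rintro ⟨h, rfl⟩; simp [Finset.erase_insert h]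
  simp only [create, conjTranspose, annihilate, col, transpose_apply, Matrix.map_apply, key]
  by_cases ha : a ∈ S
  · simp [ha]
  · by_cases hT : T = insert a S
    · subst hT
      have := jwSign_insert_self a S
      simp only [jwSign] at this
      simp [ha, this, jwSign]
    · simp [ha, hT]

/-- Removing a smaller state flips the sign of a larger one, while removing a larger state does not
affect a smaller one. So exactly one of the two orders acquires an extra minus sign on each basis
vector. -/
theorem annihilate_anticomm (a b : Ω) :
    annihilate a * annihilate b + annihilate b * annihilate a = 0 := by
  refine Matrix.ext_of_mulVec_single fun S => ?_
  change _ *ᵥ fockBasis S = _ *ᵥ fockBasis S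
  rw [add_mulVec, ← mulVec_mulVec, ← mulVec_mulVec, annihilate_mulVec_single,
    annihilate_mulVec_single, zero_mulVec]
  wlog hab : a ≤ b generalizing a b
  · rw [add_comm]; exact this b a (le_of_not_ge hab)
  rcases hab.eq_or_lt with rfl | hlt
  · by_cases ha : a ∈ S <;> simp [ha, mulVec_smul, annihilate_mulVec_single]
  · by_cases ha : a ∈ S <;> by_cases hb : b ∈ S <;>
      simp [ha, hb, mulVec_smul, annihilate_mulVec_single, hlt.ne, hlt.ne',
        jwSign_erase_of_lt, jwSign_erase_of_gt, hlt, smul_smul, Finset.erase_right_comm (a := a),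
        mul_comm]

theorem annihilate_create_anticomm (a b : Ω) :
    annihilate a * create b + create b * annihilate a = if a = b then 1 else 0 := by
  refine Matrix.ext_of_mulVec_single fun S => ?_
  change _ *ᵥ fockBasis S = _ *ᵥ fockBasis S
  rw [add_mulVec, ← mulVec_mulVec, ← mulVec_mulVec, annihilate_mulVec_single,
    create_mulVec_single]
  rcases lt_trichotomy a b with hlt | rfl | hlt
  · by_cases ha : a ∈ S <;> by_cases hb : b ∈ S <;>
      simp [ha, hb, mulVec_smul, annihilate_mulVec_single, create_mulVec_single, hlt.ne, hlt.ne',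
        jwSign_erase_of_lt, jwSign_insert_of_gt, hlt, smul_smul,
        mul_comm, Finset.erase_insert_of_ne hlt.ne']
  · by_cases ha : a ∈ S <;>
      simp [ha, mulVec_smul, annihilate_mulVec_single, create_mulVec_single,
        jwSign_erase_self, jwSign_insert_self, smul_smul, jwSign_mul_self, Finset.insert_erase]
  · by_cases ha : a ∈ S <;> by_cases hb : b ∈ S <;>
      simp [ha, hb, mulVec_smul, annihilate_mulVec_single, create_mulVec_single, hlt.ne, hlt.ne',
        jwSign_erase_of_gt, jwSign_insert_of_lt, hlt, smul_smul,
        mul_comm, Finset.erase_insert_of_ne hlt.ne]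

end

/-! ### Exponentials, free evolution and the Kubo–Martin–Schwinger condition. -/

section

open Matrix

section Exponential

open scoped Matrix.Norms.L2Operator ComplexOrder

variable {n : Type} [Fintype n] [DecidableEq n]

/-- The one-parameter group `z ↦ e^{z H}`. -/
def expm (H : Matrix n n ℂ) (z : ℂ) : Matrix n n ℂ := NormedSpace.exp (z • H)

theorem expm_zero (H : Matrix n n ℂ) : expm H 0 = 1 := by simp [expm]

theorem expm_add (H : Matrix n n ℂ) (z w : ℂ) : expm H (z + w) = expm H z * expm H w := by
  rw [expm, add_smul, Matrix.exp_add_of_commute _ _ (((Commute.refl H).smul_left z).smul_right w)]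
  rfl

theorem expm_mul_neg (H : Matrix n n ℂ) (z : ℂ) : expm H z * expm H (-z) = 1 := by
  rw [← expm_add, add_neg_cancel, expm_zero]

theorem expm_neg_mul (H : Matrix n n ℂ) (z : ℂ) : expm H (-z) * expm H z = 1 := by
  rw [← expm_add, neg_add_cancel, expm_zero]

theorem expm_conjTranspose {H : Matrix n n ℂ} (hH : H.IsHermitian) (z : ℂ) :
    (expm H z)ᴴ = expm H (star z) := by
  rw [expm, ← Matrix.exp_conjTranspose, conjTranspose_smul, hH.eq]; rfl

theorem hasDerivAt_expm (H : Matrix n n ℂ) (z : ℂ) :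
    HasDerivAt (expm H) (expm H z * H) z :=
  hasDerivAt_exp_smul_const (𝕂 := ℂ) H z

theorem hasDerivAt_expm' (H : Matrix n n ℂ) (z : ℂ) :
    HasDerivAt (expm H) (H * expm H z) z :=
  hasDerivAt_exp_smul_const' (𝕂 := ℂ) H z

theorem continuous_expm (H : Matrix n n ℂ) : Continuous (expm H) :=
  continuous_iff_continuousAt.2 fun z => (hasDerivAt_expm H z).continuousAt

theorem expm_eq_conjTranspose_mul_self {H : Matrix n n ℂ} (hH : H.IsHermitian) (t : ℝ) :
    expm H t = (expm H (t / 2 : ℝ))ᴴ * expm H (t / 2 : ℝ) := by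
  rw [expm_conjTranspose hH, ← expm_add]
  congr 1
  simp

theorem posSemidef_expm {H : Matrix n n ℂ} (hH : H.IsHermitian) (t : ℝ) :
    (expm H t).PosSemidef := by
  rw [expm_eq_conjTranspose_mul_self hH]; exact posSemidef_conjTranspose_mul_self _

theorem posDef_expm {H : Matrix n n ℂ} (hH : H.IsHermitian) (t : ℝ) :
    (expm H t).PosDef :=
  (posSemidef_expm hH t).posDef_iff_isUnit.2
    (IsUnit.of_mul_eq_one _ (expm_mul_neg H t))

theorem trace_expm_pos [Nonempty n] {H : Matrix n n ℂ} (hH : H.IsHermitian) (t : ℝ) :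
    0 < (expm H t).trace :=
  (posDef_expm hH t).trace_pos

theorem trace_expm_ne_zero [Nonempty n] {H : Matrix n n ℂ} (hH : H.IsHermitian) (t : ℝ) :
    (expm H t).trace ≠ 0 := (trace_expm_pos hH t).ne'

/-- The identity plus a positive semidefinite matrix is positive definite. The inverse solves the
linear system that the Kubo–Martin–Schwinger condition imposes on two-point functions. -/
theorem exists_inv_one_add_expm {H : Matrix n n ℂ} (hH : H.IsHermitian) (t : ℝ) :
    ∃ G : Matrix n n ℂ, G * (1 + expm H t) = 1 ∧ (1 + expm H t) * G = 1 := by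
  have h : (1 + expm H t).PosDef := PosDef.one.add_posSemidef (posSemidef_expm hH t)
  obtain ⟨u, hu⟩ := h.isUnit
  exact ⟨↑u⁻¹, by rw [← hu]; exact u.inv_mul, by rw [← hu]; exact u.mul_inv⟩

end Exponential

variable {Ω : Type} [LinearOrder Ω] [Fintype Ω]

theorem freeHam_isHermitian {h : Matrix Ω Ω ℂ} (hh : h.IsHermitian) : (freeHam h).IsHermitian := by
  unfold IsHermitian freeHam
  simp only [conjTranspose_sum, conjTranspose_smul, conjTranspose_mul]
  rw [Finset.sum_comm]
  refine Finset.sum_congr rfl fun a _ => Finset.sum_congr rfl fun b _ => ?_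
  rw [hh.apply, create, create, conjTranspose_conjTranspose]

theorem freeHam_commutator (h : Matrix Ω Ω ℂ) (c : Ω) :
    freeHam h * annihilate c - annihilate c * freeHam h = -∑ b, h c b • annihilate b := by
  have key : ∀ a b : Ω, create a * annihilate b * annihilate c -
      annihilate c * (create a * annihilate b) = -((if c = a then (1 : FockOp Ω) else 0) * annihilate b) := by
    intro a b
    rw [← annihilate_create_anticomm, mul_assoc, eq_neg_of_add_eq_zero_left (annihilate_anticomm b c)]
    noncomm_ring
  simp only [freeHam, Finset.sum_mul, Finset.mul_sum, ← Finset.sum_sub_distrib, smul_mul_assoc,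
    mul_smul_comm, ← smul_sub, key]
  rw [Finset.sum_eq_single c]
  · simp
  · intro a _ ha; simp [ha.symm]
  · simp

/-- The annihilation operator of the covector `f`. -/
def ann (f : Ω → ℂ) : FockOp Ω := ∑ a, f a • annihilate a

/-- The creation operator of the vector `g`. -/
def cre (g : Ω → ℂ) : FockOp Ω := ∑ a, g a • create a

theorem ann_single (a : Ω) : ann (Pi.single a 1) = annihilate a := by
  rw [ann, Finset.sum_eq_single a] <;> simp +contextual

theorem cre_single (a : Ω) : cre (Pi.single a 1) = create a := by
  rw [cre, Finset.sum_eq_single a] <;> simp +contextual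

theorem ann_conjTranspose (f : Ω → ℂ) : (ann f)ᴴ = cre (star f) := by
  simp [ann, cre, conjTranspose_sum, create]

theorem ann_anticomm (f g : Ω → ℂ) : ann f * ann g + ann g * ann f = 0 := by
  simp only [ann, Finset.sum_mul, Finset.mul_sum, smul_mul_assoc, mul_smul_comm, Finset.smul_sum]
  rw [Finset.sum_comm, ← Finset.sum_add_distrib]
  refine Finset.sum_eq_zero fun a _ => ?_
  rw [← Finset.sum_add_distrib]
  refine Finset.sum_eq_zero fun b _ => ?_
  rw [smul_smul, smul_smul, mul_comm, ← smul_add, annihilate_anticomm, smul_zero]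

theorem cre_anticomm (f g : Ω → ℂ) : cre f * cre g + cre g * cre f = 0 := by
  have := congrArg conjTranspose (ann_anticomm (star g) (star f))
  simpa [ann_conjTranspose] using this

theorem ann_cre_anticomm (f g : Ω → ℂ) : ann f * cre g + cre g * ann f = (f ⬝ᵥ g) • 1 := by
  simp only [ann, cre, Finset.sum_mul, Finset.mul_sum, smul_mul_assoc, mul_smul_comm, Finset.smul_sum]
  rw [Finset.sum_comm, ← Finset.sum_add_distrib, dotProduct, Finset.sum_smul]
  refine Finset.sum_congr rfl fun a _ => ?_
  rw [← Finset.sum_add_distrib, Finset.sum_eq_single a]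
  · rw [smul_smul, smul_smul, mul_comm, ← smul_add, annihilate_create_anticomm, if_pos rfl]
  · intro b _ hb
    rw [smul_smul, smul_smul, mul_comm, ← smul_add, annihilate_create_anticomm]
    simp [hb.symm]
  · simp

theorem evolve_eq (h : Matrix Ω Ω ℂ) (τ : ℝ) (A : FockOp Ω) :
    evolve h τ A = expm (freeHam h) τ * A * expm (freeHam h) (-τ) := rfl

theorem evolve_zero (h : Matrix Ω Ω ℂ) (A : FockOp Ω) : evolve h 0 A = A := by
  simp [evolve_eq, expm_zero]

theorem evolve_mul (h : Matrix Ω Ω ℂ) (τ : ℝ) (A B : FockOp Ω) :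
    evolve h τ (A * B) = evolve h τ A * evolve h τ B := by
  simp only [evolve_eq]
  rw [show expm (freeHam h) τ * A * expm (freeHam h) (-τ) * (expm (freeHam h) τ * B *
    expm (freeHam h) (-τ)) = expm (freeHam h) τ * A * (expm (freeHam h) (-τ) * expm (freeHam h) τ)
    * B * expm (freeHam h) (-τ) by noncomm_ring, expm_neg_mul]
  noncomm_ring

theorem evolve_one (h : Matrix Ω Ω ℂ) (τ : ℝ) : evolve h τ (1 : FockOp Ω) = 1 := by
  simp [evolve_eq, expm_mul_neg]

theorem evolve_evolve (h : Matrix Ω Ω ℂ) (σ τ : ℝ) (A : FockOp Ω) :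
    evolve h σ (evolve h τ A) = evolve h (σ + τ) A := by
  simp only [evolve_eq]
  push_cast
  rw [neg_add_rev, expm_add, expm_add]
  noncomm_ring

theorem evolve_list_prod (h : Matrix Ω Ω ℂ) (τ : ℝ) (L : List (FockOp Ω)) :
    evolve h τ L.prod = (L.map (evolve h τ)).prod := by
  induction L with
  | nil => simp [evolve_one]
  | cons a L ih => simp [evolve_mul, ih]

theorem evolve_smul (h : Matrix Ω Ω ℂ) (τ : ℝ) (c : ℂ) (A : FockOp Ω) :
    evolve h τ (c • A) = c • evolve h τ A := by
  simp [evolve_eq]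

theorem evolve_sum (h : Matrix Ω Ω ℂ) (τ : ℝ) {ι : Type} (s : Finset ι) (A : ι → FockOp Ω) :
    evolve h τ (∑ i ∈ s, A i) = ∑ i ∈ s, evolve h τ (A i) := by
  simp [evolve_eq, Finset.mul_sum, Finset.sum_mul]

-- The evolved operators y_b(z) satisfy y' = -h y by `freeHam_commutator`, so ∑ (e^{zh})_{ab} y_b(z)
-- has zero derivative and equals its value ψ_a at z = 0. Inverting e^{zh} gives the formula.
open scoped Matrix.Norms.L2Operator in
theorem evolve_annihilate (h : Matrix Ω Ω ℂ) (τ : ℝ) (a : Ω) :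
    evolve h τ (annihilate a) = ∑ b, expm h (-τ) a b • annihilate b := by
  set H := freeHam h
  let y : ℂ → Ω → FockOp Ω := fun z b => expm H z * annihilate b * expm H (-z)
  have hy : ∀ z b, HasDerivAt (fun z => y z b) (-∑ c, h b c • y z c) z := by
    intro z b
    have h1 := ((hasDerivAt_expm H z).mul_const (annihilate b)).mul
      ((hasDerivAt_expm' H (-z)).scomp z (hasDerivAt_neg z))
    refine h1.congr_deriv ?_
    simp only [y, Function.comp_def, neg_smul, one_smul]
    rw [show expm H z * H * annihilate b * expm H (-z) + expm H z * annihilate b *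
      -(H * expm H (-z)) = expm H z * (H * annihilate b - annihilate b * H) * expm H (-z) by
        noncomm_ring, freeHam_commutator]
    simp [Finset.mul_sum, Finset.sum_mul]
  have he : ∀ z a b, HasDerivAt (fun z => expm h z a b) ((expm h z * h) a b) z := fun z a b =>
    hasDerivAt_pi.1 (hasDerivAt_pi.1 (hasDerivAt_expm h z) a) b
  have hx : ∀ a z, HasDerivAt (fun z => ∑ b, expm h z a b • y z b) 0 z := by
    intro a z
    have := HasDerivAt.fun_sum (u := Finset.univ) fun b _ => (he z a b).smul (hy z b)
    refine this.congr_deriv ?_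
    rw [Finset.sum_add_distrib]
    simp only [smul_neg, Finset.sum_neg_distrib, Finset.smul_sum, Matrix.mul_apply, Finset.sum_smul]
    rw [Finset.sum_comm (f := fun b c => expm h z a b • h b c • y z c)]
    simp [smul_smul]
  have hc : ∀ a, ∑ b, expm h τ a b • y τ b = annihilate a := by
    intro a
    rw [is_const_of_deriv_eq_zero (fun z => (hx a z).differentiableAt) (fun z => (hx a z).deriv) τ 0]
    simp [y, expm_zero, Matrix.one_apply]
  have hs : ∑ b, expm h (-τ) a b • annihilate b = y τ a := by
    simp_rw [← hc, Finset.smul_sum, smul_smul]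
    rw [Finset.sum_comm]
    simp_rw [← Finset.sum_smul, ← Matrix.mul_apply, expm_neg_mul]
    simp [Matrix.one_apply]
  rw [hs, evolve_eq]

theorem evolve_ann (h : Matrix Ω Ω ℂ) (τ : ℝ) (f : Ω → ℂ) :
    evolve h τ (ann f) = ann (f ᵥ* expm h (-τ)) := by
  simp only [ann, evolve_sum, evolve_smul, evolve_annihilate, Finset.smul_sum, smul_smul,
    vecMul, dotProduct, Finset.sum_smul]
  rw [Finset.sum_comm]

theorem evolve_conjTranspose {h : Matrix Ω Ω ℂ} (hh : h.IsHermitian) (τ : ℝ) (A : FockOp Ω) :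
    (evolve h τ A)ᴴ = evolve h (-τ) Aᴴ := by
  simp only [evolve_eq, conjTranspose_mul, expm_conjTranspose (freeHam_isHermitian hh)]
  simp [mul_assoc]

theorem evolve_cre {h : Matrix Ω Ω ℂ} (hh : h.IsHermitian) (τ : ℝ) (g : Ω → ℂ) :
    evolve h τ (cre g) = cre (expm h τ *ᵥ g) := by
  have := congrArg conjTranspose (evolve_ann h (-τ) (star g))
  rw [evolve_conjTranspose hh, ann_conjTranspose, ann_conjTranspose, star_star, neg_neg,
    star_vecMul, expm_conjTranspose hh, star_star] at this
  simpa using this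

/-- The free expectation as a linear functional. -/
def freeExpectₗ (h : Matrix Ω Ω ℂ) (β : ℝ) : FockOp Ω →ₗ[ℂ] ℂ where
  toFun := freeExpect h β
  map_add' A B := by simp [freeExpect, add_mul, add_div]
  map_smul' c A := by simp [freeExpect, mul_div_assoc]

theorem freeExpectₗ_apply (h : Matrix Ω Ω ℂ) (β : ℝ) (A : FockOp Ω) :
    freeExpectₗ h β A = freeExpect h β A := rfl

theorem freeExpect_eq (h : Matrix Ω Ω ℂ) (β : ℝ) (A : FockOp Ω) :
    freeExpect h β A = (A * expm (freeHam h) (-β)).trace / (expm (freeHam h) (-β)).trace := rfl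

theorem freeExpect_one {h : Matrix Ω Ω ℂ} (hh : h.IsHermitian) (β : ℝ) :
    freeExpect h β 1 = 1 := by
  rw [freeExpect_eq, one_mul, div_self]
  simpa using trace_expm_ne_zero (freeHam_isHermitian hh) (-β)

/-- The Kubo–Martin–Schwinger condition. -/
theorem freeExpect_mul_comm (h : Matrix Ω Ω ℂ) (β : ℝ) (A B : FockOp Ω) :
    freeExpect h β (A * B) = freeExpect h β (evolve h β B * A) := by
  rw [freeExpect_eq, freeExpect_eq]
  congr 1
  rw [evolve_eq, show expm (freeHam h) β * B * expm (freeHam h) (-β) * A * expm (freeHam h) (-β) =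
    (expm (freeHam h) β * B) * (expm (freeHam h) (-β) * A * expm (freeHam h) (-β)) by
      noncomm_ring, Matrix.trace_mul_comm (expm (freeHam h) β * B),
    show expm (freeHam h) (-β) * A * expm (freeHam h) (-β) * (expm (freeHam h) β * B) =
    expm (freeHam h) (-β) * A * (expm (freeHam h) (-β) * expm (freeHam h) β) * B by noncomm_ring,
    expm_neg_mul, mul_one, Matrix.trace_mul_comm (A * B), ← mul_assoc]

end

/-! ### Laplace expansion along words and Wick's theorem for abstract quasi-free functionals. -/

section

open Matrix

section Splits

variable {X α β : Type}

/-- All ways of singling out one letter of a list. -/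
def splits : List X → List (List X × X × List X)
  | [] => []
  | x :: L => ([], x, L) :: (splits L).map fun t => (x :: t.1, t.2.1, t.2.2)

theorem eq_of_mem_splits {L : List X} {t : List X × X × List X} (ht : t ∈ splits L) :
    L = t.1 ++ t.2.1 :: t.2.2 := by
  induction L generalizing t with
  | nil => simp [splits] at ht
  | cons x L ih =>
    simp only [splits, List.mem_cons, List.mem_map] at ht
    rcases ht with rfl | ⟨u, hu, rfl⟩
    · rfl
    · simp [← ih hu]

theorem list_sum_comm {X Y : Type} (l : List X) (m : List Y) (f : X → Y → ℂ) :
    (l.map fun a => (m.map fun b => f a b).sum).sum =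
      (m.map fun b => (l.map fun a => f a b).sum).sum := by
  induction l with
  | nil => simp
  | cons a l ih => simp [ih, List.sum_map_add]

theorem sum_splits_eq (L : List X) (F : List X × X × List X → ℂ) :
    ((splits L).map F).sum = ∑ j : Fin L.length, F (L.take j, L[j], L.drop (j + 1)) := by
  induction L generalizing F with
  | nil => simp [splits]
  | cons x L ih =>
    simp only [splits, List.map_cons, List.map_map, List.sum_cons, ih, List.length_cons]
    rw [Fin.sum_univ_succ]
    simp

/-- The determinant of `M` restricted to a list of rows and a list of columns, expanded along the
rows. -/
def wdet (M : α → β → ℂ) : List α → List β → ℂ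
  | [], _ => 1
  | r :: R, C => ((splits C).map fun t =>
      (-1) ^ t.1.length * M r t.2.1 * wdet M R (t.1 ++ t.2.2)).sum

/-- `wdet` expands along rows, but a word may begin with a column letter, and then the expansion
along the first column is needed. Expanding once in each direction, the two double sums differ only
by the order of summation. -/
theorem wdet_cons_right (M : α → β → ℂ) (R : List α) (c : β) (C : List β)
    (hl : R.length = C.length + 1) :
    wdet M R (c :: C) = ((splits R).map fun t =>
      (-1) ^ t.1.length * M t.2.1 c * wdet M (t.1 ++ t.2.2) C).sum := by
  induction R generalizing C with
  | nil => simp at hl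
  | cons r R ih =>
    simp only [List.length_cons, add_left_inj] at hl
    simp only [wdet, splits, List.map_cons, List.map_map, List.sum_cons, Function.comp_def,
      List.length_nil, pow_zero, one_mul, List.nil_append, List.length_cons, List.cons_append]
    congr 1
    calc _ = ((splits C).map fun t => ((splits R).map fun u => -((-1) ^ t.1.length * M r t.2.1 *
          ((-1) ^ u.1.length * M u.2.1 c * wdet M (u.1 ++ u.2.2) (t.1 ++ t.2.2)))).sum).sum := by
          congr 1
          refine List.map_congr_left fun t ht => ?_
          have := congrArg List.length (eq_of_mem_splits ht)
          simp only [List.length_append, List.length_cons] at this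
          rw [ih _ (by rw [List.length_append]; omega), pow_succ, ← List.sum_map_mul_left]
          congr 1
          refine List.map_congr_left fun u _ => ?_
          ring
      _ = _ := by
          rw [list_sum_comm]
          congr 1
          refine List.map_congr_left fun u _ => ?_
          rw [← List.sum_map_mul_left]
          congr 1
          refine List.map_congr_left fun t _ => ?_
          ring

theorem eraseIdx_ofFn {n : ℕ} (C : Fin (n + 1) → β) (j : Fin (n + 1)) :
    (List.ofFn C).eraseIdx j = List.ofFn fun i => C (j.succAbove i) := by
  apply List.ext_getElem
  · rw [List.length_eraseIdx_of_lt (by simp; omega)]; simp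
  · intro i h1 h2
    simp only [List.getElem_eraseIdx, List.getElem_ofFn]
    split_ifs with h
    · congr 1
      ext
      simp [Fin.succAbove, Fin.lt_def, h]
    · congr 1
      ext
      simp [Fin.succAbove, Fin.lt_def, h]

theorem wdet_ofFn (M : α → β → ℂ) {n : ℕ} (R : Fin n → α) (C : Fin n → β) :
    wdet M (List.ofFn R) (List.ofFn C) = (Matrix.of fun i j => M (R i) (C j)).det := by
  induction n with
  | zero => simp [wdet]
  | succ n ih =>
    rw [List.ofFn_succ (f := R), wdet, sum_splits_eq, Matrix.det_succ_row_zero]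
    rw [← (finCongr (List.length_ofFn (f := C))).sum_comp]
    refine Finset.sum_congr rfl fun j _ => ?_
    have hj : (j : ℕ) < n + 1 := by simpa using j.2
    have := eraseIdx_ofFn C (finCongr (List.length_ofFn (f := C)) j)
    rw [List.eraseIdx_eq_take_drop_succ] at this
    simp only [finCongr_apply, Fin.val_cast] at this
    rw [this, ih]
    simp only [List.length_take, List.length_ofFn, min_eq_left hj.le, Fin.getElem_fin,
      List.getElem_ofFn, finCongr_apply, Fin.val_cast, Matrix.of_apply]
    rfl

/-- The row letters of a word. -/
def rowLetters (L : List (α ⊕ β)) : List α := L.filterMap Sum.getLeft?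

/-- The column letters of a word. -/
def colLetters (L : List (α ⊕ β)) : List β := L.filterMap Sum.getRight?

@[simp] theorem rowLetters_nil : rowLetters ([] : List (α ⊕ β)) = [] := rfl
@[simp] theorem colLetters_nil : colLetters ([] : List (α ⊕ β)) = [] := rfl
@[simp] theorem rowLetters_inl (r : α) (L : List (α ⊕ β)) :
    rowLetters (Sum.inl r :: L) = r :: rowLetters L := rfl
@[simp] theorem rowLetters_inr (c : β) (L : List (α ⊕ β)) :
    rowLetters (Sum.inr c :: L) = rowLetters L := rfl
@[simp] theorem colLetters_inl (r : α) (L : List (α ⊕ β)) :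
    colLetters (Sum.inl r :: L) = colLetters L := rfl
@[simp] theorem colLetters_inr (c : β) (L : List (α ⊕ β)) :
    colLetters (Sum.inr c :: L) = c :: colLetters L := rfl
@[simp] theorem rowLetters_append (L L' : List (α ⊕ β)) :
    rowLetters (L ++ L') = rowLetters L ++ rowLetters L' := List.filterMap_append
@[simp] theorem colLetters_append (L L' : List (α ⊕ β)) :
    colLetters (L ++ L') = colLetters L ++ colLetters L' := List.filterMap_append

theorem length_eq_rowLetters_add_colLetters (L : List (α ⊕ β)) :
    L.length = (rowLetters L).length + (colLetters L).length := by
  induction L with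
  | nil => rfl
  | cons x L ih => cases x <;> simp [ih] <;> omega

/-- The sign of moving all row letters of a word to the left. -/
def shuffleSign : List (α ⊕ β) → ℂ
  | [] => 1
  | Sum.inl _ :: L => shuffleSign L
  | Sum.inr _ :: L => (-1) ^ (rowLetters L).length * shuffleSign L

theorem shuffleSign_insert_inr (A B : List (α ⊕ β)) (c : β) :
    shuffleSign (A ++ Sum.inr c :: B) = (-1) ^ (rowLetters B).length * shuffleSign (A ++ B) := by
  induction A with
  | nil => rfl
  | cons x A ih =>
    cases x with
    | inl r => simpa [shuffleSign] using ih
    | inr c' => simp [shuffleSign, ih]; ring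

theorem shuffleSign_insert_inl (A B : List (α ⊕ β)) (r : α) :
    shuffleSign (A ++ Sum.inl r :: B) = (-1) ^ (colLetters A).length * shuffleSign (A ++ B) := by
  induction A with
  | nil => simp [shuffleSign]
  | cons x A ih =>
    cases x with
    | inl r => simpa [shuffleSign] using ih
    | inr c' => simp [shuffleSign, ih]; ring

/-- Wick's theorem sums over all letters of a word, the Laplace expansion over one kind of letter.
The letters of the wrong kind contribute zero, which identifies the two sums. -/
theorem sum_splits_colLetters (L : List (α ⊕ β)) (g : List β → β → List β → ℂ) :
    ((splits L).map fun t => Sum.elim (fun _ => 0)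
      (fun c => g (colLetters t.1) c (colLetters t.2.2)) t.2.1).sum =
      ((splits (colLetters L)).map fun t => g t.1 t.2.1 t.2.2).sum := by
  induction L generalizing g with
  | nil => rfl
  | cons x L ih =>
    cases x with
    | inl r => simpa [splits, Function.comp_def] using ih g
    | inr c => simpa [splits, Function.comp_def] using ih fun A => g (c :: A)

theorem sum_splits_rowLetters (L : List (α ⊕ β)) (g : List α → α → List α → ℂ) :
    ((splits L).map fun t => Sum.elim
      (fun r => g (rowLetters t.1) r (rowLetters t.2.2)) (fun _ => 0) t.2.1).sum =
      ((splits (rowLetters L)).map fun t => g t.1 t.2.1 t.2.2).sum := by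
  induction L generalizing g with
  | nil => rfl
  | cons x L ih =>
    cases x with
    | inl r => simpa [splits, Function.comp_def] using ih fun A => g (r :: A)
    | inr c => simpa [splits, Function.comp_def] using ih g

end Splits

section Wick

variable {R : Type} [Ring R] [Algebra ℂ R] {X : Type}

/-- The factor `y` is moved to the right through the word; every anticommutation leaves a scalar
contraction and flips the sign. The prefix `Y` collects the letters already passed and serves only
the induction. -/
theorem mul_list_prod_eq (op : X → R) (y : R) (κ : X → ℂ)
    (hκ : ∀ x, y * op x + op x * y = κ x • 1) (L : List X) (ω : R →ₗ[ℂ] ℂ) (Y : R) :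
    ω (Y * (y * (L.map op).prod)) = ((splits L).map fun t => (-1) ^ t.1.length * κ t.2.1 *
      ω (Y * ((t.1 ++ t.2.2).map op).prod)).sum + (-1) ^ L.length * ω (Y * ((L.map op).prod * y)) := by
  induction L generalizing Y with
  | nil => simp [splits]
  | cons x L ih =>
    simp only [List.map_cons, List.prod_cons, splits, List.map_map, List.sum_cons,
      Function.comp_def, List.length_nil, pow_zero, one_mul, List.nil_append, List.length_cons,
      List.cons_append]
    have h1 : y * (op x * (L.map op).prod) = κ x • (L.map op).prod -
        op x * (y * (L.map op).prod) := by
      rw [← mul_assoc, eq_sub_of_add_eq (hκ x), sub_mul, smul_mul_assoc, one_mul, mul_assoc]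
    rw [h1, mul_sub, map_sub, mul_smul_comm, map_smul, ← mul_assoc Y (op x), ih (Y * op x)]
    simp only [pow_succ, mul_neg, mul_one, neg_mul, smul_eq_mul, mul_assoc]
    rw [show (fun t : List X × X × List X => -((-1) ^ t.1.length * (κ t.2.1 *
      ω (Y * (op x * ((t.1 ++ t.2.2).map op).prod))))) = fun t => (-1) *  ((-1) ^ t.1.length *
      (κ t.2.1 * ω (Y * (op x * ((t.1 ++ t.2.2).map op).prod)))) by ext; ring,
      List.sum_map_mul_left]
    ring

/-- The two-point function of a quasi-free expectation. -/
theorem quasiFree_two_point {Ω : Type} [Fintype Ω] [DecidableEq Ω] (ω : R →ₗ[ℂ] ℂ)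
    (hω : ω 1 = 1) (y : Ω → R) (x : R) (κ : Ω → ℂ) (hκ : ∀ a, y a * x + x * y a = κ a • 1)
    (K N : Matrix Ω Ω ℂ) (hK : ∀ a W, ω (W * y a) = ∑ b, K a b * ω (y b * W))
    (hN : N * (1 + K) = 1) (f : Ω → ℂ) :
    ω ((∑ a, f a • y a) * x) = f ⬝ᵥ (N *ᵥ κ) := by
  have h1 : ((1 + K) *ᵥ fun c => ω (y c * x)) = κ := by
    ext a
    have := congrArg ω (hκ a)
    rw [map_add, hK, map_smul, hω, smul_eq_mul, mul_one] at this
    rw [Matrix.add_mulVec, Matrix.one_mulVec]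
    exact this
  rw [← h1, Matrix.mulVec_mulVec, hN, Matrix.one_mulVec]
  simp [Finset.sum_mul, dotProduct]

/-- Expansion of a quasi-free expectation along the first letter. -/
theorem quasiFree_expand {Ω : Type} [Fintype Ω] [DecidableEq Ω] (op : X → R) (ω : R →ₗ[ℂ] ℂ)
    (hω : ω 1 = 1) (y : Ω → R) (κ : Ω → X → ℂ)
    (hκ : ∀ a x, y a * op x + op x * y a = κ a x • 1) (K N : Matrix Ω Ω ℂ)
    (hK : ∀ a W, ω (W * y a) = ∑ b, K a b * ω (y b * W)) (hN : N * (1 + K) = 1)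
    (f : Ω → ℂ) (L : List X) (hL : Odd L.length) :
    ω ((∑ a, f a • y a) * (L.map op).prod) = ((splits L).map fun t => (-1) ^ t.1.length *
      ω ((∑ a, f a • y a) * op t.2.1) * ω ((t.1 ++ t.2.2).map op).prod).sum := by
  -- Moving y_a through an odd word costs a minus sign, and `hK` brings it back to the front with
  -- the matrix K. So 1 + K applied to the vector of expectations is the vector of contraction sums,
  -- and N inverts this.
  have key : ∀ (a : Ω) (L : List X), Odd L.length → ω (y a * (L.map op).prod) =
      ∑ b, N a b * ((splits L).map fun t => (-1) ^ t.1.length * κ b t.2.1 *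
        ω ((t.1 ++ t.2.2).map op).prod).sum := by
    intro a L hL
    have h1 : ∀ b, ((splits L).map fun t => (-1) ^ t.1.length * κ b t.2.1 *
        ω ((t.1 ++ t.2.2).map op).prod).sum =
        ∑ c, (1 + K) b c * ω (y c * (L.map op).prod) := by
      intro b
      have h2 := mul_list_prod_eq op (y b) (κ b) (hκ b) L ω 1
      simp only [one_mul, hL.neg_one_pow, neg_mul, hK] at h2
      simp only [Matrix.add_apply, add_mul, Finset.sum_add_distrib, Matrix.one_apply, ite_mul,
        one_mul, zero_mul, Finset.sum_ite_eq, Finset.mem_univ, if_true]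
      rw [h2]; ring
    simp only [h1, Finset.mul_sum]
    rw [Finset.sum_comm]
    simp only [← mul_assoc, ← Finset.sum_mul, ← Matrix.mul_apply, hN, Matrix.one_apply, ite_mul,
        one_mul, zero_mul, Finset.sum_ite_eq, Finset.mem_univ, if_true]
  have key1 : ∀ a x, ω (y a * op x) = ∑ b, N a b * κ b x := by
    intro a x
    have := key a [x] (by simp)
    simpa [splits, hω] using this
  simp only [Finset.sum_mul, smul_mul_assoc, map_sum, map_smul, smul_eq_mul]
  simp only [key _ L hL, key1, Finset.mul_sum, Finset.sum_mul, ← List.sum_map_mul_left]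
  generalize splits L = l
  induction l with
  | nil => simp
  | cons t l ih =>
    simp only [List.map_cons, List.sum_cons, Finset.sum_add_distrib, ih]
    congr 1
    refine Finset.sum_congr rfl fun a _ => Finset.sum_congr rfl fun b _ => ?_
    ring

/-- Wick's theorem: the expectation of a word is a determinant of time-ordered two-point
functions. -/
theorem wick {α β : Type} (op : α ⊕ β → R) (ω : R →ₗ[ℂ] ℂ) (hω : ω 1 = 1)
    (hexp : ∀ (x : α ⊕ β) (L : List (α ⊕ β)), Odd L.length → ω (op x * (L.map op).prod) =
      ((splits L).map fun t => (-1) ^ t.1.length *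
        ω (op x * op t.2.1) * ω ((t.1 ++ t.2.2).map op).prod).sum)
    (hrr : ∀ r r', ω (op (Sum.inl r) * op (Sum.inl r')) = 0)
    (hcc : ∀ c c', ω (op (Sum.inr c) * op (Sum.inr c')) = 0)
    (M : α → β → ℂ) (n : ℕ) (L : List (α ⊕ β))
    (hM₁ : L.Pairwise fun x y => ∀ r c, x = Sum.inl r → y = Sum.inr c → M r c = ω (op x * op y))
    (hM₂ : L.Pairwise fun x y => ∀ r c, x = Sum.inr c → y = Sum.inl r → M r c = -ω (op x * op y))
    (hr : (rowLetters L).length = n) (hc : (colLetters L).length = n) :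
    ω (L.map op).prod =
      shuffleSign L * (-1) ^ n.choose 2 * wdet M (rowLetters L) (colLetters L) := by
  induction n generalizing L with
  | zero =>
    have : L = [] := by
      rw [← List.length_eq_zero_iff, length_eq_rowLetters_add_colLetters, hr, hc]
    subst this
    simp [hω, shuffleSign, wdet]
  | succ n ih =>
    have hlen := length_eq_rowLetters_add_colLetters L
    rw [hr, hc] at hlen
    have hch : (-1 : ℂ) ^ (n + 1).choose 2 = (-1) ^ n * (-1) ^ n.choose 2 := by
      rw [← pow_add, Nat.choose_succ_succ' n 1, Nat.choose_one_right]
    rcases L with _ | ⟨x, L⟩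
    · simp at hr
    have hodd : Odd L.length := ⟨n, by simp only [List.length_cons] at hlen; omega⟩
    rw [List.pairwise_cons] at hM₁ hM₂
    rw [List.map_cons, List.prod_cons, hexp x L hodd, hch]
    have hIH : ∀ t ∈ splits L, (rowLetters (t.1 ++ t.2.2)).length = n →
        (colLetters (t.1 ++ t.2.2)).length = n → ω ((t.1 ++ t.2.2).map op).prod =
        shuffleSign (t.1 ++ t.2.2) * (-1) ^ n.choose 2 *
          wdet M (rowLetters (t.1 ++ t.2.2)) (colLetters (t.1 ++ t.2.2)) := by
      intro t ht
      have hs : List.Sublist (t.1 ++ t.2.2) L := by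
        rw [eq_of_mem_splits ht]
        exact List.Sublist.append (List.Sublist.refl _) (List.sublist_cons_self _ _)
      exact ih _ (hM₁.2.sublist hs) (hM₂.2.sublist hs)
    -- The first letter decides between expansion along the first row and along the first column.
    -- The position of its partner among letters of its own kind differs from its position in the
    -- word by the letters of the other kind; the change of `shuffleSign`, together with the (-1)^n
    -- from `hch`, accounts for the difference.
    cases x with
    | inl r =>
      simp only [rowLetters_inl, colLetters_inl, List.length_cons, add_left_inj] at hr hc
      have hpow : ((-1 : ℂ)) ^ n * (-1) ^ n = 1 := by rw [← mul_pow]; simp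
      simp only [rowLetters_inl, colLetters_inl, wdet, shuffleSign, ← List.sum_map_mul_left]
      rw [← sum_splits_colLetters L fun A c B => shuffleSign L * ((-1) ^ n * (-1) ^ n.choose 2) *
        ((-1) ^ A.length * M r c * wdet M (rowLetters L) (A ++ B))]
      congr 1
      refine List.map_congr_left fun t ht => ?_
      have hL := eq_of_mem_splits ht
      obtain ⟨A, x, B⟩ := t
      cases x with
      | inl r' => simp [hrr]
      | inr c =>
        simp only at hL
        have hIH' := hIH _ ht (by rw [← hr, hL]; simp)
          (by have := hc; rw [hL] at this; simp at this ⊢; omega)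
        simp only [Sum.elim_inr]
        simp only at hIH'
        rw [hIH', ← hM₁.1 (Sum.inr c) (by simp [hL]) r c rfl rfl]
        have hsg := shuffleSign_insert_inr A B c
        rw [← hL] at hsg
        have hAn := length_eq_rowLetters_add_colLetters A
        have hrn : (rowLetters A).length + (rowLetters B).length = n := by
          rw [← hr, hL]; simp
        have hrow : rowLetters L = rowLetters (A ++ B) := by rw [hL]; simp
        rw [hsg, hrow, hAn, ← hrn, colLetters_append]
        have hB : ((-1 : ℂ)) ^ (rowLetters B).length * (-1) ^ (rowLetters B).length = 1 := by
          rw [← mul_pow]; simp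
        simp only [pow_add]
        linear_combination (-((-1) ^ (rowLetters A).length * (-1) ^ (colLetters A).length * M r c *
          shuffleSign (A ++ B) * (-1) ^ ((rowLetters A).length + (rowLetters B).length).choose 2 *
          wdet M (rowLetters (A ++ B)) (colLetters A ++ colLetters B))) * hB
    | inr c =>
      simp only [rowLetters_inr, colLetters_inr, List.length_cons, add_left_inj] at hr hc
      simp only [rowLetters_inr, colLetters_inr, shuffleSign]
      rw [wdet_cons_right _ _ _ _ (by omega)]
      simp only [← List.sum_map_mul_left]
      rw [← sum_splits_rowLetters L fun A r B => (-1) ^ (rowLetters L).length * shuffleSign L *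
        ((-1) ^ n * (-1) ^ n.choose 2) *
        ((-1) ^ A.length * M r c * wdet M (A ++ B) (colLetters L))]
      congr 1
      refine List.map_congr_left fun t ht => ?_
      have hL := eq_of_mem_splits ht
      obtain ⟨A, x, B⟩ := t
      cases x with
      | inr c' => simp [hcc]
      | inl r =>
        simp only at hL
        have hIH' := hIH _ ht
          (by have := hr; rw [hL] at this; simp at this ⊢; omega) (by rw [← hc, hL]; simp)
        simp only [Sum.elim_inl]
        simp only at hIH'
        have hMr := hM₂.1 (Sum.inl r) (by simp [hL]) r c rfl rfl
        rw [hIH', eq_neg_iff_add_eq_zero.2 (neg_eq_iff_add_eq_zero.1 hMr.symm)]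
        have hsg := shuffleSign_insert_inl A B r
        rw [← hL] at hsg
        have hAn := length_eq_rowLetters_add_colLetters A
        have hcol : colLetters L = colLetters (A ++ B) := by rw [hL]; simp
        rw [hsg, hcol, hAn, hr, rowLetters_append]
        have hn : ((-1 : ℂ)) ^ n * (-1) ^ n = 1 := by rw [← mul_pow]; simp
        simp only [pow_add, pow_one]
        linear_combination ((-1) ^ (rowLetters A).length * (-1) ^ (colLetters A).length * M r c *
          shuffleSign (A ++ B) * (-1) ^ n.choose 2 *
          wdet M (rowLetters A ++ rowLetters B) (colLetters (A ++ B))) * hn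

end Wick

end

/-! ### The propagator and Wick's theorem for the free thermal state. -/

section

open Matrix

variable {Ω : Type} [LinearOrder Ω] [Fintype Ω]

/-- The free imaginary-time propagator `e^{-t h} (1 + e^{-β h})⁻¹`. -/
def propagator (h : Matrix Ω Ω ℂ) (β t : ℝ) : Matrix Ω Ω ℂ :=
  expm h (-t) * (1 + expm h (-β))⁻¹

theorem inv_one_add_expm_mul {h : Matrix Ω Ω ℂ} (hh : h.IsHermitian) (β : ℝ) :
    (1 + expm h (-β))⁻¹ * (1 + expm h (-β)) = 1 := by
  obtain ⟨G, h1, h2⟩ := exists_inv_one_add_expm hh (-β)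
  push_cast at h1 h2
  rw [Matrix.inv_eq_left_inv h1, h1]

theorem mul_inv_one_add_expm {h : Matrix Ω Ω ℂ} (hh : h.IsHermitian) (β : ℝ) :
    (1 + expm h (-β)) * (1 + expm h (-β))⁻¹ = 1 :=
  mul_eq_one_comm.1 (inv_one_add_expm_mul hh β)

theorem expm_mul_inv_comm {h : Matrix Ω Ω ℂ} (hh : h.IsHermitian) (β : ℝ) (z : ℂ) :
    expm h z * (1 + expm h (-β))⁻¹ = (1 + expm h (-β))⁻¹ * expm h z := by
  have hc : expm h z * (1 + expm h (-β)) = (1 + expm h (-β)) * expm h z := by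
    rw [mul_add, add_mul, ← expm_add, ← expm_add, add_comm z, mul_one, one_mul]
  set E := 1 + expm h (-β)
  calc expm h z * E⁻¹ = (E⁻¹ * E) * expm h z * E⁻¹ := by
        rw [inv_one_add_expm_mul hh, one_mul]
    _ = E⁻¹ * (expm h z * E) * E⁻¹ := by rw [hc]; noncomm_ring
    _ = E⁻¹ * expm h z * (E * E⁻¹) := by noncomm_ring
    _ = _ := by rw [mul_inv_one_add_expm hh, mul_one]

/-- Both factors are Hermitian functions of h and commute. Consequently the bound on row sums of the
Green's function also holds for column sums. -/
theorem propagator_isHermitian {h : Matrix Ω Ω ℂ} (hh : h.IsHermitian) (β t : ℝ) :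
    (propagator h β t).IsHermitian := by
  unfold IsHermitian propagator
  rw [conjTranspose_mul, expm_mul_inv_comm hh, conjTranspose_nonsing_inv, conjTranspose_add,
    expm_conjTranspose hh, expm_conjTranspose hh]
  simp

theorem freeExpect_mul_annihilate (h : Matrix Ω Ω ℂ) (β : ℝ) (a : Ω) (W : FockOp Ω) :
    freeExpectₗ h β (W * annihilate a) =
      ∑ b, expm h (-β) a b * freeExpectₗ h β (annihilate b * W) := by
  rw [freeExpectₗ_apply, freeExpect_mul_comm, evolve_annihilate, Finset.sum_mul,
    ← freeExpectₗ_apply, map_sum]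
  simp

theorem freeExpect_mul_create {h : Matrix Ω Ω ℂ} (hh : h.IsHermitian) (β : ℝ) (a : Ω)
    (W : FockOp Ω) :
    freeExpectₗ h β (W * create a) =
      ∑ b, (expm h β)ᵀ a b * freeExpectₗ h β (create b * W) := by
  rw [freeExpectₗ_apply, freeExpect_mul_comm, ← cre_single, evolve_cre hh, cre, Finset.sum_mul,
    ← freeExpectₗ_apply, map_sum]
  simp

theorem annihilate_ann (a : Ω) (f : Ω → ℂ) : annihilate a * ann f + ann f * annihilate a = 0 := by
  rw [← ann_single, ann_anticomm]

theorem annihilate_cre (a : Ω) (g : Ω → ℂ) :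
    annihilate a * cre g + cre g * annihilate a = g a • 1 := by
  rw [← ann_single, ann_cre_anticomm, single_one_dotProduct]

theorem create_cre (a : Ω) (f : Ω → ℂ) : create a * cre f + cre f * create a = 0 := by
  rw [← cre_single, cre_anticomm]

theorem create_ann (a : Ω) (f : Ω → ℂ) :
    create a * ann f + ann f * create a = f a • 1 := by
  rw [← cre_single, add_comm, ann_cre_anticomm, dotProduct_single_one]

theorem freeExpect_ann_ann {h : Matrix Ω Ω ℂ} (hh : h.IsHermitian) (β : ℝ) (f g : Ω → ℂ) :
    freeExpectₗ h β (ann f * ann g) = 0 := by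
  have := quasiFree_two_point (freeExpectₗ h β) (freeExpect_one hh β) annihilate (ann g) 0
    (by simp [annihilate_ann]) _ _ (freeExpect_mul_annihilate h β) (inv_one_add_expm_mul hh β) f
  simpa [ann] using this

theorem exists_inv_create {h : Matrix Ω Ω ℂ} (hh : h.IsHermitian) (β : ℝ) :
    ∃ N : Matrix Ω Ω ℂ, N * (1 + (expm h β)ᵀ) = 1 := by
  obtain ⟨G, -, h2⟩ := exists_inv_one_add_expm hh β
  refine ⟨Gᵀ, ?_⟩
  have := congrArg transpose h2
  simpa [transpose_mul] using this

theorem freeExpect_cre_cre {h : Matrix Ω Ω ℂ} (hh : h.IsHermitian) (β : ℝ) (f g : Ω → ℂ) :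
    freeExpectₗ h β (cre f * cre g) = 0 := by
  obtain ⟨N, hN⟩ := exists_inv_create hh β
  have := quasiFree_two_point (freeExpectₗ h β) (freeExpect_one hh β) create (cre g) 0
    (by simp [create_cre]) _ _ (freeExpect_mul_create hh β) hN f
  simpa [cre] using this

theorem freeExpect_ann_cre {h : Matrix Ω Ω ℂ} (hh : h.IsHermitian) (β : ℝ) (f g : Ω → ℂ) :
    freeExpectₗ h β (ann f * cre g) = f ⬝ᵥ ((1 + expm h (-β))⁻¹ *ᵥ g) :=
  quasiFree_two_point (freeExpectₗ h β) (freeExpect_one hh β) annihilate (cre g) g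
    (by simp [annihilate_cre]) _ _ (freeExpect_mul_annihilate h β) (inv_one_add_expm_mul hh β) f

theorem freeExpect_evolve_ann_cre {h : Matrix Ω Ω ℂ} (hh : h.IsHermitian) (β σ τ : ℝ)
    (f g : Ω → ℂ) :
    freeExpectₗ h β (evolve h σ (ann f) * evolve h τ (cre g)) =
      f ⬝ᵥ (propagator h β (σ - τ) *ᵥ g) := by
  rw [evolve_ann, evolve_cre hh, freeExpect_ann_cre hh, ← dotProduct_mulVec, mulVec_mulVec,
    mulVec_mulVec, mul_assoc, ← expm_mul_inv_comm hh, ← mul_assoc, ← expm_add, propagator]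
  congr 4
  push_cast; ring

/-- The Kubo–Martin–Schwinger condition carries the annihilation operator to the front at time σ +
β. So the opposite operator order yields the same propagator with its time shifted by β. -/
theorem freeExpect_evolve_cre_ann {h : Matrix Ω Ω ℂ} (hh : h.IsHermitian) (β σ τ : ℝ)
    (f g : Ω → ℂ) :
    freeExpectₗ h β (evolve h τ (cre g) * evolve h σ (ann f)) =
      f ⬝ᵥ (propagator h β (σ - τ + β) *ᵥ g) := by
  rw [freeExpectₗ_apply, freeExpect_mul_comm, evolve_evolve, ← freeExpectₗ_apply,
    freeExpect_evolve_ann_cre hh]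
  congr 3; ring

theorem green_of_nonneg {h : Matrix Ω Ω ℂ} (hh : h.IsHermitian) {β τ : ℝ} (hτ : 0 ≤ τ) (a b : Ω) :
    green h β τ a b = propagator h β τ a b := by
  rw [green, if_neg hτ.not_gt, ← freeExpectₗ_apply]
  have := freeExpect_evolve_ann_cre hh β τ 0 (Pi.single a 1) (Pi.single b 1)
  rw [ann_single, cre_single, evolve_zero, sub_zero] at this
  rw [this]
  simp

/-- Wick's theorem for the free thermal state. -/
theorem thermal_wick {h : Matrix Ω Ω ℂ} (hh : h.IsHermitian) (β : ℝ) {α γ : Type}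
    (σ : α → ℝ) (f : α → Ω → ℂ) (τ : γ → ℝ) (g : γ → Ω → ℂ) (op : α ⊕ γ → FockOp Ω)
    (hr : ∀ r, op (Sum.inl r) = evolve h (σ r) (ann (f r)))
    (hc : ∀ c, op (Sum.inr c) = evolve h (τ c) (cre (g c)))
    (M : α → γ → ℂ) (n : ℕ) (L : List (α ⊕ γ))
    (hM₁ : L.Pairwise fun x y => ∀ r c, x = Sum.inl r → y = Sum.inr c →
      M r c = f r ⬝ᵥ (propagator h β (σ r - τ c) *ᵥ g c))
    (hM₂ : L.Pairwise fun x y => ∀ r c, x = Sum.inr c → y = Sum.inl r →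
      M r c = -(f r ⬝ᵥ (propagator h β (σ r - τ c + β) *ᵥ g c)))
    (hrl : (rowLetters L).length = n) (hcl : (colLetters L).length = n) :
    freeExpect h β (L.map op).prod =
      shuffleSign L * (-1) ^ n.choose 2 * wdet M (rowLetters L) (colLetters L) := by
  rw [← freeExpectₗ_apply]
  refine wick op (freeExpectₗ h β) (freeExpect_one hh β) ?_ ?_ ?_ M n L ?_ ?_ hrl hcl
  · intro x L hL
    cases x with
    | inl r =>
      rw [hr, evolve_ann, ann]
      refine quasiFree_expand op (freeExpectₗ h β) (freeExpect_one hh β) annihilate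
        (fun a => Sum.elim (fun _ => 0) fun c => (expm h (τ c) *ᵥ g c) a) ?_ _ _
        (freeExpect_mul_annihilate h β) (inv_one_add_expm_mul hh β) _ L hL
      rintro a (r' | c)
      · simp [hr, evolve_ann, annihilate_ann]
      · simp [hc, evolve_cre hh, annihilate_cre]
    | inr c =>
      obtain ⟨N, hN⟩ := exists_inv_create hh β
      rw [hc, evolve_cre hh, cre]
      refine quasiFree_expand op (freeExpectₗ h β) (freeExpect_one hh β) create
        (fun a => Sum.elim (fun r => (f r ᵥ* expm h (-σ r)) a) fun c => 0) ?_ _ _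
        (freeExpect_mul_create hh β) hN _ L hL
      rintro a (r | c')
      · simp [hr, evolve_ann, create_ann]
      · simp [hc, evolve_cre hh, create_cre]
  · intro r r'
    rw [hr, hr, evolve_ann, evolve_ann, freeExpect_ann_ann hh]
  · intro r r'
    rw [hc, hc, evolve_cre hh, evolve_cre hh, freeExpect_cre_cre hh]
  · refine hM₁.imp fun {x y} H r c hx hy => ?_
    rw [H r c hx hy, hx, hy, hr, hc, freeExpect_evolve_ann_cre hh]
  · refine hM₂.imp fun {x y} H r c hx hy => ?_
    rw [H r c hx hy, hx, hy, hr, hc, freeExpect_evolve_cre_ann hh]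

end

/-! ### Hölder's inequality for traces and the bound on time-ordered expectations. -/

section

open Matrix

section Holder

open scoped Matrix.Norms.L2Operator

variable {n : Type} [Fintype n] [DecidableEq n]

/-- With e^{tH} = S S* and cyclicity, the trace is a sum of inner products ⟨S_i, A S_i⟩ over the
columns of S, and Cauchy–Schwarz applies to each term. -/
theorem norm_trace_mul_expm_le {H : Matrix n n ℂ} (hH : H.IsHermitian) (A : Matrix n n ℂ) (t : ℝ) :
    ‖(A * expm H t).trace‖ ≤ ‖A‖ * (expm H t).trace.re := by
  set S := expm H (t / 2 : ℝ) with hS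
  have hSS : expm H t = S * Sᴴ := by
    rw [hS, expm_conjTranspose hH, ← expm_add]; congr 1; simp
  have hcol : ∀ i, (Sᴴ * A * S) i i = inner ℂ (WithLp.toLp 2 (S.col i))
      (WithLp.toLp 2 (A *ᵥ S.col i)) := by
    intro i
    rw [EuclideanSpace.inner_eq_star_dotProduct, dotProduct_comm]
    simp only [mul_assoc]
    rw [Matrix.mul_apply]
    simp [dotProduct, Matrix.mul_apply, mulVec, col]
  have hnorm : ∀ i, ((Sᴴ * S) i i).re = ‖WithLp.toLp 2 (S.col i)‖ ^ 2 := by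
    intro i
    rw [EuclideanSpace.norm_sq_eq, Matrix.mul_apply, Complex.re_sum]
    refine Finset.sum_congr rfl fun j _ => ?_
    simp only [conjTranspose_apply, col, transpose_apply]
    rw [RCLike.star_def, Complex.conj_mul']
    norm_cast
  rw [hSS, ← mul_assoc, Matrix.trace_mul_comm, ← mul_assoc, Matrix.trace_mul_comm S, trace, trace,
    Complex.re_sum, Finset.mul_sum]
  refine (norm_sum_le _ _).trans (Finset.sum_le_sum fun i _ => ?_)
  simp only [diag_apply]
  rw [hcol, hnorm]
  refine (norm_inner_le_norm _ _).trans ?_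
  have := Matrix.l2_opNorm_mulVec A (WithLp.toLp 2 (S.col i))
  calc _ ≤ ‖WithLp.toLp 2 (S.col i)‖ * (‖A‖ * ‖WithLp.toLp 2 (S.col i)‖) := by gcongr; exact this
    _ = _ := by ring

theorem norm_mul_le_one {A B : Matrix n n ℂ} (hA : ‖A‖ ≤ 1) (hB : ‖B‖ ≤ 1) : ‖A * B‖ ≤ 1 :=
  (norm_mul_le _ _).trans (mul_le_one₀ hA (norm_nonneg _) hB)

theorem norm_trace_le (A : Matrix n n ℂ) : ‖A.trace‖ ≤ ‖A‖ * Fintype.card n := by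
  have := norm_trace_mul_expm_le (H := (0 : Matrix n n ℂ)) (by simp) A 0
  simpa [expm_zero, Matrix.trace_one] using this

/-- Adjacent exponentials of consecutive evolved operators merge, and the exponents are nonnegative
because the times decrease. The endpoint `e` supplies the exponent of the last factor and is free to
be chosen below all times. -/
theorem exists_factorization_evolved (H : Matrix n n ℂ) (A : Matrix n n ℂ) (τ e : ℝ)
    (L : List (Matrix n n ℂ × ℝ)) (hA : ∀ p ∈ (A, τ) :: L, ‖p.1‖ ≤ 1 ∧ e ≤ p.2)
    (hs : ((A, τ) :: L).Pairwise fun p q => q.2 ≤ p.2) :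
    ∃ K : List (Matrix n n ℂ × ℝ), K.length = L.length + 1 ∧ (∀ p ∈ K, ‖p.1‖ ≤ 1 ∧ 0 ≤ p.2) ∧
      (K.map Prod.snd).sum = τ - e ∧
      (((A, τ) :: L).map fun p => expm H p.2 * p.1 * expm H (-p.2)).prod =
        expm H τ * (K.map fun p => p.1 * expm H (-p.2)).prod * expm H (-e) := by
  induction L generalizing A τ with
  | nil =>
    refine ⟨[(A, τ - e)], rfl, ?_, by simp, ?_⟩
    · intro p hp
      rw [List.mem_singleton] at hp
      subst hp
      have := hA (A, τ) (by simp)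
      exact ⟨this.1, sub_nonneg.2 this.2⟩
    · simp only [List.map_cons, List.map_nil, List.prod_cons, List.prod_nil, mul_one, mul_assoc]
      rw [← expm_add]
      congr 3
      push_cast; ring
  | cons q L ih =>
    obtain ⟨B, σ⟩ := q
    rw [List.pairwise_cons] at hs
    obtain ⟨K, hK₁, hK₂, hK₃, hK₄⟩ := ih B σ (fun p hp => hA p (List.mem_cons_of_mem _ hp)) hs.2
    refine ⟨(A, τ - σ) :: K, by simp [hK₁], ?_, by simp [hK₃], ?_⟩
    · intro p hp
      rcases List.mem_cons.1 hp with rfl | hp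
      · exact ⟨(hA (A, τ) (by simp)).1, sub_nonneg.2 (hs.1 (B, σ) (by simp))⟩
      · exact hK₂ p hp
    · rw [List.map_cons, List.prod_cons, hK₄, List.map_cons, List.prod_cons]
      simp only [Complex.ofReal_sub]
      rw [show (-((τ : ℂ) - σ)) = -τ + σ by ring, expm_add]
      noncomm_ring

variable [Nonempty n]

theorem norm_expm_I_mul_le {H : Matrix n n ℂ} (hH : H.IsHermitian) (y : ℝ) :
    ‖expm H (y * Complex.I)‖ ≤ 1 := by
  have h1 : star (expm H (y * Complex.I)) * expm H (y * Complex.I) = 1 := by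
    rw [star_eq_conjTranspose, expm_conjTranspose hH]
    simp only [star_mul', RCLike.star_def, Complex.conj_ofReal, Complex.conj_I, mul_neg]
    exact expm_neg_mul _ _
  have h2 := CStarRing.norm_star_mul_self (x := expm H (y * Complex.I))
  rw [h1, CStarRing.norm_one] at h2
  nlinarith [norm_nonneg (expm H (y * Complex.I))]

theorem norm_expm_le {H : Matrix n n ℂ} (hH : H.IsHermitian) (z : ℂ) :
    ‖expm H z‖ ≤ ‖expm H z.re‖ := by
  conv_lhs => rw [← Complex.re_add_im z, expm_add]
  refine (norm_mul_le _ _).trans ?_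
  nlinarith [norm_expm_I_mul_le hH z.im, norm_nonneg (expm H z.re)]

/-- The multi-factor Hölder inequality for traces with imaginary-time evolution. -/
theorem norm_trace_prod_le {H : Matrix n n ℂ} (hH : H.IsHermitian) (k : ℕ)
    (L : List (Matrix n n ℂ × ℝ)) (hL : L.length = k + 1)
    (hA : ∀ p ∈ L, ‖p.1‖ ≤ 1 ∧ 0 ≤ p.2) :
    ‖(L.map fun p : Matrix n n ℂ × ℝ => p.1 * expm H (-p.2)).prod.trace‖ ≤
      (expm H (-(L.map Prod.snd).sum : ℝ)).trace.re := by
  induction k generalizing L with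
  | zero =>
    obtain ⟨⟨A, t⟩, rfl⟩ := List.length_eq_one_iff.1 hL
    have h1 := norm_trace_mul_expm_le hH A (-t)
    have h2 := (hA (A, t) (by simp)).1
    simp only [List.map_cons, List.map_nil, List.prod_cons, List.prod_nil, mul_one, List.sum_cons,
      List.sum_nil, add_zero] at h1 h2 ⊢
    push_cast at h1 ⊢
    refine h1.trans (mul_le_of_le_one_left ?_ h2)
    have := trace_expm_pos hH (-t)
    push_cast at this
    exact (Complex.lt_def.1 this).1.le
  | succ k ih =>
    match L, hL with
    | (A₁, t₁) :: (A₂, t₂) :: R, hL =>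
    obtain ⟨hA₁, ht₁⟩ := hA (A₁, t₁) (by simp)
    obtain ⟨hA₂, ht₂⟩ := hA (A₂, t₂) (by simp)
    have hR : ∀ p ∈ R, ‖p.1‖ ≤ 1 ∧ 0 ≤ p.2 := fun p hp => hA p (by simp [hp])
    simp only [List.length_cons, add_left_inj] at hL
    simp only at hA₁ ht₁ hA₂ ht₂
    set W := (R.map fun p => p.1 * expm H (-p.2)).prod with hW
    set T := t₁ + t₂ with hT
    set f : ℂ → ℂ := fun z => (A₁ * expm H (-z) * (A₂ * expm H (-(T - z)) * W)).trace with hf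
    -- Three lines theorem: the first exponent is replaced by a complex z and the second by T - z.
    -- On Re z = 0 and on Re z = T one of the two exponentials becomes unitary, two contractions
    -- merge, and the induction hypothesis bounds the remaining product, which has one factor less.
    have hgoal : ‖f t₁‖ ≤ (expm H (-(T + (R.map Prod.snd).sum) : ℝ)).trace.re := by
      have hd : Differentiable ℂ f := by
        intro z
        have e1 := (hasDerivAt_expm H (-z)).scomp z (hasDerivAt_neg z)
        have e2 := (hasDerivAt_expm H (-(T - z))).scomp z ((hasDerivAt_id z).const_sub (T : ℂ)).neg
        have e3 := (e1.const_mul A₁).mul ((e2.const_mul A₂).mul_const W)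
        have e4 := (LinearMap.toContinuousLinearMap (Matrix.traceLinearMap n ℂ ℂ)).hasFDerivAt
          (x := (A₁ * expm H (-z) * (A₂ * expm H (-(T - z)) * W)))
        exact (e4.comp_hasDerivAt z e3).differentiableAt
      refine PhragmenLindelof.vertical_strip (a := 0) (b := T) hd.diffContOnCl ?_ ?_ ?_
        (by simpa using ht₁) (by simpa [hT] using ht₂)
      -- The function is bounded on the strip, since imaginary parts only contribute unitaries, so
      -- no growth is needed. The exponent -1 also works for T = 0, where π / T is 0 by convention.
      · refine ⟨-1, ?_, 0, ?_⟩
        · have : 0 ≤ Real.pi / (T - 0) := div_nonneg Real.pi_pos.le (by linarith)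
          linarith
        · have hc1 : ContinuousOn (fun x : ℝ => ‖expm H (-x : ℝ)‖) (Set.Icc 0 T) := by
            refine (Continuous.norm ?_).continuousOn
            exact (continuous_expm H).comp (by fun_prop)
          obtain ⟨c, hc⟩ := (isCompact_Icc.image_of_continuousOn hc1).bddAbove
          have hc' : ∀ x ∈ Set.Icc 0 T, ‖expm H (-x : ℝ)‖ ≤ c := fun x hx =>
            hc (Set.mem_image_of_mem _ hx)
          have hc0 : 0 ≤ c := (norm_nonneg _).trans (hc' 0 (by simp; linarith))
          refine Asymptotics.IsBigO.of_bound (c * (c * ‖W‖) * Fintype.card n) ?_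
          refine Filter.mem_inf_of_right ?_
          intro z hz
          simp only [Set.mem_preimage, Set.mem_Ioo] at hz
          simp only [Set.mem_ofPred_eq, zero_mul, Real.exp_zero, norm_one, mul_one]
          refine (norm_trace_le _).trans ?_
          gcongr
          have b1 : ‖expm H (-z)‖ ≤ c := by
            refine (norm_expm_le hH _).trans ?_
            have := hc' z.re ⟨hz.1.le, hz.2.le⟩
            simpa using this
          have b2 : ‖expm H (-(T - z))‖ ≤ c := by
            refine (norm_expm_le hH _).trans ?_
            have := hc' (T - z.re) ⟨by linarith, by linarith⟩
            simpa using this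
          calc _ ≤ ‖A₁‖ * ‖expm H (-z)‖ * (‖A₂‖ * ‖expm H (-(T - z))‖ * ‖W‖) := by
                refine (norm_mul_le _ _).trans ?_
                gcongr
                · exact norm_mul_le _ _
                · refine (norm_mul_le _ _).trans ?_
                  gcongr
                  exact norm_mul_le _ _
            _ ≤ 1 * c * (1 * c * ‖W‖) := by gcongr
            _ = _ := by ring
      · intro z hz
        have hz' : z = z.im * Complex.I := by
          conv_lhs => rw [← Complex.re_add_im z, hz]
          simp
        have h1 := ih ((A₁ * expm H ((-z.im : ℝ) * Complex.I) * (A₂ * expm H (z.im * Complex.I)), T)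
          :: R) (by simp [hL]) (by
            intro p hp
            rcases List.mem_cons.1 hp with rfl | hp
            · exact ⟨norm_mul_le_one (norm_mul_le_one hA₁ (norm_expm_I_mul_le hH _))
                (norm_mul_le_one hA₂ (norm_expm_I_mul_le hH _)), by positivity⟩
            · exact hR p hp)
        simp only [List.map_cons, List.prod_cons, List.sum_cons, ← hW] at h1
        refine le_trans (le_of_eq (congrArg norm ?_)) h1
        simp only [hf]
        congr 1
        rw [show (-((T : ℂ) - z)) = z.im * Complex.I + (-T : ℂ) by rw [← hz']; ring, expm_add,
          show -z = (-z.im : ℝ) * Complex.I by conv_lhs => rw [hz']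
                                               push_cast; ring]
        noncomm_ring
      · intro z hz
        have hz' : z = T + z.im * Complex.I := by
          conv_lhs => rw [← Complex.re_add_im z, hz]
        set A' := expm H ((-z.im : ℝ) * Complex.I) * (A₂ * expm H (z.im * Complex.I)) with hA'
        have hA'n : ‖A'‖ ≤ 1 := norm_mul_le_one (norm_expm_I_mul_le hH _)
                (norm_mul_le_one hA₂ (norm_expm_I_mul_le hH _))
        have hfz : f z = (A' * W * (A₁ * expm H (-T))).trace := by
          rw [Matrix.trace_mul_comm]
          simp only [hf, hA']
          congr 1
          rw [show (-((T : ℂ) - z)) = z.im * Complex.I by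
              conv_lhs => rw [hz']
              ring,
            show -z = (-T : ℂ) + (-z.im : ℝ) * Complex.I by
              conv_lhs => rw [hz']
              push_cast; ring, expm_add]
          noncomm_ring
        rw [hfz]
        -- The contraction A' must be absorbed by the next factor; if there is none, cyclicity lets
        -- it be absorbed by A₁.
        match R, hL, hR, hW with
        | [], hL, hR, hW =>
          have h1 := ih [(A' * A₁, T)] (by simpa using hL.symm) (by
            intro p hp
            rw [List.mem_singleton] at hp
            subst hp
            exact ⟨norm_mul_le_one hA'n hA₁, by positivity⟩)
          simp only [List.map_nil, List.prod_nil] at hW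
          simp only [List.map_cons, List.map_nil, List.prod_cons, List.prod_nil, List.sum_cons,
            List.sum_nil, mul_one, mul_assoc] at h1
          rw [hW, mul_one]
          simpa using h1
        | (A₃, t₃) :: R, hL, hR, hW =>
          have h1 := ih (((A' * A₃, t₃) :: R) ++ [(A₁, T)]) (by simpa using hL) (by
            intro p hp
            simp only [List.cons_append, List.mem_cons, List.mem_append, List.not_mem_nil,
              or_false] at hp
            rcases hp with rfl | hp | rfl
            · exact ⟨norm_mul_le_one hA'n (hR (A₃, t₃) (by simp)).1, (hR (A₃, t₃) (by simp)).2⟩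
            · exact hR p (by simp [hp])
            · exact ⟨hA₁, by positivity⟩)
          simp only [List.map_append, List.map_cons, List.map_nil, List.prod_append, List.prod_cons,
            List.prod_nil, List.sum_append, List.sum_cons, List.sum_nil, mul_one, add_zero] at h1
          rw [hW]
          simp only [List.map_cons, List.prod_cons, List.sum_cons]
          rw [show T + (t₃ + (R.map Prod.snd).sum) = t₃ + (R.map Prod.snd).sum + T by ring]
          refine le_trans (le_of_eq (congrArg norm ?_)) h1
          congr 1
          noncomm_ring
    simp only [List.map_cons, List.prod_cons, List.sum_cons, ← hW]
    rw [← add_assoc, ← hT]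
    refine le_trans (le_of_eq (congrArg norm ?_)) hgoal
    simp only [hf, hT]
    push_cast
    rw [show -((t₁ : ℂ) + t₂ - t₁) = -t₂ by ring]

end Holder

open scoped Matrix.Norms.L2Operator in
/-- A time-ordered product of evolved contractions has expectation at most one. -/
theorem norm_freeExpect_prod_le {Ω : Type} [LinearOrder Ω] [Fintype Ω] {h : Matrix Ω Ω ℂ}
    (hh : h.IsHermitian) {β : ℝ}
    (L : List (FockOp Ω × ℝ)) (hA : ∀ p ∈ L, ‖p.1‖ ≤ 1 ∧ p.2 ∈ Set.Icc 0 β)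
    (hs : L.Pairwise fun p q => q.2 ≤ p.2) :
    ‖freeExpect h β (L.map fun p => evolve h p.2 p.1).prod‖ ≤ 1 := by
  rcases L with _ | ⟨⟨A, τ⟩, L⟩
  · simp [freeExpect_one hh]
  have hτ := (hA (A, τ) (by simp)).2
  simp only at hτ
  -- The endpoint τ - β is nonpositive, hence below all times. With it the outer exponentials cancel
  -- against e^{-βH₀} under the trace, and the exponents add up to β, so that Hölder's bound is
  -- exactly Z₀.
  obtain ⟨K, hK₁, hK₂, hK₃, hK₄⟩ := exists_factorization_evolved (freeHam h) A τ (τ - β) L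
    (fun p hp => ⟨(hA p hp).1, by linarith [(hA p hp).2.1, hτ.2]⟩) hs
  have hpos := trace_expm_pos (freeHam_isHermitian hh) (-β)
  have hbound := norm_trace_prod_le (freeHam_isHermitian hh) L.length K hK₁ hK₂
  rw [freeExpect_eq]
  simp only [evolve_eq]
  rw [hK₄, norm_div, mul_assoc, ← expm_add, Matrix.trace_mul_comm, ← mul_assoc, ← expm_add]
  rw [hK₃, sub_sub_cancel] at hbound
  push_cast at hbound hpos ⊢
  rw [show -((τ : ℂ) - β) + -β + τ = 0 by ring, expm_zero, one_mul]
  refine div_le_one_of_le₀ (hbound.trans (Complex.re_le_norm _)) (norm_nonneg _)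

end

/-! ### The determinant bound for weighted time-ordered propagators. -/

section

open Matrix

section Determinant

theorem norm_det_submatrix_equiv {m n : Type} [Fintype m] [DecidableEq m] [Fintype n]
    [DecidableEq n] (A : Matrix n n ℂ) (e₁ e₂ : m ≃ n) :
    ‖(A.submatrix e₁ e₂).det‖ = ‖A.det‖ := by
  have h1 : A.submatrix e₁ e₂ = ((A.submatrix e₁ e₁).submatrix id (e₂.trans e₁.symm)) := by
    ext i j; simp
  rw [h1, det_permute', det_submatrix_equiv_self, norm_mul]
  have : ‖(((Equiv.Perm.sign (e₂.trans e₁.symm) : ℤ)) : ℂ)‖ = 1 := by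
    rcases Int.units_eq_one_or (Equiv.Perm.sign (e₂.trans e₁.symm)) with h | h <;> simp [h]
  rw [this, one_mul]

theorem exists_equiv_of_nodup {R : Type} [Fintype R] [DecidableEq R] {l : List R} (hl : l.Nodup)
    (hm : ∀ r, r ∈ l) {k : ℕ} (hk : Fintype.card R = k) : ∃ f : Fin k ≃ R, l = List.ofFn f := by
  have hlen : l.length = k := by
    rw [← hk, ← Finset.card_univ, ← List.toFinset_card_of_nodup hl]
    congr 1
    ext; simp [hm]
  subst hlen
  exact ⟨hl.getEquivOfForallMemList l hm, (List.ofFn_get l).symm⟩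

theorem norm_wdet_eq {R C : Type} [Fintype R] [DecidableEq R] [Fintype C] [DecidableEq C]
    (M : R → C → ℂ) (e : R ≃ C) {l : List R} (hl : l.Nodup) (hm : ∀ r, r ∈ l)
    {l' : List C} (hl' : l'.Nodup) (hm' : ∀ c, c ∈ l') :
    ‖wdet M l l'‖ = ‖(Matrix.of fun r r' => M r (e r')).det‖ := by
  obtain ⟨f, rfl⟩ := exists_equiv_of_nodup hl hm rfl
  obtain ⟨g, rfl⟩ := exists_equiv_of_nodup hl' hm' (Fintype.card_congr e).symm
  rw [wdet_ofFn, ← norm_det_submatrix_equiv _ f (g.trans e.symm)]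
  congr 2
  ext i j
  simp

theorem mem_rowLetters {α β : Type} {L : List (α ⊕ β)} {r : α} :
    r ∈ rowLetters L ↔ Sum.inl r ∈ L := by
  simp [rowLetters]

theorem mem_colLetters {α β : Type} {L : List (α ⊕ β)} {c : β} :
    c ∈ colLetters L ↔ Sum.inr c ∈ L := by
  simp [colLetters]

theorem nodup_rowLetters {α β : Type} {L : List (α ⊕ β)} (hL : L.Nodup) :
    (rowLetters L).Nodup := by
  induction L with
  | nil => simp
  | cons x L ih =>
    rw [List.nodup_cons] at hL
    cases x with
    | inl r => simpa [mem_rowLetters, ih hL.2] using hL.1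
    | inr c => simpa using ih hL.2

theorem nodup_colLetters {α β : Type} {L : List (α ⊕ β)} (hL : L.Nodup) :
    (colLetters L).Nodup := by
  induction L with
  | nil => simp
  | cons x L ih =>
    rw [List.nodup_cons] at hL
    cases x with
    | inr r => simpa [mem_colLetters, ih hL.2] using hL.1
    | inl c => simpa using ih hL.2

theorem norm_shuffleSign {α β : Type} (L : List (α ⊕ β)) : ‖shuffleSign L‖ = 1 := by
  induction L with
  | nil => simp [shuffleSign]
  | cons x L ih => cases x <;> simp [shuffleSign, ih]

open scoped MatrixOrder in
theorem exists_eq_transpose_mul_self {n : Type} [Fintype n] [DecidableEq n] {Q : Matrix n n ℝ}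
    (hQ : Q.PosSemidef) : ∃ B : Matrix n n ℝ, Q = Bᵀ * B := by
  obtain ⟨X, hX, -, h⟩ := CFC.exists_sqrt_of_isSelfAdjoint_of_quasispectrumRestricts hQ.isHermitian
    (QuasispectrumRestricts.nnreal_of_nonneg hQ.nonneg)
  refine ⟨X, ?_⟩
  rw [← h]
  congr 1
  exact hX.star_eq.symm

end Determinant

section Extended

variable {Ω : Type} [LinearOrder Ω] [Fintype Ω]

/-- `s` independent copies of a one-particle operator. -/
def copies {Ω : Type} [Fintype Ω] [DecidableEq Ω] (s : ℕ) :
    Matrix Ω Ω ℂ →+* Matrix (Ω ×ₗ Fin s) (Ω ×ₗ Fin s) ℂ :=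
  (reindexAlgEquiv ℂ ℂ (toLex (α := Ω × Fin s))).toRingEquiv.toRingHom.comp
    ((blockDiagonalRingHom Ω (Fin s) ℂ).comp (Pi.constRingHom (Fin s) (Matrix Ω Ω ℂ)))

theorem copies_apply (s : ℕ) (A : Matrix Ω Ω ℂ) (x y : Ω ×ₗ Fin s) :
    copies s A x y = if (ofLex x).2 = (ofLex y).2 then A (ofLex x).1 (ofLex y).1 else 0 := rfl

theorem copies_isHermitian {h : Matrix Ω Ω ℂ} (hh : h.IsHermitian) (s : ℕ) :
    (copies s h).IsHermitian := by
  ext x y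
  simp only [conjTranspose_apply, copies_apply, eq_comm (a := (ofLex y).2)]
  split_ifs
  · rw [hh.apply]
  · simp

theorem copies_smul (s : ℕ) (z : ℂ) (A : Matrix Ω Ω ℂ) : copies s (z • A) = z • copies s A := by
  ext x y
  simp [copies_apply]

open scoped Matrix.Norms.L2Operator in
theorem expm_copies (h : Matrix Ω Ω ℂ) (s : ℕ) (z : ℂ) :
    expm (copies s h) z = copies s (expm h z) := by
  have hc : Continuous (copies (Ω := Ω) s) := by
    refine continuous_matrix fun x y => ?_
    simp only [copies_apply]
    split_ifs
    · exact continuous_id.matrix_elem _ _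
    · exact continuous_const
  have := NormedSpace.map_exp_of_mem_ball (𝕂 := ℂ) (copies s) hc (z • h)
    (by rw [NormedSpace.expSeries_radius_eq_top]; exact edist_lt_top _ _)
  rw [copies_smul] at this
  exact this.symm

theorem propagator_copies {h : Matrix Ω Ω ℂ} (hh : h.IsHermitian) (s : ℕ) (β t : ℝ) :
    propagator (copies s h) β t = copies s (propagator h β t) := by
  have hinv : (1 + expm (copies s h) (-β))⁻¹ = copies s ((1 + expm h (-β))⁻¹) := by
    apply Matrix.inv_eq_left_inv
    rw [expm_copies, ← map_one (copies s), ← map_add, ← map_mul, inv_one_add_expm_mul hh]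
  rw [propagator, hinv, expm_copies, ← map_mul, propagator]

-- For normalised f the anticommutation relations and (ann f)² = 0 make p = (ann f)* (ann f) a
-- projection. The C*-identity then bounds p, and hence ann f, by one.
open scoped Matrix.Norms.L2Operator in
theorem norm_ann_le_one (f : Ω → ℂ) (hf : f ⬝ᵥ star f = 1) : ‖ann f‖ ≤ 1 := by
  have h1 : ann f * star (ann f) + star (ann f) * ann f = 1 := by
    rw [star_eq_conjTranspose, ann_conjTranspose, ann_cre_anticomm, hf, one_smul]
  have h2 : ann f * ann f = 0 := by
    have := ann_anticomm f f
    rwa [← two_smul ℂ, smul_eq_zero_iff_right two_ne_zero] at this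
  set p := star (ann f) * ann f with hp
  have h3 : star p * p = p := by
    have : ann f * star (ann f) = 1 - p := eq_sub_of_add_eq h1
    calc star p * p = star (ann f) * (ann f * star (ann f)) * ann f := by
          rw [hp, star_mul, star_star]; noncomm_ring
      _ = p - star (ann f) * star (ann f) * (ann f * ann f) := by rw [this, hp]; noncomm_ring
      _ = p := by rw [h2]; simp
  have h4 := CStarRing.norm_star_mul_self (x := p)
  rw [h3] at h4
  have h5 : ‖p‖ ≤ 1 := by
    by_contra hlt
    push Not at hlt
    nlinarith
  have h6 := CStarRing.norm_star_mul_self (x := ann f)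
  rw [← hp] at h6
  nlinarith [norm_nonneg (ann f)]

open scoped Matrix.Norms.L2Operator in
theorem norm_cre_le_one (f : Ω → ℂ) (hf : f ⬝ᵥ star f = 1) : ‖cre f‖ ≤ 1 := by
  have : cre f = (ann (star f))ᴴ := by rw [ann_conjTranspose, star_star]
  rw [this, Matrix.l2_opNorm_conjTranspose]
  exact norm_ann_le_one _ (by rw [star_star, dotProduct_comm, hf])

/-- A one-particle vector at the site `a`, with the vector `u` in the space of copies. -/
def siteVec {s : ℕ} (a : Ω) (u : Fin s → ℂ) : Ω ×ₗ Fin s → ℂ :=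
  fun x => if (ofLex x).1 = a then u (ofLex x).2 else 0

theorem sum_lex {Ω : Type} [Fintype Ω] {s : ℕ} (F : Ω ×ₗ Fin s → ℂ) : ∑ x, F x = ∑ a, ∑ k, F (toLex (a, k)) := by
  rw [← Fintype.sum_prod_type' (f := fun a k => F (toLex (a, k)))]
  exact (Equiv.sum_comp toLex F).symm

/-- This is how weights enter two-point functions: the copies act as a tensor factor on which the
propagator is trivial, so the vectors there contribute only their pairing. -/
theorem siteVec_dotProduct_copies {s : ℕ} (a b : Ω) (u w : Fin s → ℂ) (A : Matrix Ω Ω ℂ) :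
    siteVec a u ⬝ᵥ (copies s A *ᵥ siteVec b w) = (u ⬝ᵥ w) * A a b := by
  have hs : ∀ (b : Ω) (w : Fin s → ℂ) (a : Ω) (k : Fin s),
      siteVec b w (toLex (a, k)) = if a = b then w k else 0 := fun _ _ _ _ => rfl
  have hc : ∀ (a b : Ω) (k l : Fin s), copies s A (toLex (a, k)) (toLex (b, l)) =
    if k = l then A a b else 0 := fun _ _ _ _ => rfl
  simp [dotProduct, mulVec, sum_lex, hs, hc, Finset.sum_mul]
  refine Finset.sum_congr rfl fun k _ => ?_
  ring

theorem siteVec_dotProduct_star {s : ℕ} (a : Ω) (u : Fin s → ℂ) :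
    siteVec a u ⬝ᵥ star (siteVec a u) = u ⬝ᵥ star u := by
  have hs : ∀ (a' : Ω) (k : Fin s), siteVec a u (toLex (a', k)) = if a' = a then u k else 0 :=
    fun _ _ => rfl
  simp only [dotProduct, sum_lex, Pi.star_apply, hs]
  rw [Finset.sum_eq_single a]
  · simp
  · intro a' _ ha'; simp [ha']
  · simp

open scoped Matrix.Norms.L2Operator in
/-- The determinant bound: determinants of time-ordered propagators weighted by a correlation
matrix are at most one. -/
theorem norm_det_propagator_le_one {h : Matrix Ω Ω ℂ} (hh : h.IsHermitian) {β : ℝ} {s : ℕ}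
    {τ : Fin s → ℝ} (hτ : ∀ i, τ i ∈ Set.Icc 0 β) {Q : Matrix (Fin s) (Fin s) ℝ}
    (hQ : Q.PosSemidef) (hQ1 : ∀ i, Q i i = 1) (rank : Fin s → ℕ)
    (hrank : ∀ i j, rank i ≤ rank j → τ j ≤ τ i)
    {R C : Type} [Fintype R] [DecidableEq R] [Fintype C] [DecidableEq C] (e : R ≃ C)
    (vr : R → Fin s) (ar : R → Ω) (vc : C → Fin s) (bc : C → Ω) (M : R → C → ℂ)
    (hM : ∀ r c, M r c = Q (vr r) (vc c) * if rank (vr r) < rank (vc c) then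
      propagator h β (τ (vr r) - τ (vc c)) (ar r) (bc c) else
      -propagator h β (τ (vr r) - τ (vc c) + β) (ar r) (bc c)) :
    ‖(Matrix.of fun r r' => M r (e r')).det‖ ≤ 1 := by
  -- The columns of B are real vectors with Gram matrix Q, of unit length because Q has unit
  -- diagonal. One of them is attached to each vertex.
  obtain ⟨B, hB⟩ := exists_eq_transpose_mul_self hQ
  let u : Fin s → Fin s → ℂ := fun i k => (B k i : ℂ)
  have hu : ∀ i j, u i ⬝ᵥ u j = (Q i j : ℂ) := by
    intro i j
    rw [hB, Matrix.mul_apply]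
    simp [u, dotProduct]
  have hu1 : ∀ i, u i ⬝ᵥ star (u i) = 1 := by
    intro i
    have : star (u i) = u i := by ext k; simp [u]
    rw [this, hu, hQ1]; simp
  -- Doubling the rank puts all creation operators of a rank before its annihilation operators. A
  -- row thus precedes a column exactly when its rank is strictly smaller, as in `hM`.
  let key : R ⊕ C → ℕ := Sum.elim (fun r => 2 * rank (vr r) + 1) (fun c => 2 * rank (vc c))
  let time : R ⊕ C → ℝ := Sum.elim (fun r => τ (vr r)) (fun c => τ (vc c))
  let A : R ⊕ C → FockOp (Ω ×ₗ Fin s) := Sum.elim (fun r => ann (siteVec (ar r) (u (vr r))))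
    (fun c => cre (siteVec (bc c) (u (vc c))))
  have hA : ∀ x, ‖A x‖ ≤ 1 := by
    rintro (r | c)
    · exact norm_ann_le_one _ (by rw [siteVec_dotProduct_star, hu1])
    · exact norm_cre_le_one _ (by rw [siteVec_dotProduct_star, hu1])
  let L := (Finset.univ : Finset (R ⊕ C)).toList.insertionSort fun x y => key x ≤ key y
  have : Std.Total fun x y : R ⊕ C => key x ≤ key y := ⟨fun x y => le_total _ _⟩
  have : IsTrans (R ⊕ C) fun x y => key x ≤ key y := ⟨fun x y z => le_trans⟩
  have hsort : L.Pairwise fun x y => key x ≤ key y := List.pairwise_insertionSort _ _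
  have hperm : L.Perm (Finset.univ : Finset (R ⊕ C)).toList := List.perm_insertionSort _ _
  have hnd : L.Nodup := hperm.nodup_iff.2 (Finset.nodup_toList _)
  have hmem : ∀ x, x ∈ L := fun x => hperm.mem_iff.2 (by simp)
  have htime : ∀ x y, key x ≤ key y → time y ≤ time x := by
    rintro (r | c) (r' | c') hxy <;> simp only [key, Sum.elim_inl, Sum.elim_inr] at hxy <;>
      exact hrank _ _ (by omega)
  have hmemt : ∀ x, time x ∈ Set.Icc 0 β := by rintro (r | c) <;> exact hτ _
  have hrl : (rowLetters L).length = Fintype.card R := by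
    obtain ⟨f, hf⟩ := exists_equiv_of_nodup (nodup_rowLetters hnd)
      (fun r => mem_rowLetters.2 (hmem _)) rfl
    rw [hf, List.length_ofFn]
  have hcl : (colLetters L).length = Fintype.card R := by
    obtain ⟨f, hf⟩ := exists_equiv_of_nodup (nodup_colLetters hnd)
      (fun r => mem_colLetters.2 (hmem _)) (Fintype.card_congr e).symm
    rw [hf, List.length_ofFn]
  have hwick := thermal_wick (copies_isHermitian hh s) β (fun r => τ (vr r))
    (fun r => siteVec (ar r) (u (vr r))) (fun c => τ (vc c)) (fun c => siteVec (bc c) (u (vc c)))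
    (fun x => evolve (copies s h) (time x) (A x)) (fun r => rfl) (fun c => rfl) M _ L
    (hsort.imp fun {x y} hxy r c hx hy => by
      subst hx hy
      simp only [key, Sum.elim_inl, Sum.elim_inr] at hxy
      rw [propagator_copies hh, siteVec_dotProduct_copies, hu, hM, if_pos (by omega)])
    (hsort.imp fun {x y} hxy r c hx hy => by
      subst hx hy
      simp only [key, Sum.elim_inl, Sum.elim_inr] at hxy
      rw [propagator_copies hh, siteVec_dotProduct_copies, hu, hM, if_neg (by omega), mul_neg])
    hrl hcl
  have hbound := norm_freeExpect_prod_le (copies_isHermitian hh s) (β := β)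
    (L.map fun x => (A x, time x)) (by
      intro p hp
      obtain ⟨x, -, rfl⟩ := List.mem_map.1 hp
      exact ⟨hA x, hmemt x⟩)
    (List.pairwise_map.2 (hsort.imp fun {x y} hxy => htime x y hxy))
  rw [List.map_map] at hbound
  simp only [Function.comp_def] at hbound
  rw [hwick, norm_mul, norm_mul, norm_shuffleSign, norm_pow, norm_neg, norm_one, one_pow, one_mul,
    one_mul, norm_wdet_eq M e (nodup_rowLetters hnd) (fun r => mem_rowLetters.2 (hmem _))
      (nodup_colLetters hnd) (fun r => mem_colLetters.2 (hmem _))] at hbound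
  exact hbound

end Extended

end

/-! ### Time ordering, and moments as determinants. -/

section

open Matrix

section TimeOrder

variable {s : ℕ}

/-- The vertex `i` stands to the left of the vertex `j` in a time-ordered product. -/
def before (τ : Fin s → ℝ) (i j : Fin s) : Prop := τ j < τ i ∨ τ i = τ j ∧ i < j

/-- The position of a vertex in the time-ordered product. -/
def timeRank (τ : Fin s → ℝ) (i : Fin s) : Fin s := (Tuple.sort fun i => -τ i).symm i

theorem before_of_timeRank_lt {τ : Fin s → ℝ} {i j : Fin s} (h : timeRank τ i < timeRank τ j) :
    before τ i j := by
  obtain ⟨h1, h2⟩ := Tuple.eq_sort_iff.1 (rfl : (Tuple.sort fun i => -τ i) = Tuple.sort fun i => -τ i)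
  have h3 := h1 h.le
  have h4 := h2 _ _ h
  simp only [timeRank, Function.comp_apply, Equiv.apply_symm_apply, neg_le_neg_iff] at h3 h4
  rcases h3.lt_or_eq with h5 | h5
  · exact Or.inl h5
  · exact Or.inr ⟨h5.symm, h4 (by rw [h5])⟩

theorem not_before_self (τ : Fin s → ℝ) (i : Fin s) : ¬before τ i i := by
  simp [before]

theorem before_asymm {τ : Fin s → ℝ} {i j : Fin s} (h : before τ i j) : ¬before τ j i := by
  rintro (h' | h') <;> rcases h with h | h
  · linarith
  · linarith [h.1]
  · linarith [h'.1]
  · exact lt_asymm h.2 h'.2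

theorem before_iff_timeRank_lt {τ : Fin s → ℝ} {i j : Fin s} :
    before τ i j ↔ timeRank τ i < timeRank τ j := by
  refine ⟨fun h => ?_, before_of_timeRank_lt⟩
  rcases lt_trichotomy (timeRank τ i) (timeRank τ j) with h' | h' | h'
  · exact h'
  · rw [timeRank, timeRank, EmbeddingLike.apply_eq_iff_eq] at h'
    subst h'
    exact (not_before_self τ i h).elim
  · exact (before_asymm h (before_of_timeRank_lt h')).elim

theorem le_of_timeRank_le {τ : Fin s → ℝ} {i j : Fin s} (h : timeRank τ i ≤ timeRank τ j) :
    τ j ≤ τ i := by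
  rcases h.lt_or_eq with h | h
  · rcases before_of_timeRank_lt h with h | h
    · exact h.le
    · exact h.1.ge
  · rw [timeRank, timeRank, EmbeddingLike.apply_eq_iff_eq] at h
    rw [h]

end TimeOrder

variable {Ω : Type} [LinearOrder Ω] [Fintype Ω] {s : ℕ}

/-- The index set of the fields `ψ` (and of the fields `ψ†`) of the vertices `P`. -/
abbrev FieldIdx {Ω : Type} (P : Fin s → MultiIndex Ω) : Type := Σ i : Fin s, Fin (P i).m

open Classical in
/-- The matrix of time-ordered contractions between the fields `ψ` and `ψ†`. -/
def fieldMat (h : Matrix Ω Ω ℂ) (β : ℝ) (P : Fin s → MultiIndex Ω) (τ : Fin s → ℝ) :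
    Matrix (FieldIdx P) (FieldIdx P) ℂ := fun r c =>
  if before τ r.1 c.1 then
    propagator h β (τ r.1 - τ c.1) ((P r.1).minus r.2) ((P c.1).plus c.2)
  else -propagator h β (τ r.1 - τ c.1 + β) ((P r.1).minus r.2) ((P c.1).plus c.2)

/-- The sign that relates a monomial with `m` pairs of fields to a determinant. -/
def vertexSign (m : ℕ) : ℂ := (-1) ^ (m * m + m.choose 2)

theorem norm_vertexSign (m : ℕ) : ‖vertexSign m‖ = 1 := by simp [vertexSign]

/-- The fields of the vertex `i`. -/
def vertexFields {Ω : Type} (P : Fin s → MultiIndex Ω) (i : Fin s) : List (FieldIdx P) :=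
  List.ofFn fun j : Fin (P i).m => ⟨i, j⟩

/-- The word of the vertex `i`: the fields `ψ†`, then the fields `ψ`. -/
def vertexWord {Ω : Type} (P : Fin s → MultiIndex Ω) (i : Fin s) :
    List (FieldIdx P ⊕ FieldIdx P) :=
  (vertexFields P i).map Sum.inr ++ (vertexFields P i).map Sum.inl

theorem rowLetters_map_inl {α β : Type} (l : List α) :
    rowLetters (l.map (Sum.inl : α → α ⊕ β)) = l := by
  induction l with
  | nil => rfl
  | cons a l ih => simp [ih]

theorem rowLetters_map_inr {α β : Type} (l : List β) :
    rowLetters (l.map (Sum.inr : β → α ⊕ β)) = [] := by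
  induction l with
  | nil => rfl
  | cons a l ih => simp [ih]

theorem colLetters_map_inl {α β : Type} (l : List α) :
    colLetters (l.map (Sum.inl : α → α ⊕ β)) = [] := by
  induction l with
  | nil => rfl
  | cons a l ih => simp [ih]

theorem colLetters_map_inr {α β : Type} (l : List β) :
    colLetters (l.map (Sum.inr : β → α ⊕ β)) = l := by
  induction l with
  | nil => rfl
  | cons a l ih => simp [ih]

theorem rowLetters_words {Ω : Type} (P : Fin s → MultiIndex Ω) (l : List (Fin s)) :
    rowLetters (l.map (vertexWord P)).flatten = (l.map (vertexFields P)).flatten := by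
  induction l with
  | nil => rfl
  | cons i l ih => simp [vertexWord, rowLetters_map_inl, rowLetters_map_inr, ih]

theorem colLetters_words {Ω : Type} (P : Fin s → MultiIndex Ω) (l : List (Fin s)) :
    colLetters (l.map (vertexWord P)).flatten = (l.map (vertexFields P)).flatten := by
  induction l with
  | nil => rfl
  | cons i l ih => simp [vertexWord, colLetters_map_inl, colLetters_map_inr, ih]

theorem shuffleSign_inl_append {α β : Type} (l : List α) (L : List (α ⊕ β)) :
    shuffleSign (l.map Sum.inl ++ L) = shuffleSign L := by
  induction l with
  | nil => rfl
  | cons a l ih => simpa [shuffleSign] using ih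

theorem shuffleSign_inr_append {α β : Type} (l : List β) (L : List (α ⊕ β)) :
    shuffleSign (l.map Sum.inr ++ L) =
      (-1) ^ (l.length * (rowLetters L).length) * shuffleSign L := by
  induction l with
  | nil => simp
  | cons a l ih =>
    simp only [List.map_cons, List.cons_append, shuffleSign, ih, rowLetters_append,
      rowLetters_map_inr, List.nil_append, List.length_cons]
    rw [Nat.succ_mul, pow_add]; ring

/-- Moving the m columns of one vertex past the n rows of the later ones costs (-1)^(mn), which
cancels the cross term of binom(m+n, 2). The sign in Wick's theorem is therefore a product over
vertices and independent of the time order. -/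
theorem shuffleSign_words {Ω : Type} (P : Fin s → MultiIndex Ω) (l : List (Fin s)) :
    shuffleSign (l.map (vertexWord P)).flatten *
      (-1) ^ ((l.map (vertexFields P)).flatten.length).choose 2 =
      (l.map fun i => vertexSign (P i).m).prod := by
  induction l with
  | nil => simp [shuffleSign]
  | cons i l ih =>
    rw [List.map_cons, List.flatten_cons, List.map_cons, List.flatten_cons, List.map_cons,
      List.prod_cons, ← ih, vertexWord, List.append_assoc, shuffleSign_inr_append,
      shuffleSign_inl_append, rowLetters_append, rowLetters_map_inl, rowLetters_words,
      List.length_append]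
    set n := (l.map (vertexFields P)).flatten.length
    have hm : (vertexFields P i).length = (P i).m := by simp [vertexFields]
    rw [hm]
    set m := (P i).m
    have hch : (m + n).choose 2 = m.choose 2 + n.choose 2 + m * n := by
      rw [Nat.add_choose_eq, Finset.Nat.antidiagonal_succ]
      simp [Finset.Nat.antidiagonal_succ]
      ring
    have hsq : ((-1 : ℂ) ^ (m * n)) * (-1) ^ (m * n) = 1 := by rw [← mul_pow]; simp
    rw [vertexSign, hch, mul_add]
    simp only [pow_add]
    linear_combination ((-1) ^ (m * m) * (-1) ^ m.choose 2 * (-1) ^ n.choose 2 *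
      shuffleSign (l.map (vertexWord P)).flatten) * hsq

theorem evolve_monomial (h : Matrix Ω Ω ℂ) (t : ℝ) (P : MultiIndex Ω) :
    evolve h t (monomial P) = (List.ofFn fun j => evolve h t (create (P.plus j))).prod *
      (List.ofFn fun j => evolve h t (annihilate (P.minus j))).prod := by
  rw [monomial, evolve_mul, evolve_list_prod, evolve_list_prod, List.map_ofFn, List.map_ofFn]
  rfl

/-- The moments are determinants of time-ordered contractions. -/
theorem moment_eq_det {h : Matrix Ω Ω ℂ} (hh : h.IsHermitian) (β : ℝ) (P : Fin s → MultiIndex Ω)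
    (τ : Fin s → ℝ) :
    moment h β P τ = (∏ i, vertexSign (P i).m) * (fieldMat h β P τ).det := by
  set σ : Equiv.Perm (Fin s) := Tuple.sort fun i => -τ i with hσ
  let op : FieldIdx P ⊕ FieldIdx P → FockOp Ω := Sum.elim
    (fun r => evolve h (τ r.1) (ann (Pi.single ((P r.1).minus r.2) 1)))
    (fun c => evolve h (τ c.1) (cre (Pi.single ((P c.1).plus c.2) 1)))
  set l := List.ofFn σ with hl
  set L := (l.map (vertexWord P)).flatten with hL
  have hprod : (List.ofFn fun k => evolve h (τ (σ k)) (monomial (P (σ k)))).prod =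
      (L.map op).prod := by
    rw [hL, hl, List.map_flatten, List.prod_flatten, List.map_map, List.map_map, List.map_ofFn]
    congr 2
    ext1 k
    simp only [Function.comp_apply, vertexWord, vertexFields, List.map_append, List.prod_append,
      List.map_ofFn, evolve_monomial]
    simp only [Function.comp_def, op, Sum.elim_inl, Sum.elim_inr, ann_single, cre_single]
  let E := (l.map (vertexFields P)).flatten
  have hEnd : E.Nodup := by
    rw [List.nodup_flatten]
    constructor
    · intro x hx
      obtain ⟨i, -, rfl⟩ := List.mem_map.1 hx
      rw [vertexFields, List.nodup_ofFn]
      intro a b hab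
      simpa using hab
    · rw [List.pairwise_map]
      have : l.Nodup := List.nodup_ofFn.2 σ.injective
      refine this.imp fun {i j} hij => ?_
      intro x hx hx'
      simp only [vertexFields, List.mem_ofFn] at hx hx'
      obtain ⟨a, rfl⟩ := hx
      obtain ⟨b, hb⟩ := hx'
      exact hij (congrArg Sigma.fst hb).symm
  have hEm : ∀ r, r ∈ E := by
    rintro ⟨i, j⟩
    refine List.mem_flatten.2 ⟨vertexFields P i, List.mem_map.2 ⟨i, ?_, rfl⟩, ?_⟩
    · rw [hl, List.mem_ofFn]; exact σ.surjective i
    · rw [vertexFields, List.mem_ofFn]; exact ⟨j, rfl⟩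
  let vert : FieldIdx P ⊕ FieldIdx P → Fin s := Sum.elim Sigma.fst Sigma.fst
  have hvert : ∀ i, ∀ x ∈ vertexWord P i, vert x = i := by
    intro i x hx
    simp only [vertexWord, vertexFields, List.mem_append, List.mem_map, List.mem_ofFn] at hx
    rcases hx with ⟨_, ⟨_, rfl⟩, rfl⟩ | ⟨_, ⟨_, rfl⟩, rfl⟩ <;> rfl
  -- Inside a vertex every ψ† stands before every ψ, so a row letter never precedes a column letter
  -- of its own vertex. This agrees with the second case of `fieldMat` on equal vertices.
  have hord : L.Pairwise fun x y => before τ (vert x) (vert y) ∨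
      (vert x = vert y ∧ ¬(x.isLeft ∧ y.isRight)) := by
    rw [hL, List.pairwise_flatten]
    constructor
    · intro w hw
      obtain ⟨i, -, rfl⟩ := List.mem_map.1 hw
      have h1 : (vertexWord P i).Pairwise fun x y => ¬(x.isLeft ∧ y.isRight) := by
        rw [vertexWord, List.pairwise_append]
        refine ⟨?_, ?_, ?_⟩
        · simpa [List.pairwise_map] using List.pairwise_of_forall fun _ _ => trivial
        · simpa [List.pairwise_map] using List.pairwise_of_forall fun _ _ => trivial
        · simp +contextual
      exact h1.imp_of_mem fun {x y} hx hy hxy =>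
        Or.inr ⟨(hvert i x hx).trans (hvert i y hy).symm, hxy⟩
    · rw [List.pairwise_map, hl, List.pairwise_ofFn]
      intro k k' hkk x hx y hy
      left
      rw [hvert _ _ hx, hvert _ _ hy]
      apply before_of_timeRank_lt
      rw [timeRank, timeRank, ← hσ]
      simpa using hkk
  have hrow : rowLetters L = E := rowLetters_words P l
  have hcol : colLetters L = E := colLetters_words P l
  have hw := thermal_wick hh β (fun r : FieldIdx P => τ r.1)
    (fun r => Pi.single ((P r.1).minus r.2) 1) (fun c : FieldIdx P => τ c.1)
    (fun c => Pi.single ((P c.1).plus c.2) 1) op (fun _ => rfl) (fun _ => rfl)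
    (fun r c => fieldMat h β P τ r c) E.length L
    (hord.imp fun {x y} hxy r c hx hy => by
      subst hx hy
      have hb : before τ r.1 c.1 := by
        rcases hxy with h | h
        · exact h
        · simp at h
      simp [fieldMat, if_pos hb])
    (hord.imp fun {x y} hxy r c hx hy => by
      subst hx hy
      have hb : ¬before τ r.1 c.1 := by
        rcases hxy with h | h
        · exact before_asymm h
        · have h1 : c.1 = r.1 := h.1
          rw [h1]
          exact not_before_self _ _
      simp [fieldMat, if_neg hb])
    (by rw [hrow]) (by rw [hcol])
  rw [moment, hprod, hw, hrow, hcol, hL, shuffleSign_words P l, hl, List.map_ofFn, List.prod_ofFn]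
  congr 1
  · exact Equiv.prod_comp σ fun i => vertexSign (P i).m
  · obtain ⟨f, hf⟩ := exists_equiv_of_nodup hEnd hEm rfl
    rw [hf, wdet_ofFn]
    exact det_submatrix_equiv_self f (fieldMat h β P τ)

end

/-! ### Determinants with unit rows, and the definition of the cluster sums. -/

section

open Matrix

section Override

variable {F : Type} [Fintype F] [DecidableEq F]

/-- A bound on all complementary minors bounds a determinant some of whose rows are unit vectors. -/
theorem norm_det_le_one_of_override (A : Matrix F F ℂ) (N : F → F → ℂ) (ov : F → Option F)
    (h1 : ∀ r c, ov r = some c → A r = Pi.single c 1)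
    (h2 : ∀ r, ov r = none → ∀ c, (∀ r', ov r' ≠ some c) → A r c = N r c)
    (hN : ∀ e : {r // ov r = none} ≃ {c // ∀ r, ov r ≠ some c},
      ‖(Matrix.of fun r r' : {r // ov r = none} => N r (e r')).det‖ ≤ 1) : ‖A.det‖ ≤ 1 := by
  by_cases hinj : ∀ r r' c, ov r = some c → ov r' = some c → r = r'
  swap
  · push Not at hinj
    obtain ⟨r, r', c, hr, hr', hne⟩ := hinj
    rw [det_zero_of_row_eq hne ((h1 r c hr).trans (h1 r' c hr').symm)]
    simp
  let e₀ : {r // ov r ≠ none} → {c // ¬∀ r, ov r ≠ some c} := fun r =>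
    ⟨(ov r).get (Option.isSome_iff_ne_none.2 r.2), by push Not; exact ⟨r, by simp⟩⟩
  have he₀ : ∀ r : {r // ov r ≠ none}, ov r = some (e₀ r : F) := fun r => by simp [e₀]
  have hbij : Function.Bijective e₀ := by
    constructor
    · intro r r' hrr
      exact Subtype.ext (hinj _ _ _ (he₀ r) (by rw [hrr]; exact he₀ r'))
    · rintro ⟨c, hc⟩
      push Not at hc
      obtain ⟨r, hr⟩ := hc
      refine ⟨⟨r, by simp [hr]⟩, Subtype.ext ?_⟩
      exact Option.some.inj ((he₀ ⟨r, by simp [hr]⟩).symm.trans hr)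
  let E := Equiv.ofBijective e₀ hbij
  -- The partial injection r ↦ `ov r` is extended to a permutation. After permuting the columns by
  -- it, the replaced rows are rows of the identity, the matrix is block triangular, and only the
  -- complementary minor survives.
  let π : Equiv.Perm F := E.extendSubtype
  have hπ : ∀ r, ov r ≠ none → ov r = some (π r) := by
    intro r hr
    rw [show π r = E ⟨r, hr⟩ from Equiv.extendSubtype_apply_of_mem E r hr]
    exact he₀ ⟨r, hr⟩
  have hiff : ∀ r, ov r = none ↔ ∀ r', ov r' ≠ some (π r) := by
    intro r
    constructor
    · intro hr r' hr'
      have h3 := hπ r' (by simp [hr'])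
      rw [hr', Option.some.injEq, EmbeddingLike.apply_eq_iff_eq] at h3
      subst h3
      simp [hr] at hr'
    · intro h
      by_contra hr
      exact h r (hπ r hr)
  let e : {r // ov r = none} ≃ {c // ∀ r, ov r ≠ some c} := π.subtypeEquiv hiff
  have hA : ‖A.det‖ = ‖(A.submatrix id π).det‖ := by
    rw [show A.submatrix id π = A.submatrix (Equiv.refl F) π from rfl, norm_det_submatrix_equiv]
  have hrow : ∀ r, ov r ≠ none → ∀ r', A r (π r') = if r = r' then 1 else 0 := by
    intro r hr r'
    rw [h1 r _ (hπ r hr), Pi.single_apply]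
    simp [eq_comm]
  rw [hA, twoBlockTriangular_det (A.submatrix id π) (fun r => ov r = none)]
  · have hone : toSquareBlockProp (A.submatrix id π) (fun r => ¬ov r = none) = 1 := by
      ext r r'
      rw [Matrix.one_apply]
      simp only [Subtype.ext_iff]
      exact hrow _ r.2 _
    rw [hone, det_one, mul_one]
    convert hN e using 3
    ext r r'
    exact h2 _ r.2 _ ((hiff r').1 r'.2)
  · intro r hr r' hr'
    rw [submatrix_apply, id, hrow r hr, if_neg]
    rintro rfl
    exact hr hr'

/-- Leibniz' formula, with the cofactor of (r, c) written as the determinant whose row r is replaced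
by the unit vector at c. This keeps the index set fixed under repeated differentiation. -/
theorem hasDerivAt_det {A : ℝ → Matrix F F ℂ} {A' : Matrix F F ℂ} {t : ℝ}
    (hA : ∀ r c, HasDerivAt (fun t => A t r c) (A' r c) t) :
    HasDerivAt (fun t => (A t).det)
      (∑ r, ∑ c, A' r c * (updateRow (A t) r (Pi.single c 1)).det) t := by
  have hupd : ∀ (σ : Equiv.Perm F) (r c : F),
      ∏ j, updateRow (A t) r (Pi.single c 1) (σ j) j =
        if σ c = r then ∏ j ∈ Finset.univ.erase c, A t (σ j) j else 0 := by
    intro σ r c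
    split_ifs with h
    · rw [← Finset.mul_prod_erase _ _ (Finset.mem_univ c), h, updateRow_self, Pi.single_eq_same,
        one_mul]
      refine Finset.prod_congr rfl fun j hj => ?_
      rw [updateRow_ne]
      rw [← h]
      exact fun hh => (Finset.ne_of_mem_erase hj) (σ.injective hh)
    · refine Finset.prod_eq_zero (Finset.mem_univ (σ.symm r)) ?_
      rw [Equiv.apply_symm_apply, updateRow_self, Pi.single_eq_of_ne]
      rintro rfl
      simp at h
  have h1 : HasDerivAt (fun t => ∑ σ : Equiv.Perm F, ((Equiv.Perm.sign σ : ℤ) : ℂ) * ∏ i, A t (σ i) i)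
      (∑ σ : Equiv.Perm F, ((Equiv.Perm.sign σ : ℤ) : ℂ) *
        ∑ i, (∏ j ∈ Finset.univ.erase i, A t (σ j) j) • A' (σ i) i) t :=
    HasDerivAt.fun_sum fun σ _ => (HasDerivAt.fun_finsetProd fun i _ => hA (σ i) i).const_mul _
  simp only [det_apply', hupd]
  refine h1.congr_deriv ?_
  simp only [Finset.mul_sum, smul_eq_mul]
  refine Finset.sum_comm.trans (Eq.trans ?_ Finset.sum_comm)
  refine Finset.sum_congr rfl fun c _ => Eq.trans ?_ Finset.sum_comm
  refine Finset.sum_congr rfl fun σ _ => ?_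
  rw [Finset.sum_eq_single (σ c)]
  · rw [if_pos rfl]; ring
  · intro r _ hr; rw [if_neg hr.symm]; ring
  · simp

end Override

section Cluster

variable {I F : Type} [DecidableEq I] [Fintype F] [DecidableEq F]

/-- The contraction matrix with weights `Q`, some rows being replaced by unit vectors. -/
def lineMat (vert : F → I) (G : Matrix F F ℂ) (Q : Matrix I I ℝ) (ov : F → Option F) :
    Matrix F F ℂ := fun r =>
  (ov r).elim (fun c => (Q (vert r) (vert c) : ℂ) * G r c) fun c => Pi.single c 1

/-- The restriction of a matrix to the fields of the vertices in `S`, extended by the identity. -/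
def maskMat (vert : F → I) (S : Finset I) (A : Matrix F F ℂ) : Matrix F F ℂ := fun r c =>
  if vert r ∈ S then (if vert c ∈ S then A r c else 0) else if r = c then 1 else 0

/-- The principal minor of the fields of the vertices in `S`. -/
def detOn (vert : F → I) (S : Finset I) (A : Matrix F F ℂ) : ℂ := (maskMat vert S A).det

variable {vert : F → I} {G : Matrix F F ℂ}

theorem detOn_empty (A : Matrix F F ℂ) : detOn vert ∅ A = 1 := by
  rw [detOn, show maskMat vert ∅ A = 1 by ext r c; simp [maskMat, Matrix.one_apply], det_one]

theorem detOn_congr {S : Finset I} {A B : Matrix F F ℂ}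
    (h : ∀ r c, vert r ∈ S → vert c ∈ S → A r c = B r c) : detOn vert S A = detOn vert S B := by
  rw [detOn, detOn]
  congr 1
  ext r c
  simp only [maskMat]
  split_ifs with h1 h2
  · exact h r c h1 h2
  all_goals rfl

theorem detOn_eq_det_submatrix (S : Finset I) (A : Matrix F F ℂ) :
    detOn vert S A =
      (A.submatrix (Subtype.val : {f // vert f ∈ S} → F) Subtype.val).det := by
  rw [detOn, twoBlockTriangular_det _ (fun f => vert f ∈ S)]
  · have h1 : toSquareBlockProp (maskMat vert S A) (fun f => ¬vert f ∈ S) = 1 := by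
      ext r c
      rw [Matrix.one_apply]
      simp only [Subtype.ext_iff]
      exact if_neg r.2
    rw [h1, det_one, mul_one]
    congr 1
    ext r c
    exact (if_pos r.2).trans (if_pos c.2)
  · intro r hr c hc
    rw [maskMat, if_neg hr, if_neg]
    rintro rfl
    exact hr hc

/-- Without entries between X and Y, the masked matrix of the union is the product of the two masked
matrices. -/
theorem detOn_union {X Y : Finset I} (hXY : Disjoint X Y) {A : Matrix F F ℂ}
    (h1 : ∀ r c, vert r ∈ X → vert c ∈ Y → A r c = 0)
    (h2 : ∀ r c, vert r ∈ Y → vert c ∈ X → A r c = 0) :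
    detOn vert (X ∪ Y) A = detOn vert X A * detOn vert Y A := by
  rw [detOn, detOn, detOn, ← det_mul]
  congr 1
  ext r c
  rw [Matrix.mul_apply]
  by_cases hr : vert r ∈ X
  · have hXr : ∀ d, vert d ∈ X → vert d ∉ Y := fun d hd => Finset.disjoint_left.1 hXY hd
    rw [Finset.sum_eq_single c]
    · by_cases hc : vert c ∈ X
      · simp [maskMat, hr, hc, hXr c hc]
      · by_cases hcY : vert c ∈ Y
        · simp [maskMat, hr, hc, hcY, h1 r c hr hcY]
        · simp [maskMat, hr, hc, hcY]
    · intro d _ hd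
      by_cases hdX : vert d ∈ X
      · simp [maskMat, hdX, hXr d hdX, hd]
      · simp [maskMat, hr, hdX]
    · simp
  · rw [Finset.sum_eq_single r]
    · by_cases hrY : vert r ∈ Y
      · by_cases hcX : vert c ∈ X
        · have hcY : vert c ∉ Y := Finset.disjoint_left.1 hXY hcX
          simp [maskMat, hr, hrY, hcX, hcY, h2 r c hrY hcX]
        · simp [maskMat, hr, hrY, hcX]
      · simp [maskMat, hr, hrY]
    · intro d _ hd
      simp [maskMat, hr, hd.symm]
    · simp

/-- Weakening by the factor `t` of the coupling between `X` and its complement. -/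
def cut (X : Finset I) (t : ℝ) (Q : Matrix I I ℝ) : Matrix I I ℝ := fun i j =>
  if (i ∈ X ↔ j ∈ X) then Q i j else t * Q i j

theorem cut_one (X : Finset I) (Q : Matrix I I ℝ) : cut X 1 Q = Q := by
  ext i j; simp [cut]

/-- A contraction that connects the vertex `j` to the cluster `X`. -/
def IsLine (vert : F → I) (X : Finset I) (j : I) (ov : F → Option F) (r c : F) : Prop :=
  ov r = none ∧ (vert r ∈ X ∧ vert c = j ∨ vert r = j ∧ vert c ∈ X)

open Classical in
/-- The sum over all ways of attaching the vertices of `Y`, one after the other, to the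
cluster `X`. -/
def clus (vert : F → I) (G : Matrix F F ℂ) :
    ℕ → Finset I → (F → Option F) → Matrix I I ℝ → Finset I → ℂ
  | 0, X, ov, Q, _ => detOn vert X (lineMat vert G Q ov)
  | n + 1, X, ov, Q, Y => ∑ j ∈ Y, ∫ t in (0 : ℝ)..1, ∑ r, ∑ c,
      if IsLine vert X j ov r c then (Q (vert r) (vert c) : ℂ) * G r c *
        clus vert G n (insert j X) (Function.update ov r (some c)) (cut X t Q) (Y.erase j) else 0

theorem continuous_cut (X : Finset I) : Continuous fun p : Matrix I I ℝ × ℝ => cut X p.2 p.1 := by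
  refine continuous_matrix fun i j => ?_
  simp only [cut]
  have : Continuous fun p : Matrix I I ℝ × ℝ => p.1 i j := continuous_fst.matrix_elem i j
  split_ifs
  · exact this
  · exact continuous_snd.mul this

theorem continuous_lineMat {I F : Type} [DecidableEq F] {vert : F → I} {G : Matrix F F ℂ} (ov : F → Option F) :
    Continuous fun Q : Matrix I I ℝ => lineMat vert G Q ov := by
  refine continuous_matrix fun r c => ?_
  simp only [lineMat]
  cases ov r with
  | none =>
    exact (Complex.continuous_ofReal.comp (continuous_id.matrix_elem _ _)).mul continuous_const
  | some c' => exact continuous_const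

theorem continuous_detOn (S : Finset I) :
    Continuous fun A : Matrix F F ℂ => detOn vert S A := by
  refine Continuous.matrix_det (continuous_matrix fun r c => ?_)
  simp only [maskMat]
  split_ifs
  · exact continuous_id.matrix_elem _ _
  all_goals exact continuous_const

theorem continuous_clus [Fintype I] (n : ℕ) (X : Finset I) (ov : F → Option F) (Y : Finset I) :
    Continuous fun Q => clus vert G n X ov Q Y := by
  induction n generalizing X ov Y with
  | zero => exact (continuous_detOn X).comp (continuous_lineMat ov)
  | succ n ih =>
    simp only [clus]
    refine continuous_finsetSum _ fun j _ => ?_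
    refine intervalIntegral.continuous_parametric_intervalIntegral_of_continuous' ?_ 0 1
    refine continuous_finsetSum _ fun r _ => continuous_finsetSum _ fun c _ => ?_
    split_ifs
    · refine Continuous.mul (Continuous.mul ?_ continuous_const) ?_
      · exact Complex.continuous_ofReal.comp (continuous_fst.matrix_elem _ _)
      · exact (ih _ _ _).comp (continuous_cut X)
    · exact continuous_const

/-- A set Y with a distinguished first vertex j is the same as j together with the set of the
remaining vertices. -/
theorem sum_powerset_sum_erase (D : Finset I) (f : I → Finset I → ℂ) :
    ∑ Y ∈ D.powerset, ∑ j ∈ Y, f j (Y.erase j) =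
      ∑ j ∈ D, ∑ Y ∈ (D.erase j).powerset, f j Y := by
  rw [Finset.sum_sigma', Finset.sum_sigma']
  refine Finset.sum_bij' (fun p _ => ⟨p.2, p.1.erase p.2⟩) (fun p _ => ⟨insert p.1 p.2, p.1⟩)
    ?_ ?_ ?_ ?_ ?_
  · rintro ⟨Y, j⟩ h
    simp only [Finset.mem_sigma, Finset.mem_powerset] at h ⊢
    exact ⟨h.1 h.2, Finset.erase_subset_erase _ h.1⟩
  · rintro ⟨j, Y⟩ h
    simp only [Finset.mem_sigma, Finset.mem_powerset] at h ⊢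
    exact ⟨Finset.insert_subset h.1 (h.2.trans (Finset.erase_subset _ _)),
      Finset.mem_insert_self _ _⟩
  · rintro ⟨Y, j⟩ h
    simp only [Finset.mem_sigma, Finset.mem_powerset] at h
    simp [Finset.insert_erase h.2]
  · rintro ⟨j, Y⟩ h
    simp only [Finset.mem_sigma, Finset.mem_powerset] at h
    have : j ∉ Y := fun hj => by simpa using h.2 hj
    simp [Finset.erase_insert this]
  · intro p _; rfl

end Cluster

end

/-! ### The cluster expansion of principal minors. -/

section

open Matrix

section ClusterExpansion

variable {I F : Type} [DecidableEq I] [DecidableEq F] {vert : F → I} {G : Matrix F F ℂ}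

theorem updateRow_maskMat_lineMat {S : Finset I} (Q : Matrix I I ℝ) (ov : F → Option F) {r c : F}
    (hr : vert r ∈ S) (hc : vert c ∈ S) :
    updateRow (maskMat vert S (lineMat vert G Q ov)) r (Pi.single c 1) =
      maskMat vert S (lineMat vert G Q (Function.update ov r (some c))) := by
  ext r' c'
  by_cases h : r' = r
  · subst h
    rw [updateRow_self]
    by_cases hc' : vert c' ∈ S
    · simp [maskMat, lineMat, hr, hc']
    · have : c' ≠ c := by rintro rfl; exact hc' hc
      simp [maskMat, hr, hc', this]
  · rw [updateRow_ne h]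
    simp [maskMat, lineMat, Function.update_of_ne h]

-- Only entries between X and its complement depend on t, and they do so linearly. Each of them is a
-- line from X to exactly one new vertex j, and its cofactor is the same determinant with one more
-- row replaced, recorded in `ov`.
open Classical in
theorem hasDerivAt_detOn_cut [Fintype F] {S X : Finset I} (hX : X ⊆ S) (Q : Matrix I I ℝ) (ov : F → Option F)
    (t : ℝ) :
    HasDerivAt (fun t => detOn vert S (lineMat vert G (cut X t Q) ov))
      (∑ j ∈ S \ X, ∑ r, ∑ c, if IsLine vert X j ov r c then (Q (vert r) (vert c) : ℂ) * G r c *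
        detOn vert S (lineMat vert G (cut X t Q) (Function.update ov r (some c))) else 0) t := by
  let A' : Matrix F F ℂ := fun r c => if vert r ∈ S ∧ vert c ∈ S ∧ ov r = none ∧
    ¬(vert r ∈ X ↔ vert c ∈ X) then (Q (vert r) (vert c) : ℂ) * G r c else 0
  have hA : ∀ r c, HasDerivAt
      (fun t => maskMat vert S (lineMat vert G (cut X t Q) ov) r c) (A' r c) t := by
    intro r c
    by_cases hr : vert r ∈ S
    swap
    · simpa [maskMat, hr, A'] using hasDerivAt_const t _
    by_cases hc : vert c ∈ S
    swap
    · simpa [maskMat, hr, hc, A'] using hasDerivAt_const t _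
    rcases hov : ov r with _ | c'
    swap
    · simpa [maskMat, lineMat, hr, hc, hov, A'] using hasDerivAt_const t _
    by_cases hx : vert r ∈ X ↔ vert c ∈ X
    · simpa [maskMat, lineMat, hr, hc, hov, hx, A', cut] using hasDerivAt_const t _
    · simp only [maskMat, lineMat, hr, hc, hov, hx, A', cut, if_true, if_false, Option.elim_none,
        true_and, not_false_eq_true, Complex.ofReal_mul]
      have := (((hasDerivAt_id t).ofReal_comp).mul_const (Q (vert r) (vert c) : ℂ)).mul_const (G r c)
      simpa using this
  refine (hasDerivAt_det hA).congr_deriv ?_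
  refine Eq.trans ?_ Finset.sum_comm
  refine Finset.sum_congr rfl fun r _ => Eq.trans ?_ Finset.sum_comm
  refine Finset.sum_congr rfl fun c _ => ?_
  by_cases h : vert r ∈ S ∧ vert c ∈ S ∧ ov r = none ∧ ¬(vert r ∈ X ↔ vert c ∈ X)
  · obtain ⟨hr, hc, hov, hx⟩ := h
    simp only [A', hr, hc, hov, hx, not_false_eq_true, and_self, if_true]
    rw [updateRow_maskMat_lineMat _ _ hr hc]
    by_cases hrX : vert r ∈ X
    · have hcX : vert c ∉ X := fun h => hx (by simp [hrX, h])
      rw [Finset.sum_eq_single (vert c)]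
      · rw [if_pos ⟨hov, Or.inl ⟨hrX, rfl⟩⟩]; rfl
      · intro j hj hjc
        rw [if_neg]
        rintro ⟨-, ⟨-, h⟩ | ⟨-, h⟩⟩
        · exact hjc h.symm
        · exact hcX h
      · intro h; exact (h (by simp [hc, hcX])).elim
    · have hcX : vert c ∈ X := by by_contra h; exact hx (by simp [hrX, h])
      rw [Finset.sum_eq_single (vert r)]
      · rw [if_pos ⟨hov, Or.inr ⟨rfl, hcX⟩⟩]; rfl
      · intro j hj hjc
        rw [if_neg]
        rintro ⟨-, ⟨h, -⟩ | ⟨h, -⟩⟩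
        · exact hrX h
        · exact hjc h.symm
      · intro h; exact (h (by simp [hr, hrX])).elim
  · simp only [A', if_neg h, zero_mul]
    symm
    refine Finset.sum_eq_zero fun j hj => if_neg ?_
    rw [Finset.mem_sdiff] at hj
    rintro ⟨hov, ⟨h1, h2⟩ | ⟨h1, h2⟩⟩
    · refine h ⟨hX h1, h2 ▸ hj.1, hov, fun h3 => hj.2 ?_⟩
      rw [← h2]; exact h3.1 h1
    · refine h ⟨h1 ▸ hj.1, hX h2, hov, fun h3 => hj.2 ?_⟩
      rw [← h1]; exact h3.2 h2

/-- The cluster expansion of a principal minor. -/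
theorem detOn_eq_sum_clus [Fintype I] [Fintype F] (n : ℕ) (S X : Finset I) (ov : F → Option F) (Q : Matrix I I ℝ)
    (hX : X ⊆ S) (hn : (S \ X).card = n)
    (hov : ∀ r c, ov r = some c → vert r ∈ X ∧ vert c ∈ X)
    (hQ : ∀ i j, i ∉ X → j ∉ X → Q i j = 1) :
    detOn vert S (lineMat vert G Q ov) =
      ∑ Y ∈ (S \ X).powerset, clus vert G Y.card X ov Q Y * detOn vert ((S \ X) \ Y) G := by
  classical
  induction n generalizing X ov Q with
  | zero =>
    rw [Finset.card_eq_zero] at hn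
    have hSX : S = X := (Finset.sdiff_eq_empty_iff_subset.1 hn).antisymm hX
    rw [hn, Finset.powerset_empty, Finset.sum_singleton, Finset.card_empty, clus, hSX]
    simp [detOn_empty]
  | succ n ih =>
    -- At t = 0 nothing couples X to its complement. Outside X no row has been replaced and all
    -- weights are still one, so the second factor is the original minor.
    have hzero : detOn vert S (lineMat vert G (cut X 0 Q) ov) =
        detOn vert X (lineMat vert G Q ov) * detOn vert (S \ X) G := by
      conv_lhs => rw [← Finset.union_sdiff_of_subset hX]
      rw [detOn_union Finset.disjoint_sdiff]
      · congr 1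
        · refine detOn_congr fun r c hr hc => ?_
          rcases h : ov r with _ | c' <;> simp [lineMat, h, cut, hr, hc]
        · refine detOn_congr fun r c hr hc => ?_
          rw [Finset.mem_sdiff] at hr hc
          have hr' : ov r = none := by
            rcases h : ov r with _ | c'
            · rfl
            · exact (hr.2 (hov r c' h).1).elim
          simp [lineMat, hr', cut, hr.2, hc.2, hQ _ _ hr.2 hc.2]
      · intro r c hr hc
        rw [Finset.mem_sdiff] at hc
        rcases h : ov r with _ | c'
        · simp [lineMat, h, cut, hr, hc.2]
        · have : c ≠ c' := by rintro rfl; exact hc.2 (hov _ _ h).2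
          simp [lineMat, h, this]
      · intro r c hr hc
        rw [Finset.mem_sdiff] at hr
        rcases h : ov r with _ | c'
        · simp [lineMat, h, cut, hr.2, hc]
        · exact (hr.2 (hov _ _ h).1).elim
    have hcontcut : Continuous fun t : ℝ => cut X t Q :=
      (continuous_cut X).comp (continuous_const.prodMk continuous_id)
    have hcont : ∀ ov' : F → Option F, Continuous fun t : ℝ =>
        detOn vert S (lineMat vert G (cut X t Q) ov') := fun ov' =>
      (continuous_detOn S).comp ((continuous_lineMat ov').comp hcontcut)
    -- The original minor is the value at t = 1; the difference from the factorised value at t = 0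
    -- is the integral of the line terms, to each of which the induction hypothesis applies with the
    -- cluster enlarged by j.
    have hftc := intervalIntegral.integral_eq_sub_of_hasDerivAt (a := 0) (b := 1)
      (fun t _ => hasDerivAt_detOn_cut (vert := vert) (G := G) hX Q ov t) (by
        refine Continuous.intervalIntegrable ?_ _ _
        refine continuous_finsetSum _ fun j _ => continuous_finsetSum _ fun r _ =>
          continuous_finsetSum _ fun c _ => ?_
        split_ifs
        · exact continuous_const.mul (hcont _)
        · exact continuous_const)
    rw [cut_one, hzero] at hftc
    have hmain : detOn vert S (lineMat vert G Q ov) =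
        detOn vert X (lineMat vert G Q ov) * detOn vert (S \ X) G + ∑ j ∈ S \ X,
          ∑ Y ∈ ((S \ X).erase j).powerset, (∫ t in (0 : ℝ)..1, ∑ r, ∑ c,
            if IsLine vert X j ov r c then (Q (vert r) (vert c) : ℂ) * G r c *
              clus vert G Y.card (insert j X) (Function.update ov r (some c)) (cut X t Q) Y
            else 0) * detOn vert ((S \ X) \ insert j Y) G := by
      rw [eq_add_of_sub_eq' hftc.symm]
      congr 1
      have hIH : ∀ t : ℝ, ∀ j ∈ S \ X, (∑ r, ∑ c, if IsLine vert X j ov r c then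
          (Q (vert r) (vert c) : ℂ) * G r c *
          detOn vert S (lineMat vert G (cut X t Q) (Function.update ov r (some c))) else 0) =
          ∑ Y ∈ ((S \ X).erase j).powerset, (∑ r, ∑ c,
            if IsLine vert X j ov r c then (Q (vert r) (vert c) : ℂ) * G r c *
              clus vert G Y.card (insert j X) (Function.update ov r (some c)) (cut X t Q) Y
            else 0) * detOn vert ((S \ X) \ insert j Y) G := by
        intro t j hj
        have hj' := Finset.mem_sdiff.1 hj
        have hsd : S \ insert j X = (S \ X).erase j := by
          ext x; simp only [Finset.mem_sdiff, Finset.mem_insert, Finset.mem_erase]; tauto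
        simp only [Finset.sum_mul]
        refine Eq.trans ?_ Finset.sum_comm
        refine Finset.sum_congr rfl fun r _ => Eq.trans ?_ Finset.sum_comm
        refine Finset.sum_congr rfl fun c _ => ?_
        split_ifs with hl
        · rw [ih (insert j X) (Function.update ov r (some c)) (cut X t Q)
            (Finset.insert_subset hj'.1 hX)
            (by rw [hsd, Finset.card_erase_of_mem hj, hn]; rfl), hsd, Finset.mul_sum]
          · refine Finset.sum_congr rfl fun Y hY => ?_
            have : (S \ X).erase j \ Y = (S \ X) \ insert j Y := by
              ext x; simp only [Finset.mem_sdiff, Finset.mem_insert, Finset.mem_erase]; tauto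
            rw [this]; ring
          · intro r' c' h'
            by_cases hrr : r' = r
            · subst hrr
              rw [Function.update_self, Option.some.injEq] at h'
              subst h'
              rcases hl with ⟨-, ⟨h1, h2⟩ | ⟨h1, h2⟩⟩
              · exact ⟨Finset.mem_insert_of_mem h1, h2 ▸ Finset.mem_insert_self _ _⟩
              · exact ⟨h1 ▸ Finset.mem_insert_self _ _, Finset.mem_insert_of_mem h2⟩
            · rw [Function.update_of_ne hrr] at h'
              exact ⟨Finset.mem_insert_of_mem (hov _ _ h').1,
                Finset.mem_insert_of_mem (hov _ _ h').2⟩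
          · intro i i' hi hi'
            simp only [Finset.mem_insert, not_or] at hi hi'
            simp [cut, hi.2, hi'.2, hQ _ _ hi.2 hi'.2]
        · simp
      have hc1 : ∀ (j : I) (Y : Finset I), Continuous fun t : ℝ => (∑ r, ∑ c,
            if IsLine vert X j ov r c then (Q (vert r) (vert c) : ℂ) * G r c *
              clus vert G Y.card (insert j X) (Function.update ov r (some c)) (cut X t Q) Y
            else 0) * detOn vert ((S \ X) \ insert j Y) G := by
        intro j Y
        refine Continuous.mul ?_ continuous_const
        refine continuous_finsetSum _ fun r _ => continuous_finsetSum _ fun c _ => ?_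
        split_ifs
        · exact continuous_const.mul ((continuous_clus _ _ _ _).comp hcontcut)
        · exact continuous_const
      rw [intervalIntegral.integral_congr fun t _ => Finset.sum_congr rfl fun j hj => hIH t j hj,
        intervalIntegral.integral_finsetSum fun j _ =>
          (continuous_finsetSum _ fun Y _ => hc1 j Y).intervalIntegrable _ _]
      refine Finset.sum_congr rfl fun j _ => ?_
      rw [intervalIntegral.integral_finsetSum fun Y _ => (hc1 j Y).intervalIntegrable _ _]
      refine Finset.sum_congr rfl fun Y _ => ?_
      rw [intervalIntegral.integral_mul_const]
    -- Collecting the terms by the full set of attached vertices reproduces the defining recursion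
    -- of `clus`; the empty set is the factorised term.
    rw [hmain, ← sum_powerset_sum_erase (S \ X) fun j Y => (∫ t in (0 : ℝ)..1, ∑ r, ∑ c,
            if IsLine vert X j ov r c then (Q (vert r) (vert c) : ℂ) * G r c *
              clus vert G Y.card (insert j X) (Function.update ov r (some c)) (cut X t Q) Y
            else 0) * detOn vert ((S \ X) \ insert j Y) G]
    have hemp : ∀ f : Finset I → ℂ, ∑ Y ∈ (S \ X).powerset, f Y =
        f ∅ + ∑ Y ∈ (S \ X).powerset.erase ∅, f Y := fun f =>
      (Finset.add_sum_erase _ _ (Finset.empty_mem_powerset _)).symm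
    rw [hemp, hemp fun Y => clus vert G Y.card X ov Q Y * detOn vert ((S \ X) \ Y) G]
    simp only [Finset.sum_empty, zero_add, Finset.card_empty, clus, Finset.sdiff_empty]
    congr 1
    refine Finset.sum_congr rfl fun Y hY => ?_
    have hne : Y.Nonempty := Finset.nonempty_iff_ne_empty.2 (Finset.ne_of_mem_erase hY)
    obtain ⟨k, hk⟩ := Nat.exists_eq_succ_of_ne_zero hne.card_ne_zero
    rw [hk, clus, Finset.sum_mul]
    refine Finset.sum_congr rfl fun j hj => ?_
    rw [Finset.card_erase_of_mem hj, hk, Finset.insert_erase hj]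
    rfl

end ClusterExpansion

end

/-! ### Weight matrices and the bound of cluster sums by tree sums. -/

section

open Matrix

section CutWeights

variable {I : Type} [DecidableEq I]

/-- The weight matrices that occur in the cluster expansion. -/
structure IsWeight (Q : Matrix I I ℝ) : Prop where
  posSemidef : Q.PosSemidef
  diag : ∀ i, Q i i = 1
  nonneg : ∀ i j, 0 ≤ Q i j
  le_one : ∀ i j, Q i j ≤ 1

theorem IsWeight.symm {I : Type} {Q : Matrix I I ℝ} (hQ : IsWeight Q) (i j : I) :
    Q i j = Q j i := by
  have := hQ.posSemidef.isHermitian.apply i j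
  simpa using this.symm

theorem isWeight_one {I : Type} [Fintype I] : IsWeight (Matrix.of fun _ _ : I => (1 : ℝ)) where
  posSemidef := by
    have := posSemidef_vecMulVec_self_star (fun _ : I => (1 : ℝ))
    convert this using 1
    ext i j
    simp [vecMulVec_apply]
  diag _ := rfl
  nonneg _ _ := zero_le_one
  le_one _ _ := le_rfl

/-- The weakened matrix is the convex combination t Q + (1 - t) Q', where Q' is the block diagonal
part of Q with respect to X and its complement, again positive semidefinite. -/
theorem IsWeight.cut [Fintype I] {Q : Matrix I I ℝ} (hQ : IsWeight Q) (X : Finset I) {t : ℝ}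
    (ht : t ∈ Set.Icc (0 : ℝ) 1) : IsWeight (cut X t Q) where
  posSemidef := by
    let D : Matrix I I ℝ := diagonal fun i => if i ∈ X then 1 else 0
    let D' : Matrix I I ℝ := diagonal fun i => if i ∈ X then 0 else 1
    have h : Fermion.cut X t Q = t • Q + (1 - t) • (Dᴴ * Q * D + D'ᴴ * Q * D') := by
      ext i j
      simp only [D, D', diagonal_conjTranspose, Matrix.add_apply, Matrix.smul_apply, mul_diagonal, diagonal_mul,
        Fermion.cut, star_trivial, smul_eq_mul]
      by_cases hi : i ∈ X <;> by_cases hj : j ∈ X <;> simp [hi, hj] <;> ring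
    rw [h]
    exact (hQ.posSemidef.smul ht.1).add (((hQ.posSemidef.conjTranspose_mul_mul_same D).add
      (hQ.posSemidef.conjTranspose_mul_mul_same D')).smul (by linarith [ht.2]))
  diag i := by simp [Fermion.cut, hQ.diag]
  nonneg i j := by
    rw [Fermion.cut]
    split_ifs
    · exact hQ.nonneg i j
    · exact mul_nonneg ht.1 (hQ.nonneg i j)
  le_one i j := by
    rw [Fermion.cut]
    split_ifs
    · exact hQ.le_one i j
    · exact mul_le_one₀ ht.2 (hQ.nonneg i j) (hQ.le_one i j)

end CutWeights

/-- Replaced rows and rows outside X are unit vectors, so the determinant reduces to a minor of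
weighted propagators, to which `norm_det_propagator_le_one` applies. -/
theorem norm_detOn_lineMat_le_one {Ω : Type} [LinearOrder Ω] [Fintype Ω] {s : ℕ}
    {h : Matrix Ω Ω ℂ} (hh : h.IsHermitian) {β : ℝ}
    (P : Fin s → MultiIndex Ω) {τ : Fin s → ℝ} (hτ : ∀ i, τ i ∈ Set.Icc 0 β)
    {Q : Matrix (Fin s) (Fin s) ℝ} (hQ : IsWeight Q) (X : Finset (Fin s))
    (ov : FieldIdx P → Option (FieldIdx P)) :
    ‖detOn Sigma.fst X (lineMat Sigma.fst (fieldMat h β P τ) Q ov)‖ ≤ 1 := by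
  classical
  -- A unit vector pointing to a column outside X is masked to a zero row, and the determinant
  -- vanishes.
  by_cases hz : ∃ r c, r.1 ∈ X ∧ ov r = some c ∧ c.1 ∉ X
  · obtain ⟨r, c, hr, hrc, hc⟩ := hz
    rw [detOn, det_eq_zero_of_row_eq_zero r, norm_zero]
    · exact zero_le_one
    · intro c'
      simp only [maskMat, hr, if_true, lineMat, hrc, Option.elim_some]
      split_ifs with hc'
      · rw [Pi.single_eq_of_ne]
        rintro rfl
        exact hc hc'
      · rfl
  push Not at hz
  -- The identity rows of the mask are treated as further replaced rows, each pointing to its own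
  -- column.
  let ov' : FieldIdx P → Option (FieldIdx P) := fun r => if r.1 ∈ X then ov r else some r
  refine norm_det_le_one_of_override _ (fun r c => (Q r.1 c.1 : ℂ) * fieldMat h β P τ r c) ov'
    ?_ ?_ ?_
  · intro r c hrc
    ext c'
    by_cases hr : r.1 ∈ X
    · simp only [ov', hr, if_true] at hrc
      simp only [maskMat, hr, if_true, lineMat, hrc, Option.elim_some]
      split_ifs with hc'
      · rfl
      · rw [Pi.single_eq_of_ne]
        rintro rfl
        exact hc' (hz _ _ hr hrc)
    · simp only [ov', hr, if_false, Option.some.injEq] at hrc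
      subst hrc
      simp only [maskMat, hr, if_false, Pi.single_apply, eq_comm]
  · intro r hr c hc
    have hrX : r.1 ∈ X := by
      by_contra h
      simp [ov', h] at hr
    have hcX : c.1 ∈ X := by
      by_contra h
      exact hc c (by simp [ov', h])
    simp only [ov', hrX, if_true] at hr
    simp [maskMat, hrX, hcX, lineMat, hr]
  · intro e
    refine norm_det_propagator_le_one hh hτ hQ.posSemidef hQ.diag (fun i => (timeRank τ i : ℕ))
      (fun i j hij => le_of_timeRank_le hij) e (fun r => r.1.1)
      (fun r => (P r.1.1).minus r.1.2) (fun c => c.1.1) (fun c => (P c.1.1).plus c.1.2)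
      (fun r c => (Q r.1.1 c.1.1 : ℂ) * fieldMat h β P τ r.1 c.1) ?_
    intro r c
    simp only [fieldMat, before_iff_timeRank_lt, Fin.lt_def]

section TreeBound

variable {I : Type} [DecidableEq I]

/-- The sum over all ways of attaching the vertices of `Y` to the cluster `X` by single lines of
strength `T`. -/
def treeSum (T : I → I → ℝ) : ℕ → Finset I → Matrix I I ℝ → Finset I → ℝ
  | 0, _, _, _ => 1
  | n + 1, X, Q, Y => ∑ j ∈ Y, ∫ t in (0 : ℝ)..1, ∑ i ∈ X,
      Q i j * T i j * treeSum T n (insert j X) (cut X t Q) (Y.erase j)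

theorem continuous_treeSum [Fintype I] (T : I → I → ℝ) (n : ℕ) (X Y : Finset I) :
    Continuous fun Q => treeSum T n X Q Y := by
  induction n generalizing X Y with
  | zero => exact continuous_const
  | succ n ih =>
    simp only [treeSum]
    refine continuous_finsetSum _ fun j _ => ?_
    refine intervalIntegral.continuous_parametric_intervalIntegral_of_continuous' ?_ 0 1
    refine continuous_finsetSum _ fun i _ => ?_
    exact ((continuous_fst.matrix_elem _ _).mul continuous_const).mul
      ((ih _ _).comp (continuous_cut X))

theorem continuous_treeSum_cut [Fintype I] (T : I → I → ℝ) (n : ℕ) (X X' Y : Finset I)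
    (Q : Matrix I I ℝ) : Continuous fun t => treeSum T n X' (cut X t Q) Y :=
  (continuous_treeSum T n X' Y).comp
    ((continuous_cut X).comp (continuous_const.prodMk continuous_id))

theorem treeSum_nonneg [Fintype I] {T : I → I → ℝ} (hT : ∀ i j, 0 ≤ T i j) (n : ℕ)
    (X Y : Finset I) {Q : Matrix I I ℝ} (hQ : IsWeight Q) : 0 ≤ treeSum T n X Q Y := by
  induction n generalizing X Y Q with
  | zero => exact zero_le_one
  | succ n ih =>
    simp only [treeSum]
    refine Finset.sum_nonneg fun j _ => intervalIntegral.integral_nonneg zero_le_one fun t ht => ?_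
    exact Finset.sum_nonneg fun i _ =>
      mul_nonneg (mul_nonneg (hQ.nonneg _ _) (hT _ _)) (ih _ _ (hQ.cut X ht))

open Classical in
/-- The sum of the absolute values of all contractions between the vertices `i` and `j`. -/
def lineSum {F : Type} [Fintype F] (vert : F → I) (G : Matrix F F ℂ) (i j : I) : ℝ :=
  ∑ r, ∑ c, if vert r = i ∧ vert c = j ∨ vert r = j ∧ vert c = i then ‖G r c‖ else 0

theorem lineSum_nonneg {F : Type} [Fintype F] (vert : F → I) (G : Matrix F F ℂ) (i j : I) :
    0 ≤ lineSum vert G i j := by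
  refine Finset.sum_nonneg fun r _ => Finset.sum_nonneg fun c _ => ?_
  split_ifs
  · exact norm_nonneg _
  · exact le_rfl

variable {F : Type} [Fintype F] {vert : F → I} {G : Matrix F F ℂ}

open Classical in
theorem sum_isLine_le {Q : Matrix I I ℝ} (hQ : IsWeight Q) (X : Finset I) (j : I)
    (ov : F → Option F) :
    (∑ r, ∑ c, if IsLine vert X j ov r c then Q (vert r) (vert c) * ‖G r c‖ else 0) ≤
      ∑ i ∈ X, Q i j * lineSum vert G i j := by
  have h1 : ∑ i ∈ X, Q i j * lineSum vert G i j = ∑ r, ∑ c, ∑ i ∈ X, Q i j *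
      if vert r = i ∧ vert c = j ∨ vert r = j ∧ vert c = i then ‖G r c‖ else 0 := by
    simp only [lineSum, Finset.mul_sum]
    rw [Finset.sum_comm]
    exact Finset.sum_congr rfl fun r _ => Finset.sum_comm
  rw [h1]
  refine Finset.sum_le_sum fun r _ => Finset.sum_le_sum fun c _ => ?_
  have hnn : ∀ i ∈ X, 0 ≤ Q i j *
      if vert r = i ∧ vert c = j ∨ vert r = j ∧ vert c = i then ‖G r c‖ else 0 := by
    intro i _
    refine mul_nonneg (hQ.nonneg _ _) ?_
    split_ifs
    · exact norm_nonneg _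
    · exact le_rfl
  split_ifs with hl
  · rcases hl with ⟨-, ⟨h1, h2⟩ | ⟨h1, h2⟩⟩
    · refine le_trans (le_of_eq ?_) (Finset.single_le_sum hnn h1)
      rw [if_pos (Or.inl ⟨rfl, h2⟩), h2]
    · refine le_trans (le_of_eq ?_) (Finset.single_le_sum hnn h2)
      rw [if_pos (Or.inr ⟨h1, rfl⟩), h1, hQ.symm]
  · exact Finset.sum_nonneg hnn

/-- If all determinants are bounded by one, the cluster sum is bounded by a sum over trees. -/
theorem norm_clus_le_treeSum [Fintype I] [DecidableEq F]
    (hdet : ∀ Q : Matrix I I ℝ, IsWeight Q → ∀ X ov, ‖detOn vert X (lineMat vert G Q ov)‖ ≤ 1)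
    (n : ℕ) (X : Finset I) (ov : F → Option F) {Q : Matrix I I ℝ} (hQ : IsWeight Q)
    (Y : Finset I) : ‖clus vert G n X ov Q Y‖ ≤ treeSum (lineSum vert G) n X Q Y := by
  classical
  induction n generalizing X ov Q Y with
  | zero => exact hdet Q hQ X ov
  | succ n ih =>
    rw [clus, treeSum]
    refine (norm_sum_le _ _).trans (Finset.sum_le_sum fun j _ => ?_)
    refine intervalIntegral.norm_integral_le_of_norm_le zero_le_one ?_ ?_
    · refine Filter.Eventually.of_forall fun t ht => ?_
      have ht' : t ∈ Set.Icc (0 : ℝ) 1 := ⟨ht.1.le, ht.2⟩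
      set B := treeSum (lineSum vert G) n (insert j X) (cut X t Q) (Y.erase j)
      have hB : 0 ≤ B := treeSum_nonneg (lineSum_nonneg vert G) _ _ _ (hQ.cut X ht')
      calc _ ≤ ∑ r, ∑ c, (if IsLine vert X j ov r c then Q (vert r) (vert c) * ‖G r c‖ else 0) * B := by
            refine (norm_sum_le _ _).trans (Finset.sum_le_sum fun r _ => ?_)
            refine (norm_sum_le _ _).trans (Finset.sum_le_sum fun c _ => ?_)
            split_ifs
            · rw [norm_mul, norm_mul, Complex.norm_real, Real.norm_of_nonneg (hQ.nonneg _ _)]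
              exact mul_le_mul_of_nonneg_left (ih _ _ (hQ.cut X ht') _)
                (mul_nonneg (hQ.nonneg _ _) (norm_nonneg _))
            · simp
        _ = (∑ r, ∑ c, if IsLine vert X j ov r c then Q (vert r) (vert c) * ‖G r c‖ else 0) * B := by
            simp only [Finset.sum_mul]
        _ ≤ (∑ i ∈ X, Q i j * lineSum vert G i j) * B :=
            mul_le_mul_of_nonneg_right (sum_isLine_le hQ X j ov) hB
        _ = _ := Finset.sum_mul _ _ _
    · refine Continuous.intervalIntegrable ?_ _ _
      exact continuous_finsetSum _ fun i _ =>
        continuous_const.mul (continuous_treeSum_cut _ _ _ _ _ _)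

end TreeBound

end

/-! ### Summation of the trees over the labels of their vertices. -/

section

open Matrix

section LabelSum

variable {I ι : Type} [Fintype I] [DecidableEq I] [Fintype ι] [DecidableEq ι]

/-- The functions that agree with `p₀` off `Y`. -/
def agree (Y : Finset I) (p₀ : I → ι) : Finset (I → ι) :=
  Finset.univ.filter fun p => ∀ i, i ∉ Y → p i = p₀ i

theorem mem_agree {Y : Finset I} {p₀ p : I → ι} : p ∈ agree Y p₀ ↔ ∀ i, i ∉ Y → p i = p₀ i := by
  simp [agree]

theorem sum_agree_eq {Y : Finset I} {j : I} (hj : j ∈ Y) (p₀ : I → ι) (f : (I → ι) → ℝ) :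
    ∑ p ∈ agree Y p₀, f p = ∑ b, ∑ p ∈ agree (Y.erase j) (Function.update p₀ j b), f p := by
  rw [← Finset.sum_fiberwise (agree Y p₀) (fun p => p j)]
  refine Finset.sum_congr rfl fun b _ => Finset.sum_congr ?_ fun _ _ => rfl
  ext p
  simp only [Finset.mem_filter, mem_agree, Finset.mem_erase, not_and]
  constructor
  · rintro ⟨h1, rfl⟩ i hi
    by_cases hij : i = j
    · subst hij; simp
    · rw [Function.update_of_ne hij]; exact h1 i (hi hij)
  · intro h
    have h1 : p j = b := by simpa using h j (fun h => (h rfl).elim)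
    refine ⟨fun i hi => ?_, h1⟩
    have hij : i ≠ j := by rintro rfl; exact hi hj
    simpa [Function.update_of_ne hij] using h i (fun _ => hi)

/-- The bound e^σ reproduces itself under attaching a vertex: the factor σ and the new bound t σ + 1
form an exact derivative in t, so each attachment costs only a factor e. -/
theorem integral_mul_exp_add_one_le (σ : ℝ) :
    ∫ t in (0 : ℝ)..1, σ * Real.exp (t * σ + 1) ≤ Real.exp 1 * Real.exp σ := by
  have h : ∀ t ∈ Set.uIcc (0 : ℝ) 1,
      HasDerivAt (fun t => Real.exp (t * σ + 1)) (σ * Real.exp (t * σ + 1)) t := by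
    intro t _
    have := ((hasDerivAt_mul_const (x := t) σ).add_const 1).exp
    simpa [mul_comm] using this
  rw [intervalIntegral.integral_eq_sub_of_hasDerivAt h]
  · rw [one_mul, zero_mul, zero_add, Real.exp_add, mul_comm (Real.exp 1)]
    linarith [Real.exp_pos 1]
  · exact Continuous.intervalIntegrable (by fun_prop) _ _

/-- The sum over all labels of the vertices of `Y` of the tree sums. -/
theorem sum_agree_treeSum_le {wt : ι → ℝ} (hwt : ∀ a, 0 ≤ wt a) {w : I → I → ι → ι → ℝ}
    (hw : ∀ i j a b, 0 ≤ w i j a b) {lam : ℝ} (hlam0 : 0 ≤ lam)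
    (hlam : ∀ i j a, i ≠ j → ∑ b, wt b * w i j a b ≤ lam) (n : ℕ) {X Y : Finset I}
    (hXY : Disjoint X Y) (hY : Y.card = n) {Q : Matrix I I ℝ} (hQ : IsWeight Q) {σ : ℝ}
    (hσ0 : 0 ≤ σ) (hσ : ∀ j ∈ Y, ∑ i ∈ X, Q i j ≤ σ) (p₀ : I → ι) :
    ∑ p ∈ agree Y p₀, (∏ y ∈ Y, wt (p y)) * treeSum (fun i j => w i j (p i) (p j)) n X Q Y ≤
      n.factorial * Real.exp 1 ^ n * Real.exp σ * lam ^ n := by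
  induction n generalizing X Y Q σ p₀ with
  | zero =>
    rw [Finset.card_eq_zero] at hY
    subst hY
    have : agree ∅ p₀ = {p₀} := by
      ext p
      simp [mem_agree, funext_iff]
    simpa [this, treeSum] using hσ0
  | succ n ih =>
    have hcont : ∀ (p : I → ι) (j : I), Continuous fun t : ℝ => ∑ i ∈ X, Q i j * w i j (p i) (p j) *
        treeSum (fun i j => w i j (p i) (p j)) n (insert j X) (cut X t Q) (Y.erase j) := fun p j =>
      continuous_finsetSum _ fun i _ => continuous_const.mul (continuous_treeSum_cut _ _ _ _ _ _)
    have hswap : ∑ p ∈ agree Y p₀, (∏ y ∈ Y, wt (p y)) *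
          treeSum (fun i j => w i j (p i) (p j)) (n + 1) X Q Y =
        ∑ j ∈ Y, ∫ t in (0 : ℝ)..1, ∑ p ∈ agree Y p₀, (∏ y ∈ Y, wt (p y)) *
          ∑ i ∈ X, Q i j * w i j (p i) (p j) *
            treeSum (fun i j => w i j (p i) (p j)) n (insert j X) (cut X t Q) (Y.erase j) := by
      simp only [treeSum, Finset.mul_sum (s := Y)]
      rw [Finset.sum_comm]
      refine Finset.sum_congr rfl fun j _ => ?_
      refine Eq.trans (Finset.sum_congr rfl fun p _ => ?_) (intervalIntegral.integral_finsetSum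
        fun p _ => (Continuous.intervalIntegrable ?_ _ _)).symm
      · exact (intervalIntegral.integral_const_mul _ _).symm
      · exact continuous_const.mul (hcont p j)
    -- The bound is the same for each of the n + 1 choices of the vertex attached first, which turns
    -- n! into (n + 1)!.
    have hj : ∀ j ∈ Y, (∫ t in (0 : ℝ)..1, ∑ p ∈ agree Y p₀, (∏ y ∈ Y, wt (p y)) *
          ∑ i ∈ X, Q i j * w i j (p i) (p j) *
            treeSum (fun i j => w i j (p i) (p j)) n (insert j X) (cut X t Q) (Y.erase j)) ≤
        n.factorial * Real.exp 1 ^ (n + 1) * Real.exp σ * lam ^ (n + 1) := by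
      intro j hj
      have hpt : ∀ t ∈ Set.Icc (0 : ℝ) 1, (∑ p ∈ agree Y p₀, (∏ y ∈ Y, wt (p y)) *
          ∑ i ∈ X, Q i j * w i j (p i) (p j) *
            treeSum (fun i j => w i j (p i) (p j)) n (insert j X) (cut X t Q) (Y.erase j)) ≤
          (n.factorial * Real.exp 1 ^ n * lam ^ (n + 1)) * (σ * Real.exp (t * σ + 1)) := by
        intro t ht
        set K : ℝ := n.factorial * Real.exp 1 ^ n * Real.exp (t * σ + 1) * lam ^ n with hK
        have hK0 : 0 ≤ K := by positivity
        rw [sum_agree_eq hj]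
        -- σ bounds the total weight from the cluster to any remaining vertex. After j is attached,
        -- the old weights are scaled by t and j adds at most one, so the induction hypothesis is
        -- used with t σ + 1.
        have hIH : ∀ b, ∑ p ∈ agree (Y.erase j) (Function.update p₀ j b),
            (∏ y ∈ Y.erase j, wt (p y)) * treeSum (fun i j => w i j (p i) (p j)) n
              (insert j X) (cut X t Q) (Y.erase j) ≤ K := by
          intro b
          refine ih ?_ (by rw [Finset.card_erase_of_mem hj, hY]; rfl) (hQ.cut X ht)
            (by nlinarith [ht.1]) ?_ _
          · rw [Finset.disjoint_insert_left]
            exact ⟨by simp, hXY.mono_right (Finset.erase_subset _ _)⟩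
          · intro k hk
            have hkY := Finset.mem_of_mem_erase hk
            have hkX : k ∉ X := fun h => Finset.disjoint_left.1 hXY h hkY
            have hjX : j ∉ X := fun h => Finset.disjoint_left.1 hXY h hj
            rw [Finset.sum_insert hjX]
            have h1 : ∑ i ∈ X, cut X t Q i k = t * ∑ i ∈ X, Q i k := by
              rw [Finset.mul_sum]
              refine Finset.sum_congr rfl fun i hi => ?_
              simp [cut, hi, hkX]
            rw [h1]
            have h2 := mul_le_mul_of_nonneg_left (hσ k hkY) ht.1
            have h3 := (hQ.cut X ht).le_one j k
            linarith
        calc _ = ∑ b, (wt b * ∑ i ∈ X, Q i j * w i j (p₀ i) b) *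
              ∑ p ∈ agree (Y.erase j) (Function.update p₀ j b), (∏ y ∈ Y.erase j, wt (p y)) *
                treeSum (fun i j => w i j (p i) (p j)) n (insert j X) (cut X t Q) (Y.erase j) := by
              refine Finset.sum_congr rfl fun b _ => ?_
              rw [Finset.mul_sum]
              refine Finset.sum_congr rfl fun p hp => ?_
              rw [mem_agree] at hp
              have hpj : p j = b := by simpa using hp j (by simp)
              have hpi : ∀ i ∈ X, p i = p₀ i := by
                intro i hi
                have hiY : i ∉ Y := Finset.disjoint_left.1 hXY hi
                have hij : i ≠ j := by rintro rfl; exact hiY hj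
                simpa [Function.update_of_ne hij] using
                  hp i (fun h => hiY (Finset.mem_of_mem_erase h))
              rw [← Finset.mul_prod_erase _ _ hj, hpj, ← Finset.sum_mul,
                Finset.sum_congr rfl fun i hi => by rw [hpi i hi]]
              ring
          _ ≤ ∑ b, (wt b * ∑ i ∈ X, Q i j * w i j (p₀ i) b) * K := by
              refine Finset.sum_le_sum fun b _ => mul_le_mul_of_nonneg_left (hIH b) ?_
              exact mul_nonneg (hwt b) (Finset.sum_nonneg fun i _ =>
                mul_nonneg (hQ.nonneg _ _) (hw _ _ _ _))
          _ = (∑ i ∈ X, Q i j * ∑ b, wt b * w i j (p₀ i) b) * K := by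
              rw [← Finset.sum_mul]
              congr 1
              simp only [Finset.mul_sum]
              rw [Finset.sum_comm]
              exact Finset.sum_congr rfl fun i _ => Finset.sum_congr rfl fun b _ => by ring
          _ ≤ (∑ i ∈ X, Q i j * lam) * K := by
              refine mul_le_mul_of_nonneg_right (Finset.sum_le_sum fun i hi => ?_) hK0
              refine mul_le_mul_of_nonneg_left (hlam i j _ ?_) (hQ.nonneg _ _)
              rintro rfl
              exact Finset.disjoint_left.1 hXY hi hj
          _ ≤ (σ * lam) * K := by
              rw [← Finset.sum_mul]
              exact mul_le_mul_of_nonneg_right (mul_le_mul_of_nonneg_right (hσ j hj) hlam0) hK0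
          _ = _ := by rw [hK]; ring
      calc _ ≤ ∫ t in (0 : ℝ)..1,
            (n.factorial * Real.exp 1 ^ n * lam ^ (n + 1)) * (σ * Real.exp (t * σ + 1)) := by
            refine intervalIntegral.integral_mono_on zero_le_one ?_ ?_ hpt
            · exact (continuous_finsetSum _ fun p _ =>
                continuous_const.mul (hcont p j)).intervalIntegrable _ _
            · exact Continuous.intervalIntegrable (by fun_prop) _ _
        _ = (n.factorial * Real.exp 1 ^ n * lam ^ (n + 1)) *
            ∫ t in (0 : ℝ)..1, σ * Real.exp (t * σ + 1) := intervalIntegral.integral_const_mul _ _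
        _ ≤ (n.factorial * Real.exp 1 ^ n * lam ^ (n + 1)) * (Real.exp 1 * Real.exp σ) :=
            mul_le_mul_of_nonneg_left (integral_mul_exp_add_one_le σ) (by positivity)
        _ = _ := by ring
    rw [hswap]
    refine (Finset.sum_le_sum hj).trans (le_of_eq ?_)
    rw [Finset.sum_const, hY, nsmul_eq_mul, Nat.factorial_succ, Nat.cast_mul]
    ring

end LabelSum

end

/-! ### Moments and cumulants of set functions. -/

section

section Cumulants

variable {I : Type} [DecidableEq I]

/-- The cumulants of a set function. -/
def cumul (e : Finset I → ℂ) (S : Finset I) : ℂ :=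
  ∑ π : Finpartition S, (-1) ^ (π.parts.card - 1) * ((π.parts.card - 1).factorial : ℂ) *
    ∏ B ∈ π.parts, e B

/-- The partitions of `S` as sets of sets. -/
def setPartitions (S : Finset I) : Finset (Finset (Finset I)) :=
  Finset.univ.image fun π : Finpartition S => π.parts

theorem mem_setPartitions {S : Finset I} {ρ : Finset (Finset I)} :
    ρ ∈ setPartitions S ↔ ∃ π : Finpartition S, π.parts = ρ := by
  simp [setPartitions]

theorem sum_finpartition (S : Finset I) (f : Finset (Finset I) → ℂ) :
    ∑ π : Finpartition S, f π.parts = ∑ ρ ∈ setPartitions S, f ρ := by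
  rw [setPartitions, Finset.sum_image]
  intro π _ π' _ h
  exact Finpartition.ext h

theorem exists_erase_parts {S : Finset I} (π : Finpartition S) {D : Finset I} (hD : D ∈ π.parts) :
    ∃ π' : Finpartition (S \ D), π'.parts = π.parts.erase D := by
  refine ⟨⟨π.parts.erase D, π.supIndep.subset (Finset.erase_subset _ _), ?_, fun h =>
    π.bot_notMem (Finset.mem_of_mem_erase h)⟩, rfl⟩
  ext x
  simp only [Finset.mem_sup, Finset.mem_erase, id, Finset.mem_sdiff]
  constructor
  · rintro ⟨B, ⟨hBD, hB⟩, hx⟩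
    exact ⟨π.subset hB hx, fun hxD => hBD (π.eq_of_mem_parts hB hD hx hxD)⟩
  · rintro ⟨hx, hxD⟩
    obtain ⟨B, hB, hxB⟩ := π.exists_mem hx
    exact ⟨B, ⟨by rintro rfl; exact hxD hxB, hB⟩, hxB⟩

/-- Adjoining the block Y \ Z to a partition of Z ∪ {r} gives a partition of Y ∪ {r} with a marked
block avoiding r, and deleting the marked block is the inverse. Z = Y is excluded because its block
would be empty. -/
theorem sum_powerset_erase_setPartitions {r : I} {Y : Finset I} (hr : r ∉ Y)
    (f : Finset (Finset I) → Finset I → ℂ) :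
    ∑ Z ∈ Y.powerset.erase Y, ∑ π ∈ setPartitions (insert r Z), f π (Y \ Z) =
      ∑ ρ ∈ setPartitions (insert r Y), ∑ D ∈ ρ.filter (r ∉ ·), f (ρ.erase D) D := by
  rw [Finset.sum_sigma', Finset.sum_sigma']
  have hsd : ∀ {D : Finset I}, D ⊆ insert r Y → r ∉ D → D ⊆ Y := by
    intro D hD hrD x hx
    rcases Finset.mem_insert.1 (hD hx) with rfl | h
    · exact (hrD hx).elim
    · exact h
  have hnot : ∀ Z, Z ∈ Y.powerset.erase Y → ∀ π ∈ setPartitions (insert r Z), Y \ Z ∉ π := by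
    intro Z hZ π hπ h
    obtain ⟨π', rfl⟩ := mem_setPartitions.1 hπ
    have h1 := π'.subset h
    obtain ⟨x, hx⟩ := π'.nonempty_of_mem_parts h
    have h2 := h1 hx
    rw [Finset.mem_sdiff] at hx
    rcases Finset.mem_insert.1 h2 with rfl | h
    · exact hr hx.1
    · exact hx.2 h
  refine Finset.sum_bij' (fun p _ => ⟨insert (Y \ p.1) p.2, Y \ p.1⟩)
    (fun p _ => ⟨Y \ p.2, p.1.erase p.2⟩) ?_ ?_ ?_ ?_ ?_
  · rintro ⟨Z, π⟩ h
    rw [Finset.mem_sigma] at h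
    obtain ⟨π', hπ'⟩ := mem_setPartitions.1 h.2
    have hZ := Finset.mem_erase.1 h.1
    rw [Finset.mem_powerset] at hZ
    simp only [Finset.mem_sigma, Finset.mem_filter, Finset.mem_insert_self,
      Finset.mem_sdiff, hr, false_and, not_false_eq_true, and_true]
    refine mem_setPartitions.2 ⟨π'.extend (b := Y \ Z) ?_ ?_ ?_, ?_⟩
    · intro h0
      exact hZ.1 (hZ.2.antisymm (Finset.sdiff_eq_empty_iff_subset.1 h0))
    · rw [Finset.disjoint_insert_left]
      exact ⟨by simp [hr], Finset.disjoint_sdiff⟩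
    · simp [Finset.insert_union, Finset.union_sdiff_of_subset hZ.2]
    · exact congrArg (insert (Y \ Z)) hπ'
  · rintro ⟨ρ, D⟩ h
    simp only [Finset.mem_sigma, Finset.mem_filter] at h
    obtain ⟨hρ, hD, hrD⟩ := h
    obtain ⟨ρ', rfl⟩ := mem_setPartitions.1 hρ
    have hDY := hsd (ρ'.subset hD) hrD
    simp only [Finset.mem_sigma, Finset.mem_erase, Finset.mem_powerset]
    refine ⟨⟨fun h => ?_, Finset.sdiff_subset⟩, mem_setPartitions.2 ?_⟩
    · obtain ⟨x, hx⟩ := ρ'.nonempty_of_mem_parts hD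
      have := hDY hx
      rw [← h, Finset.mem_sdiff] at this
      exact this.2 hx
    · rw [← Finset.insert_sdiff_of_notMem _ hrD]
      exact exists_erase_parts ρ' hD
  · rintro ⟨Z, π⟩ h
    rw [Finset.mem_sigma] at h
    have hZ := Finset.mem_powerset.1 (Finset.mem_of_mem_erase h.1)
    simp only [Finset.sdiff_sdiff_eq_self hZ, Finset.erase_insert (hnot Z h.1 π h.2)]
  · rintro ⟨ρ, D⟩ h
    simp only [Finset.mem_sigma, Finset.mem_filter] at h
    obtain ⟨hρ, hD, hrD⟩ := h
    obtain ⟨ρ', rfl⟩ := mem_setPartitions.1 hρ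
    have hDY := hsd (ρ'.subset hD) hrD
    simp only [Finset.sdiff_sdiff_eq_self hDY, Finset.insert_erase hD]
  · rintro ⟨Z, π⟩ h
    rw [Finset.mem_sigma] at h
    simp only [Finset.erase_insert (hnot Z h.1 π h.2)]

/-- The recursion between moments and cumulants. -/
theorem moment_cumul_recursion {e : Finset I → ℂ} (he : e ∅ = 1) {r : I} {Y : Finset I}
    (hr : r ∉ Y) :
    e (insert r Y) = ∑ Z ∈ Y.powerset, cumul e (insert r Z) * e (Y \ Z) := by
  rw [← Finset.add_sum_erase _ _ (Finset.mem_powerset_self Y), Finset.sdiff_self, he, mul_one]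
  let u : Finset (Finset I) → ℂ := fun ρ =>
    (-1) ^ (ρ.card - 1) * ((ρ.card - 1).factorial : ℂ) * ∏ B ∈ ρ, e B
  have hc : ∀ S, cumul e S = ∑ ρ ∈ setPartitions S, u ρ := fun S => sum_finpartition S u
  simp only [hc, Finset.sum_mul]
  rw [sum_powerset_erase_setPartitions hr fun π D => u π * e D, ← Finset.sum_add_distrib]
  have hne : insert r Y ≠ (⊥ : Finset I) := (Finset.insert_nonempty r Y).ne_empty
  have hone : ({insert r Y} : Finset (Finset I)) ∈ setPartitions (insert r Y) :=
    mem_setPartitions.2 ⟨Finpartition.indiscrete hne, rfl⟩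
  have hcard : ∀ ρ ∈ setPartitions (insert r Y), (ρ.filter (r ∉ ·)).card = ρ.card - 1 := by
    intro ρ hρ
    obtain ⟨π, rfl⟩ := mem_setPartitions.1 hρ
    obtain ⟨B, ⟨hB, hrB⟩, -⟩ := π.existsUnique_mem (Finset.mem_insert_self r Y)
    rw [← Finset.card_erase_of_mem hB]
    congr 1
    ext D
    simp only [Finset.mem_filter, Finset.mem_erase]
    constructor
    · rintro ⟨hD, hrD⟩
      exact ⟨by rintro rfl; exact hrD hrB, hD⟩
    · rintro ⟨hne, hD⟩
      exact ⟨hD, fun hrD => hne (π.eq_of_mem_parts hD hB hrD hrB)⟩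
  -- A partition into k blocks collects its own coefficient and k - 1 times that of k - 1 blocks,
  -- one for each block avoiding r. These cancel for k ≥ 2; for k = 1 the truncated k - 2 is
  -- harmless because the factor k - 1 vanishes.
  have hinner : ∀ ρ ∈ setPartitions (insert r Y),
      u ρ + ∑ D ∈ ρ.filter (r ∉ ·), u (ρ.erase D) * e D =
        ((-1) ^ (ρ.card - 1) * ((ρ.card - 1).factorial : ℂ) +
          ((ρ.card - 1 : ℕ) : ℂ) * ((-1) ^ (ρ.card - 2) * ((ρ.card - 2).factorial : ℂ))) *
        ∏ B ∈ ρ, e B := by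
    intro ρ hρ
    have : ∀ D ∈ ρ.filter (r ∉ ·), u (ρ.erase D) * e D =
        (-1) ^ (ρ.card - 2) * ((ρ.card - 2).factorial : ℂ) * ∏ B ∈ ρ, e B := by
      intro D hD
      have hD' := Finset.mem_of_mem_filter D hD
      simp only [u]
      rw [Finset.card_erase_of_mem hD', ← Finset.mul_prod_erase ρ e hD', Nat.sub_sub]
      ring
    rw [Finset.sum_congr rfl this, Finset.sum_const, hcard ρ hρ, nsmul_eq_mul]
    simp only [u]
    ring
  rw [Finset.sum_congr rfl hinner, Finset.sum_eq_single_of_mem _ hone]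
  · simp
  · intro ρ hρ hρ1
    obtain ⟨π, rfl⟩ := mem_setPartitions.1 hρ
    obtain ⟨B, ⟨hB, hrB⟩, -⟩ := π.existsUnique_mem (Finset.mem_insert_self r Y)
    have h2 : 2 ≤ π.parts.card := by
      by_contra hlt
      have h1 : π.parts.card = 1 := by
        have := Finset.card_pos.2 ⟨B, hB⟩
        omega
      obtain ⟨D, hD⟩ := Finset.card_eq_one.1 h1
      have := π.sup_parts
      rw [hD, Finset.sup_singleton] at this
      exact hρ1 (by rw [hD]; exact congrArg _ this)
    obtain ⟨k, hk⟩ := Nat.exists_eq_add_of_le' h2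
    rw [hk]
    simp only [Nat.add_sub_cancel, show k + 2 - 1 = k + 1 from rfl, Nat.factorial_succ,
      Nat.cast_mul, pow_succ]
    ring

/-- The recursion determines the cumulants. -/
theorem eq_cumul_of_recursion {e : Finset I → ℂ} (he : e ∅ = 1) {r : I} {c : Finset I → ℂ}
    (hc : ∀ Y, r ∉ Y → e (insert r Y) = ∑ Z ∈ Y.powerset, c Z * e (Y \ Z)) (Y : Finset I)
    (hr : r ∉ Y) : c Y = cumul e (insert r Y) := by
  induction Y using Finset.strongInduction with
  | H Y ih =>
    have h1 := hc Y hr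
    rw [moment_cumul_recursion he hr, ← Finset.add_sum_erase _ _ (Finset.mem_powerset_self Y),
      ← Finset.add_sum_erase _ (fun Z => c Z * e (Y \ Z)) (Finset.mem_powerset_self Y),
      Finset.sdiff_self, he, mul_one, mul_one] at h1
    have h2 : ∑ Z ∈ Y.powerset.erase Y, cumul e (insert r Z) * e (Y \ Z) =
        ∑ Z ∈ Y.powerset.erase Y, c Z * e (Y \ Z) := by
      refine Finset.sum_congr rfl fun Z hZ => ?_
      rw [Finset.mem_erase, Finset.mem_powerset] at hZ
      rw [ih Z (hZ.2.ssubset_of_ne hZ.1) fun h => hr (hZ.2 h)]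
    rw [h2] at h1
    exact (add_right_cancel h1).symm

/-- Both sides satisfy the moment–cumulant recursion, which has a unique solution, so partitions
need not be transported along f. -/
theorem cumul_map {J : Type} [DecidableEq J] {e : Finset I → ℂ} (he : e ∅ = 1) (f : J ↪ I)
    {S : Finset J} (hS : S.Nonempty) :
    cumul e (S.map f) = cumul (fun B => e (B.map f)) S := by
  obtain ⟨r, hr⟩ := hS
  have h := eq_cumul_of_recursion (e := fun B => e (B.map f)) (by simpa using he) (r := r)
    (c := fun Z => cumul e ((insert r Z).map f)) (fun Y hrY => ?_) (S.erase r) (by simp)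
  · simpa only [Finset.insert_erase hr] using h
  · simp only [Finset.map_insert, Finset.map_sdiff]
    rw [moment_cumul_recursion he (by simpa using hrY)]
    refine Finset.sum_bij' (fun Z _ => Z.preimage f f.injective.injOn) (fun Z _ => Z.map f)
      ?_ ?_ ?_ ?_ ?_
    · intro Z hZ
      rw [Finset.mem_powerset] at hZ ⊢
      intro x hx
      simpa using hZ (Finset.mem_preimage.1 hx)
    · intro Z hZ
      rw [Finset.mem_powerset] at hZ ⊢
      exact Finset.map_subset_map.2 hZ
    · intro Z hZ
      rw [Finset.mem_powerset] at hZ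
      ext x
      simp only [Finset.mem_map, Finset.mem_preimage]
      constructor
      · rintro ⟨y, hy, rfl⟩; exact hy
      · intro hx
        obtain ⟨y, -, rfl⟩ := Finset.mem_map.1 (hZ hx)
        exact ⟨y, hx, rfl⟩
    · intro Z hZ
      ext x
      simp
    · intro Z hZ
      rw [Finset.mem_powerset] at hZ
      have : (Z.preimage f f.injective.injOn).map f = Z := by
        ext x
        simp only [Finset.mem_map, Finset.mem_preimage]
        constructor
        · rintro ⟨y, hy, rfl⟩; exact hy
        · intro hx
          obtain ⟨y, -, rfl⟩ := Finset.mem_map.1 (hZ hx)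
          exact ⟨y, hx, rfl⟩
      rw [this]

/-- The blocks of a partition exhaust S, so every partition yields the same product of ε. Thus the
vertex signs factor out of the cumulants. -/
theorem cumul_prod_mul (ε : I → ℂ) (e : Finset I → ℂ) (S : Finset I) :
    cumul (fun B => (∏ i ∈ B, ε i) * e B) S = (∏ i ∈ S, ε i) * cumul e S := by
  rw [cumul, cumul, Finset.mul_sum]
  refine Finset.sum_congr rfl fun π _ => ?_
  have : ∏ B ∈ π.parts, ∏ i ∈ B, ε i = ∏ i ∈ S, ε i := by
    conv_rhs => rw [← π.biUnion_parts]
    rw [Finset.prod_biUnion π.disjoint]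
    rfl
  rw [Finset.prod_mul_distrib, this]
  ring

end Cumulants

end

/-! ### The cumulants as cluster sums of principal minors. -/

section

open Matrix

variable {Ω : Type} [LinearOrder Ω] [Fintype Ω] {s : ℕ}

/-- The moment of the vertices in `B`. -/
def momentOn (h : Matrix Ω Ω ℂ) (β : ℝ) (P : Fin s → MultiIndex Ω) (τ : Fin s → ℝ)
    (B : Finset (Fin s)) : ℂ :=
  (∏ i ∈ B, vertexSign (P i).m) * detOn Sigma.fst B (fieldMat h β P τ)

theorem momentOn_empty (h : Matrix Ω Ω ℂ) (β : ℝ) (P : Fin s → MultiIndex Ω) (τ : Fin s → ℝ) :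
    momentOn h β P τ ∅ = 1 := by
  simp [momentOn, detOn_empty]

theorem momentOn_univ {h : Matrix Ω Ω ℂ} (hh : h.IsHermitian) (β : ℝ) (P : Fin s → MultiIndex Ω)
    (τ : Fin s → ℝ) : momentOn h β P τ Finset.univ = moment h β P τ := by
  rw [moment_eq_det hh, momentOn, detOn]
  congr 2
  ext r c
  simp [maskMat]

theorem before_comp {k : ℕ} (f : Fin k ↪o Fin s) (τ : Fin s → ℝ) (i j : Fin k) :
    before (fun k => τ (f k)) i j ↔ before τ (f i) (f j) := by
  simp [before]

/-- An increasing relabelling preserves the time order including the tie-breaking by labels, so the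
contractions agree entry by entry. -/
theorem momentOn_map (h : Matrix Ω Ω ℂ) (β : ℝ) (P : Fin s → MultiIndex Ω) (τ : Fin s → ℝ) {k : ℕ}
    (f : Fin k ↪o Fin s) (B : Finset (Fin k)) :
    momentOn h β P τ (B.map f.toEmbedding) =
      momentOn h β (fun i => P (f i)) (fun i => τ (f i)) B := by
  rw [momentOn, momentOn, Finset.prod_map]
  congr 1
  rw [detOn_eq_det_submatrix, detOn_eq_det_submatrix]
  let φ : {x : FieldIdx (fun i => P (f i)) // x.1 ∈ B} →
      {x : FieldIdx P // x.1 ∈ B.map f.toEmbedding} := fun x =>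
    ⟨⟨f x.1.1, x.1.2⟩, Finset.mem_map_of_mem _ x.2⟩
  have hφ : Function.Bijective φ := by
    constructor
    · rintro ⟨⟨i, a⟩, hi⟩ ⟨⟨j, b⟩, hj⟩ hij
      simp only [φ, Subtype.mk.injEq, Sigma.mk.injEq] at hij
      obtain ⟨h1, h2⟩ := hij
      obtain rfl := f.injective h1
      simpa using h2
    · rintro ⟨⟨i, a⟩, hi⟩
      obtain ⟨j, hj, hji⟩ := Finset.mem_map.1 hi
      have hji' : f j = i := hji
      subst hji'
      exact ⟨⟨⟨j, a⟩, hj⟩, rfl⟩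
  rw [← det_submatrix_equiv_self (Equiv.ofBijective φ hφ)]
  congr 1
  ext r c
  simp only [submatrix_apply, Equiv.ofBijective_apply, φ, fieldMat]
  congr 1
  exact propext (before_comp f τ _ _).symm

theorem moment_orderEmb {h : Matrix Ω Ω ℂ} (hh : h.IsHermitian) (β : ℝ)
    (P : Fin s → MultiIndex Ω) (τ : Fin s → ℝ) (B : Finset (Fin s)) :
    moment h β (fun k => P (B.orderEmbOfFin rfl k)) (fun k => τ (B.orderEmbOfFin rfl k)) =
      momentOn h β P τ B := by
  rw [← momentOn_univ hh, ← momentOn_map h β P τ (B.orderEmbOfFin rfl)]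
  rw [Finset.map_orderEmbOfFin_univ]

theorem cumulant_eq_cumul {h : Matrix Ω Ω ℂ} (hh : h.IsHermitian) (β : ℝ)
    (P : Fin s → MultiIndex Ω) (τ : Fin s → ℝ) :
    cumulant h β P τ = cumul (momentOn h β P τ) Finset.univ := by
  rw [cumulant, cumul]
  simp only [moment_orderEmb hh]

theorem cumul_momentOn_orderEmb {h : Matrix Ω Ω ℂ} (hh : h.IsHermitian) (β : ℝ)
    (P : Fin s → MultiIndex Ω) (τ : Fin s → ℝ) {B : Finset (Fin s)} (hB : B.Nonempty) {k : ℕ}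
    (hk : B.card = k) :
    cumul (momentOn h β P τ) B =
      cumulant h β (fun i => P (B.orderEmbOfFin hk i)) (fun i => τ (B.orderEmbOfFin hk i)) := by
  have hmap : Finset.univ.map (B.orderEmbOfFin hk).toEmbedding = B :=
    Finset.map_orderEmbOfFin_univ B hk
  have hne : (Finset.univ : Finset (Fin k)).Nonempty := by
    rw [← Finset.map_nonempty (f := (B.orderEmbOfFin hk).toEmbedding), hmap]
    exact hB
  rw [cumulant_eq_cumul hh]
  conv_lhs => rw [← hmap]
  rw [cumul_map (momentOn_empty h β P τ) _ hne]
  simp only [momentOn_map]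

theorem momentOn_orderEmb {h : Matrix Ω Ω ℂ} (hh : h.IsHermitian) (β : ℝ)
    (P : Fin s → MultiIndex Ω) (τ : Fin s → ℝ) {B : Finset (Fin s)} {k : ℕ} (hk : B.card = k) :
    momentOn h β P τ B =
      moment h β (fun i => P (B.orderEmbOfFin hk i)) (fun i => τ (B.orderEmbOfFin hk i)) := by
  subst hk
  exact (moment_orderEmb hh β P τ B).symm

/-- The cluster sums grown from the vertex 0 with all weights one solve the recursion that
characterises the cumulants of the principal minors; the signs relating these to the true moments
have modulus one. -/
theorem norm_cumulant_le_treeSum {h : Matrix Ω Ω ℂ} (hh : h.IsHermitian) {β : ℝ} {n : ℕ}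
    (P : Fin (n + 1) → MultiIndex Ω) {τ : Fin (n + 1) → ℝ} (hτ : ∀ i, τ i ∈ Set.Icc 0 β) :
    ‖cumulant h β P τ‖ ≤ treeSum (lineSum Sigma.fst (fieldMat h β P τ)) n {0}
      (Matrix.of fun _ _ => 1) (Finset.univ.erase 0) := by
  have hline : lineMat Sigma.fst (fieldMat h β P τ) (Matrix.of fun _ _ => 1) (fun _ => none) =
      fieldMat h β P τ := by
    ext r c
    simp [lineMat]
  have hclus := eq_cumul_of_recursion (e := fun B => detOn Sigma.fst B (fieldMat h β P τ))
    (detOn_empty _) (r := 0) (c := fun Y => clus Sigma.fst (fieldMat h β P τ) Y.card {0}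
      (fun _ => none) (Matrix.of fun _ _ => 1) Y) (fun Y hY => by
        have h1 := detOn_eq_sum_clus (vert := Sigma.fst) (G := fieldMat h β P τ) _ (insert 0 Y) {0}
          (fun _ => none) (Matrix.of fun _ _ => 1) (by simp) rfl (by simp) (by simp)
        have h2 : insert (0 : Fin (n + 1)) Y \ {0} = Y := by
          rw [Finset.sdiff_singleton_eq_erase, Finset.erase_insert hY]
        rw [hline, h2] at h1
        exact h1) (Finset.univ.erase 0) (by simp)
  have hcard : (Finset.univ.erase (0 : Fin (n + 1))).card = n := by simp
  rw [cumulant_eq_cumul hh]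
  have hsplit : cumul (momentOn h β P τ) Finset.univ = (∏ i, vertexSign (P i).m) *
      cumul (fun B => detOn Sigma.fst B (fieldMat h β P τ)) Finset.univ :=
    cumul_prod_mul _ _ _
  rw [Finset.insert_erase (Finset.mem_univ _), hcard] at hclus
  rw [hsplit, ← hclus, norm_mul, norm_prod, Finset.prod_congr rfl fun i _ => norm_vertexSign _,
    Finset.prod_const_one, one_mul]
  exact norm_clus_le_treeSum (fun Q hQ X ov => norm_detOn_lineMat_le_one hh P hτ hQ X ov) _ _ _
    isWeight_one _

end

/-! ### Summability of the contractions and the pointwise bound on the cumulants. -/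

section

open Matrix

theorem treeSum_mono {I : Type} [DecidableEq I] [Fintype I] {T T' : I → I → ℝ}
    (hT : ∀ i j, 0 ≤ T i j) (hTT : ∀ i j, T i j ≤ T' i j) (n : ℕ) (X Y : Finset I)
    {Q : Matrix I I ℝ} (hQ : IsWeight Q) : treeSum T n X Q Y ≤ treeSum T' n X Q Y := by
  induction n generalizing X Y Q with
  | zero => exact le_rfl
  | succ n ih =>
    rw [treeSum, treeSum]
    refine Finset.sum_le_sum fun j _ => intervalIntegral.integral_mono_on zero_le_one
      (Continuous.intervalIntegrable ?_ _ _) (Continuous.intervalIntegrable ?_ _ _) fun t ht => ?_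
    · exact continuous_finsetSum _ fun i _ =>
        continuous_const.mul (continuous_treeSum_cut _ _ _ _ _ _)
    · exact continuous_finsetSum _ fun i _ =>
        continuous_const.mul (continuous_treeSum_cut _ _ _ _ _ _)
    · refine Finset.sum_le_sum fun i _ => ?_
      exact mul_le_mul (mul_le_mul_of_nonneg_left (hTT i j) (hQ.nonneg _ _))
        (ih _ _ (hQ.cut X ht)) (treeSum_nonneg hT _ _ _ (hQ.cut X ht))
        (mul_nonneg (hQ.nonneg _ _) ((hT i j).trans (hTT i j)))

-- Grouping by the site y: a term meets y with at most M of its fields, and the terms meeting y have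
-- total weight at most L.
open Classical in
theorem sum_vertex_le {Ω ι : Type} [Fintype Ω] [Fintype ι] {wt : ι → ℝ} (hwt : ∀ a, 0 ≤ wt a)
    {m : ι → ℕ} (q : (b : ι) → Fin (m b) → Ω) {M : ℕ} (hm : ∀ b, m b ≤ M) {L : ℝ}
    (hL : ∀ y, ∑ b with y ∈ Set.range (q b), wt b ≤ L) {φ : Ω → ℝ} (hφ : ∀ y, 0 ≤ φ y) :
    ∑ b, wt b * ∑ l, φ (q b l) ≤ M * L * ∑ y, φ y := by
  have h1 : ∀ b, ∑ l, φ (q b l) ≤ ∑ y, if y ∈ Set.range (q b) then M * φ y else 0 := by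
    intro b
    rw [← Finset.sum_fiberwise Finset.univ (q b)]
    refine Finset.sum_le_sum fun y _ => ?_
    rw [Finset.sum_congr rfl (g := fun _ => φ y) fun l hl => by rw [(Finset.mem_filter.1 hl).2],
      Finset.sum_const, nsmul_eq_mul]
    split_ifs with hy
    · refine mul_le_mul_of_nonneg_right ?_ (hφ y)
      refine Nat.cast_le.2 ((Finset.card_filter_le _ _).trans ?_)
      simpa using hm b
    · rw [Finset.filter_eq_empty_iff.2 fun l _ hl => hy ⟨l, hl⟩]
      simp
  calc _ ≤ ∑ b, wt b * ∑ y, if y ∈ Set.range (q b) then M * φ y else 0 :=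
        Finset.sum_le_sum fun b _ => mul_le_mul_of_nonneg_left (h1 b) (hwt b)
    _ = ∑ y, M * φ y * ∑ b with y ∈ Set.range (q b), wt b := by
        simp only [Finset.mul_sum, Finset.sum_filter]
        rw [Finset.sum_comm]
        refine Finset.sum_congr rfl fun y _ => Finset.sum_congr rfl fun b _ => ?_
        split_ifs <;> ring
    _ ≤ ∑ y, M * φ y * L := Finset.sum_le_sum fun y _ =>
        mul_le_mul_of_nonneg_left (hL y) (mul_nonneg (Nat.cast_nonneg _) (hφ y))
    _ = M * L * ∑ y, φ y := by
        rw [Finset.mul_sum]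
        exact Finset.sum_congr rfl fun y _ => by ring

variable {Ω : Type} [LinearOrder Ω] [Fintype Ω]

theorem sum_norm_propagator_le {h : Matrix Ω Ω ℂ} (hh : h.IsHermitian) {β Lg : ℝ}
    (hG : GreenSummable h β Lg) {t : ℝ} (ht : t ∈ Set.Icc 0 β) (a : Ω) :
    ∑ b, ‖propagator h β t a b‖ ≤ Lg := by
  refine le_trans (le_of_eq ?_) (hG t ⟨by linarith [ht.1, ht.2], ht.2⟩ a)
  exact Finset.sum_congr rfl fun b _ => by rw [green_of_nonneg hh ht.1]

theorem sum_norm_propagator_le' {h : Matrix Ω Ω ℂ} (hh : h.IsHermitian) {β Lg : ℝ}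
    (hG : GreenSummable h β Lg) {t : ℝ} (ht : t ∈ Set.Icc 0 β) (b : Ω) :
    ∑ a, ‖propagator h β t a b‖ ≤ Lg := by
  refine le_trans (le_of_eq ?_) (sum_norm_propagator_le hh hG ht b)
  refine Finset.sum_congr rfl fun a _ => ?_
  rw [← (propagator_isHermitian hh β t).apply a b, norm_star]

/-- The propagators at times 0 and β add up to the identity, so one of their diagonal entries at a
has modulus at least 1/2. This lets the root vertex, which has no line of its own, be charged a full
factor λ. -/
theorem half_le_of_greenSummable {h : Matrix Ω Ω ℂ} (hh : h.IsHermitian) {β Lg : ℝ} (hβ : 0 ≤ β)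
    (hG : GreenSummable h β Lg) (a : Ω) : 1 / 2 ≤ Lg := by
  have h0 := sum_norm_propagator_le hh hG (t := 0) ⟨le_rfl, hβ⟩ a
  have h1 := sum_norm_propagator_le hh hG (t := β) ⟨hβ, le_rfl⟩ a
  have hsum : propagator h β 0 + propagator h β β = 1 := by
    rw [propagator, propagator, ← add_mul]
    have := mul_inv_one_add_expm hh β
    simpa [expm_zero] using this
  have h2 : propagator h β 0 a a + propagator h β β a a = 1 := by
    rw [← Matrix.add_apply, hsum, one_apply_eq]
  have h3 : (1 : ℝ) ≤ ‖propagator h β 0 a a‖ + ‖propagator h β β a a‖ := by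
    have := norm_add_le (propagator h β 0 a a) (propagator h β β a a)
    rwa [h2, norm_one] at this
  have h4 := Finset.single_le_sum (f := fun b => ‖propagator h β 0 a b‖)
    (fun b _ => norm_nonneg _) (Finset.mem_univ a)
  have h5 := Finset.single_le_sum (f := fun b => ‖propagator h β β a b‖)
    (fun b _ => norm_nonneg _) (Finset.mem_univ a)
  linarith

open Classical in
/-- The absolute value of the contraction of `ψ_x` at the vertex `i` with `ψ_y†` at the
vertex `j`. -/
def contr (h : Matrix Ω Ω ℂ) (β : ℝ) {s : ℕ} (τ : Fin s → ℝ) (i j : Fin s) (x y : Ω) : ℝ :=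
  ‖if before τ i j then propagator h β (τ i - τ j) x y else -propagator h β (τ i - τ j + β) x y‖

theorem contr_nonneg (h : Matrix Ω Ω ℂ) (β : ℝ) {s : ℕ} (τ : Fin s → ℝ) (i j : Fin s) (x y : Ω) :
    0 ≤ contr h β τ i j x y := norm_nonneg _

/-- In either time order the argument of the propagator lies in [0, β], so all contractions between
two given vertices are entries of a single summable propagator. -/
theorem contr_eq {β : ℝ} {s : ℕ} {τ : Fin s → ℝ} (hτ : ∀ i, τ i ∈ Set.Icc 0 β)
    (h : Matrix Ω Ω ℂ) (i j : Fin s) :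
    ∃ t ∈ Set.Icc 0 β, ∀ x y, contr h β τ i j x y = ‖propagator h β t x y‖ := by
  have hi := hτ i
  have hj := hτ j
  rw [Set.mem_Icc] at hi hj
  by_cases hb : before τ i j
  · refine ⟨τ i - τ j, ?_, fun x y => by rw [contr, if_pos hb]⟩
    have : τ j ≤ τ i := by
      rcases hb with hb | hb
      · exact hb.le
      · exact hb.1.ge
    constructor <;> linarith
  · refine ⟨τ i - τ j + β, ?_, fun x y => by rw [contr, if_neg hb, norm_neg]⟩
    have : τ i ≤ τ j := by
      by_contra hlt
      exact hb (Or.inl (not_le.1 hlt))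
    constructor <;> linarith

/-- The sum of the absolute values of all contractions between a vertex `a` at `i` and a
vertex `b` at `j`. -/
def vertexLines (h : Matrix Ω Ω ℂ) (β : ℝ) {s : ℕ} (τ : Fin s → ℝ) (i j : Fin s)
    (a b : MultiIndex Ω) : ℝ :=
  ∑ k, ∑ l, contr h β τ i j (a.minus k) (b.plus l) +
    ∑ k, ∑ l, contr h β τ j i (b.minus l) (a.plus k)

theorem lineSum_le_vertexLines (h : Matrix Ω Ω ℂ) (β : ℝ) {s : ℕ} (P : Fin s → MultiIndex Ω)
    (τ : Fin s → ℝ) (i j : Fin s) :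
    lineSum Sigma.fst (fieldMat h β P τ) i j ≤ vertexLines h β τ i j (P i) (P j) := by
  classical
  have hkey : ∀ i j : Fin s, (∑ r : FieldIdx P, ∑ c : FieldIdx P,
      if r.1 = i ∧ c.1 = j then ‖fieldMat h β P τ r c‖ else 0) =
      ∑ k, ∑ l, contr h β τ i j ((P i).minus k) ((P j).plus l) := by
    intro i j
    rw [Fintype.sum_sigma, Finset.sum_eq_single i]
    · refine Finset.sum_congr rfl fun k _ => ?_
      rw [Fintype.sum_sigma, Finset.sum_eq_single j]
      · refine Finset.sum_congr rfl fun l _ => ?_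
        rw [if_pos ⟨rfl, rfl⟩]
        rfl
      · intro j' _ hj'
        exact Finset.sum_eq_zero fun l _ => if_neg fun h => hj' h.2
      · simp
    · intro i' _ hi'
      exact Finset.sum_eq_zero fun k _ => Finset.sum_eq_zero fun c _ => if_neg fun h => hi' h.1
    · simp
  have hle : lineSum Sigma.fst (fieldMat h β P τ) i j ≤
      (∑ r : FieldIdx P, ∑ c : FieldIdx P,
        if r.1 = i ∧ c.1 = j then ‖fieldMat h β P τ r c‖ else 0) +
      ∑ r : FieldIdx P, ∑ c : FieldIdx P,
        if r.1 = j ∧ c.1 = i then ‖fieldMat h β P τ r c‖ else 0 := by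
    simp only [lineSum, ← Finset.sum_add_distrib]
    refine Finset.sum_le_sum fun r _ => Finset.sum_le_sum fun c _ => ?_
    have := norm_nonneg (fieldMat h β P τ r c)
    split_ifs with h1 h2 h3 h4 h5 h6 <;> first | linarith | (exfalso; tauto)
  refine hle.trans (le_of_eq ?_)
  rw [hkey, hkey, vertexLines]
  congr 1
  exact Finset.sum_comm

/-- Each orientation of the line contributes M choices of the field at a, a factor M L_V / 2 for the
new vertex and L_g for the propagator. One orientation uses row sums and P⁺, the other column sums
and P⁻; together they give M² L_g L_V. -/
theorem sum_vertexLines_le {ι : Type} [Fintype ι] {h : Matrix Ω Ω ℂ} (hh : h.IsHermitian)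
    {v : ι → ℂ} {P : ι → MultiIndex Ω} {β Lg LV : ℝ} {M : ℕ} (hM : ∀ i, (P i).m ≤ M)
    (hG : GreenSummable h β Lg) (hV : PotentialSummable v P LV) (hLg : 0 ≤ Lg) (hLV : 0 ≤ LV)
    {s : ℕ} {τ : Fin s → ℝ} (hτ : ∀ i, τ i ∈ Set.Icc 0 β) (i j : Fin s) (a : ι) :
    ∑ b, ‖v b‖ * vertexLines h β τ i j (P a) (P b) ≤ M ^ 2 * Lg * LV := by
  have hbound : ∀ c : ℝ, 0 ≤ c → ((P a).m : ℝ) * c ≤ M * c := fun c hc =>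
    mul_le_mul_of_nonneg_right (Nat.cast_le.2 (hM a)) hc
  have h1 : ∑ b, ‖v b‖ * ∑ k, ∑ l, contr h β τ i j ((P a).minus k) ((P b).plus l) ≤
      M * (M * (LV / 2) * Lg) := by
    obtain ⟨t, ht, htc⟩ := contr_eq hτ h i j
    calc _ = ∑ k, ∑ b, ‖v b‖ * ∑ l, contr h β τ i j ((P a).minus k) ((P b).plus l) :=
          (Finset.sum_congr rfl fun b _ => Finset.mul_sum _ _ _).trans Finset.sum_comm
      _ ≤ ∑ _k : Fin (P a).m, M * (LV / 2) * Lg := by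
          refine Finset.sum_le_sum fun k _ => ?_
          refine (sum_vertex_le (fun b => norm_nonneg (v b)) (fun b => (P b).plus) hM
            (fun y => by convert hV.2 y)
            (φ := contr h β τ i j ((P a).minus k)) (contr_nonneg h β τ i j _)).trans ?_
          refine mul_le_mul_of_nonneg_left ?_ (by positivity)
          simp only [htc]
          exact sum_norm_propagator_le hh hG ht _
      _ ≤ _ := by
          rw [Finset.sum_const, nsmul_eq_mul, Finset.card_univ, Fintype.card_fin]
          exact hbound _ (by positivity)
  have h2 : ∑ b, ‖v b‖ * ∑ k, ∑ l, contr h β τ j i ((P b).minus l) ((P a).plus k) ≤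
      M * (M * (LV / 2) * Lg) := by
    obtain ⟨t, ht, htc⟩ := contr_eq hτ h j i
    calc _ = ∑ k, ∑ b, ‖v b‖ * ∑ l, contr h β τ j i ((P b).minus l) ((P a).plus k) :=
          (Finset.sum_congr rfl fun b _ => Finset.mul_sum _ _ _).trans Finset.sum_comm
      _ ≤ ∑ _k : Fin (P a).m, M * (LV / 2) * Lg := by
          refine Finset.sum_le_sum fun k _ => ?_
          refine (sum_vertex_le (fun b => norm_nonneg (v b)) (fun b => (P b).minus) hM
            (fun y => by convert hV.1 y)
            (φ := fun x => contr h β τ j i x ((P a).plus k))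
            (fun x => contr_nonneg h β τ j i _ _)).trans ?_
          refine mul_le_mul_of_nonneg_left ?_ (by positivity)
          simp only [htc]
          exact sum_norm_propagator_le' hh hG ht _
      _ ≤ _ := by
          rw [Finset.sum_const, nsmul_eq_mul, Finset.card_univ, Fintype.card_fin]
          exact hbound _ (by positivity)
  simp only [vertexLines, mul_add, Finset.sum_add_distrib]
  nlinarith

/-- Since m ≥ 1, every term annihilates at some site and is counted there. This is the only source
of the volume factor N. -/
theorem sum_norm_le {ι : Type} [Fintype ι] {v : ι → ℂ} {P : ι → MultiIndex Ω} {LV : ℝ}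
    (hV : PotentialSummable v P LV) : ∑ a, ‖v a‖ ≤ Fintype.card Ω * (LV / 2) := by
  classical
  calc ∑ a, ‖v a‖ ≤ ∑ a, ∑ x : Ω, if x ∈ Set.range (P a).minus then ‖v a‖ else 0 := by
        refine Finset.sum_le_sum fun a _ => ?_
        let x := (P a).minus ⟨0, (P a).one_le_m⟩
        refine le_trans (le_of_eq ?_) (Finset.single_le_sum (fun y _ => ?_) (Finset.mem_univ x))
        · rw [if_pos ⟨_, rfl⟩]
        · split_ifs
          · exact norm_nonneg _
          · exact le_rfl
    _ = ∑ x : Ω, ∑ a with x ∈ Set.range (P a).minus, ‖v a‖ := by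
        rw [Finset.sum_comm]
        simp only [Finset.sum_filter]
    _ ≤ ∑ _x : Ω, LV / 2 := Finset.sum_le_sum fun x _ => by convert hV.1 x
    _ = _ := by simp

/-- The pointwise bound on the sum of the cumulants over all labels. -/
theorem sum_norm_cumulant_le {ι : Type} [Fintype ι] {h : Matrix Ω Ω ℂ} (hh : h.IsHermitian)
    {v : ι → ℂ} {P : ι → MultiIndex Ω} {β Lg LV : ℝ} {M : ℕ} (hβ : 0 ≤ β)
    (hM : ∀ i, (P i).m ≤ M) (hG : GreenSummable h β Lg) (hV : PotentialSummable v P LV) {n : ℕ}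
    {τ : Fin (n + 1) → ℝ} (hτ : ∀ i, τ i ∈ Set.Icc 0 β) :
    ∑ p : Fin (n + 1) → ι, ‖∏ k, v (p k)‖ * ‖cumulant h β (fun k => P (p k)) τ‖ ≤
      Fintype.card Ω * ((n + 1).factorial * (Real.exp 1 * (M ^ 2 * Lg * LV)) ^ (n + 1)) := by
  classical
  rcases isEmpty_or_nonempty Ω with hΩ | ⟨⟨x⟩⟩
  · have : IsEmpty ι := ⟨fun i => hΩ.false ((P i).minus ⟨0, (P i).one_le_m⟩)⟩
    simp
  have hLg : 1 / 2 ≤ Lg := half_le_of_greenSummable hh hβ hG x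
  have hLV : 0 ≤ LV := by
    have := (Finset.sum_nonneg fun i _ => norm_nonneg (v i)).trans (hV.1 x)
    linarith
  rcases isEmpty_or_nonempty ι with hι | ⟨⟨a₀⟩⟩
  · rw [Finset.univ_eq_empty, Finset.sum_empty]
    positivity
  have hM1 : (1 : ℝ) ≤ M := by exact_mod_cast (P a₀).one_le_m.trans (hM a₀)
  set lam : ℝ := M ^ 2 * Lg * LV with hlam
  have hlam0 : 0 ≤ lam := by positivity
  have hLVlam : LV / 2 ≤ lam := by
    have h1 : (1 : ℝ) ≤ (M : ℝ) ^ 2 := one_le_pow₀ hM1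
    have h2 : 1 / 2 ≤ (M : ℝ) ^ 2 * Lg := by nlinarith
    have := mul_le_mul_of_nonneg_right h2 hLV
    linarith
  let w : Fin (n + 1) → Fin (n + 1) → ι → ι → ℝ := fun i j a b =>
    vertexLines h β τ i j (P a) (P b)
  have hw : ∀ i j a b, 0 ≤ w i j a b := fun i j a b =>
    add_nonneg (Finset.sum_nonneg fun _ _ => Finset.sum_nonneg fun _ _ => contr_nonneg _ _ _ _ _ _ _)
      (Finset.sum_nonneg fun _ _ => Finset.sum_nonneg fun _ _ => contr_nonneg _ _ _ _ _ _ _)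
  let Y : Finset (Fin (n + 1)) := Finset.univ.erase 0
  let J : Matrix (Fin (n + 1)) (Fin (n + 1)) ℝ := Matrix.of fun _ _ => 1
  calc _ ≤ ∑ p : Fin (n + 1) → ι, (∏ y, ‖v (p y)‖) *
        treeSum (fun i j => w i j (p i) (p j)) n {0} J Y := by
        refine Finset.sum_le_sum fun p _ => ?_
        rw [norm_prod]
        refine mul_le_mul_of_nonneg_left ?_ (Finset.prod_nonneg fun _ _ => norm_nonneg _)
        refine (norm_cumulant_le_treeSum hh _ hτ).trans ?_
        exact treeSum_mono (lineSum_nonneg _ _)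
          (lineSum_le_vertexLines h β (fun k => P (p k)) τ) _ _ _ isWeight_one
    _ = ∑ a, ‖v a‖ * ∑ p ∈ agree Y (Function.update (fun _ => a₀) 0 a),
        (∏ y ∈ Y, ‖v (p y)‖) * treeSum (fun i j => w i j (p i) (p j)) n {0} J Y := by
        have huniv : (Finset.univ : Finset (Fin (n + 1) → ι)) =
            agree Finset.univ (fun _ => a₀) := by ext p; simp [mem_agree]
        rw [huniv, sum_agree_eq (Finset.mem_univ 0)]
        refine Finset.sum_congr rfl fun a _ => ?_
        rw [Finset.mul_sum]
        refine Finset.sum_congr rfl fun p hp => ?_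
        have hp0 : p 0 = a := by
          simpa using mem_agree.1 hp 0 (Finset.notMem_erase _ _)
        rw [← Finset.mul_prod_erase _ _ (Finset.mem_univ 0), hp0, mul_assoc]
    -- The initial cluster is the single vertex 0 with all weights one, so σ = 1 and the last
    -- exponential is e^σ = e.
    _ ≤ ∑ a, ‖v a‖ * (n.factorial * Real.exp 1 ^ n * Real.exp 1 * lam ^ n) := by
        refine Finset.sum_le_sum fun a _ => mul_le_mul_of_nonneg_left ?_ (norm_nonneg _)
        refine sum_agree_treeSum_le (wt := fun a => ‖v a‖) (fun a => norm_nonneg _) hw hlam0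
          (fun i j a _ => sum_vertexLines_le hh hM hG hV (by linarith) hLV hτ i j a) n
          (by simp [Y]) (by simp [Y]) isWeight_one zero_le_one (by simp) _
    _ = (∑ a, ‖v a‖) * (n.factorial * Real.exp 1 ^ n * Real.exp 1 * lam ^ n) := by
        rw [Finset.sum_mul]
    _ ≤ (Fintype.card Ω * (LV / 2)) * (n.factorial * Real.exp 1 ^ n * Real.exp 1 * lam ^ n) :=
        mul_le_mul_of_nonneg_right (sum_norm_le hV) (by positivity)
    _ ≤ (Fintype.card Ω * lam) * ((n + 1).factorial * Real.exp 1 ^ n * Real.exp 1 * lam ^ n) := by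
        gcongr
        exact Nat.le_succ n
    _ = _ := by ring

end

/-! ### Measurability, integrability and the bound on each order. -/

section

open Matrix MeasureTheory

variable {Ω : Type} [LinearOrder Ω] [Fintype Ω] {s : ℕ}

theorem continuous_propagator_apply (h : Matrix Ω Ω ℂ) (β : ℝ) (a b : Ω) :
    Continuous fun t : ℝ => propagator h β t a b := by
  have h1 : Continuous fun t : ℝ => expm h (-(t : ℂ)) :=
    (continuous_expm h).comp (by fun_prop)
  exact (h1.matrix_mul continuous_const).matrix_elem a b

theorem measurableSet_before (i j : Fin s) : MeasurableSet {τ : Fin s → ℝ | before τ i j} := by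
  by_cases hij : i < j
  · have : {τ : Fin s → ℝ | before τ i j} = {τ | τ j < τ i} ∪ {τ | τ i = τ j} := by
      ext τ; simp [before, hij]
    rw [this]
    exact (measurableSet_lt (measurable_pi_apply j) (measurable_pi_apply i)).union
      (measurableSet_eq_fun (measurable_pi_apply i) (measurable_pi_apply j))
  · have : {τ : Fin s → ℝ | before τ i j} = {τ | τ j < τ i} := by
      ext τ; simp [before, hij]
    rw [this]
    exact measurableSet_lt (measurable_pi_apply j) (measurable_pi_apply i)

theorem measurable_fieldMat (h : Matrix Ω Ω ℂ) (β : ℝ) (P : Fin s → MultiIndex Ω)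
    (r c : FieldIdx P) : Measurable fun τ => fieldMat h β P τ r c := by
  classical
  have hc := continuous_propagator_apply h β ((P r.1).minus r.2) ((P c.1).plus c.2)
  refine Measurable.ite (measurableSet_before r.1 c.1) ?_ ?_
  · exact (hc.comp (by fun_prop : Continuous fun τ : Fin s → ℝ => τ r.1 - τ c.1)).measurable
  · exact (hc.comp
      (by fun_prop : Continuous fun τ : Fin s → ℝ => τ r.1 - τ c.1 + β)).measurable.neg

theorem measurable_momentOn (h : Matrix Ω Ω ℂ) (β : ℝ) (P : Fin s → MultiIndex Ω)
    (B : Finset (Fin s)) : Measurable fun τ => momentOn h β P τ B := by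
  simp only [momentOn, detOn, det_apply']
  refine measurable_const.mul (Finset.measurable_fun_sum _ fun σ _ => measurable_const.mul
    (Finset.measurable_fun_prod _ fun i _ => ?_))
  simp only [maskMat]
  split_ifs
  · exact measurable_fieldMat h β P _ _
  all_goals exact measurable_const

theorem norm_momentOn_le_one {h : Matrix Ω Ω ℂ} (hh : h.IsHermitian) {β : ℝ}
    (P : Fin s → MultiIndex Ω) {τ : Fin s → ℝ} (hτ : τ ∈ timeBox β s) (B : Finset (Fin s)) :
    ‖momentOn h β P τ B‖ ≤ 1 := by
  have hline : lineMat Sigma.fst (fieldMat h β P τ) (Matrix.of fun _ _ => 1) (fun _ => none) =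
      fieldMat h β P τ := by
    ext r c
    simp [lineMat]
  have := norm_detOn_lineMat_le_one hh P (fun i => ⟨hτ.1 i, hτ.2 i⟩) isWeight_one B (fun _ => none)
  rw [hline] at this
  rwa [momentOn, norm_mul, norm_prod, Finset.prod_congr rfl fun i _ => norm_vertexSign _,
    Finset.prod_const_one, one_mul]

theorem measurableSet_timeBox (β : ℝ) (s : ℕ) : MeasurableSet (timeBox β s) := measurableSet_Icc

theorem volume_timeBox_lt_top (β : ℝ) (s : ℕ) : volume (timeBox β s) < ⊤ :=
  (isCompact_Icc : IsCompact (timeBox β s)).measure_lt_top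

theorem integrableOn_timeBox_of_bounded {β : ℝ} {f : (Fin s → ℝ) → ℂ} (hf : Measurable f) {C : ℝ}
    (hC : ∀ τ ∈ timeBox β s, ‖f τ‖ ≤ C) : IntegrableOn f (timeBox β s) :=
  Measure.integrableOn_of_bounded (M := C) (volume_timeBox_lt_top β s).ne hf.aestronglyMeasurable
    ((ae_restrict_iff' (measurableSet_timeBox β s)).2 (Filter.Eventually.of_forall hC))

theorem integrableOn_moment {h : Matrix Ω Ω ℂ} (hh : h.IsHermitian) (β : ℝ)
    (P : Fin s → MultiIndex Ω) : IntegrableOn (fun τ => moment h β P τ) (timeBox β s) := by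
  simp only [← momentOn_univ hh]
  exact integrableOn_timeBox_of_bounded (measurable_momentOn h β P _)
    fun τ hτ => norm_momentOn_le_one hh P hτ _

theorem integrableOn_cumul_momentOn {h : Matrix Ω Ω ℂ} (hh : h.IsHermitian) (β : ℝ)
    (P : Fin s → MultiIndex Ω) (X : Finset (Fin s)) :
    IntegrableOn (fun τ => cumul (momentOn h β P τ) X) (timeBox β s) := by
  refine integrable_finsetSum _ fun π _ => Integrable.const_mul ?_ _
  refine integrableOn_timeBox_of_bounded (C := 1)
    (Finset.measurable_fun_prod _ fun B _ => measurable_momentOn h β P B) fun τ hτ => ?_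
  rw [norm_prod]
  exact Finset.prod_le_one (fun _ _ => norm_nonneg _) fun B _ => norm_momentOn_le_one hh P hτ B

theorem integrableOn_cumulant {h : Matrix Ω Ω ℂ} (hh : h.IsHermitian) (β : ℝ)
    (P : Fin s → MultiIndex Ω) : IntegrableOn (fun τ => cumulant h β P τ) (timeBox β s) := by
  simp only [cumulant_eq_cumul hh]
  exact integrableOn_cumul_momentOn hh β P _

theorem volume_real_timeBox {β : ℝ} (hβ : 0 ≤ β) (s : ℕ) :
    volume.real (timeBox β s) = β ^ s := by
  rw [Measure.real, timeBox, Real.volume_Icc_pi_toReal fun _ => hβ]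
  simp

theorem absCumulantTerm_le {ι : Type} [Fintype ι] {h : Matrix Ω Ω ℂ} (hh : h.IsHermitian)
    {v : ι → ℂ} {P : ι → MultiIndex Ω} {β Lg LV : ℝ} {M : ℕ} (hβ : 0 ≤ β)
    (hM : ∀ i, (P i).m ≤ M) (hG : GreenSummable h β Lg) (hV : PotentialSummable v P LV) (n : ℕ) :
    absCumulantTerm h v P β (n + 1) ≤
      Fintype.card Ω * (Real.exp 1 * β * M ^ 2 * Lg * LV) ^ (n + 1) := by
  set K : ℝ := Fintype.card Ω * ((n + 1).factorial * (Real.exp 1 * (M ^ 2 * Lg * LV)) ^ (n + 1))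
  have hint : ∀ p : Fin (n + 1) → ι, IntegrableOn (fun τ => ‖∏ k, v (p k)‖ *
      ‖cumulant h β (fun k => P (p k)) τ‖) (timeBox β (n + 1)) := fun p =>
    (integrableOn_cumulant hh β _).norm.const_mul _
  have h1 : ∑ p : Fin (n + 1) → ι, ‖∏ k, v (p k)‖ *
      ∫ τ in timeBox β (n + 1), ‖cumulant h β (fun k => P (p k)) τ‖ ≤ K * β ^ (n + 1) := by
    calc _ = ∫ τ in timeBox β (n + 1), ∑ p : Fin (n + 1) → ι, ‖∏ k, v (p k)‖ *
          ‖cumulant h β (fun k => P (p k)) τ‖ := by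
          rw [integral_finsetSum _ fun p _ => hint p]
          exact Finset.sum_congr rfl fun p _ => (integral_const_mul _ _).symm
      _ ≤ ∫ _τ in timeBox β (n + 1), K := by
          refine setIntegral_mono_on (integrable_finsetSum _ fun p _ => hint p)
            (integrableOn_const (volume_timeBox_lt_top _ _).ne) (measurableSet_timeBox _ _)
            fun τ hτ => ?_
          exact sum_norm_cumulant_le hh hβ hM hG hV fun i => ⟨hτ.1 i, hτ.2 i⟩
      _ = K * β ^ (n + 1) := by
          rw [setIntegral_const, volume_real_timeBox hβ, smul_eq_mul, mul_comm]
  rw [absCumulantTerm]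
  refine (mul_le_mul_of_nonneg_left h1 (by positivity)).trans (le_of_eq ?_)
  have : ((n + 1).factorial : ℝ) ≠ 0 := Nat.cast_ne_zero.2 (Nat.factorial_ne_zero _)
  simp only [K]
  field_simp
  rw [mul_assoc, ← mul_pow]

end

/-! ### Integrals of time-ordered products over boxes as iterated integrals. -/

section

open Matrix MeasureTheory
open scoped Matrix.Norms.L2Operator

section SortRecursion

variable {n : ℕ}

/-- Prepending i to the sorting permutation of the other times gives a monotone order that breaks
ties by labels, and the sorting permutation is the only such one. -/
theorem sort_of_timeRank_eq_zero {τ : Fin (n + 1) → ℝ} {i : Fin (n + 1)} (hi : timeRank τ i = 0) :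
    (Tuple.sort fun k => -τ k) 0 = i ∧ ∀ k : Fin n, (Tuple.sort fun k => -τ k) k.succ =
      i.succAbove ((Tuple.sort fun k => -τ (i.succAbove k)) k) := by
  set σ' := Tuple.sort fun k => -τ (i.succAbove k) with hσ'
  have hrank : ∀ j, timeRank τ i ≤ timeRank τ j := fun j => by rw [hi]; exact Fin.zero_le _
  let g : Fin (n + 1) → Fin (n + 1) := Fin.cons i fun k => i.succAbove (σ' k)
  have hg0 : g 0 = i := rfl
  have hgs : ∀ k : Fin n, g k.succ = i.succAbove (σ' k) := fun k => rfl
  have hinj : Function.Injective g := by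
    rw [Fin.cons_injective_iff]
    refine ⟨?_, Fin.succAbove_right_injective.comp σ'.injective⟩
    rintro ⟨k, hk⟩
    exact Fin.succAbove_ne i _ hk
  let σ : Equiv.Perm (Fin (n + 1)) :=
    Equiv.ofBijective g (Finite.injective_iff_bijective.1 hinj)
  have hσ : σ = Tuple.sort fun k => -τ k := by
    obtain ⟨h1, h2⟩ := Tuple.eq_sort_iff.1 hσ'
    rw [Tuple.eq_sort_iff]
    constructor
    · intro a b hab
      simp only [Function.comp_apply, σ, Equiv.ofBijective_apply, neg_le_neg_iff]
      induction a using Fin.cases with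
      | zero => exact le_of_timeRank_le (hrank _)
      | succ a =>
        induction b using Fin.cases with
        | zero => exact absurd hab (by simp)
        | succ b => simpa [hgs] using h1 (Fin.succ_le_succ_iff.1 hab)
    · intro a b hab hval
      simp only [σ, Equiv.ofBijective_apply] at hval ⊢
      induction b using Fin.cases with
      | zero => exact (Fin.not_lt_zero a hab).elim
      | succ b =>
        induction a using Fin.cases with
        | zero =>
          have hne : timeRank τ (g b.succ) ≠ 0 := by
            rw [← hi, timeRank, timeRank, Ne, EmbeddingLike.apply_eq_iff_eq]
            exact Fin.succAbove_ne i _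
          have hb : before τ i (g b.succ) := by
            rw [before_iff_timeRank_lt, hi]
            exact Fin.pos_iff_ne_zero.2 hne
          rcases hb with hb | hb
          · rw [hg0] at hval; linarith
          · exact hb.2
        | succ a =>
          rw [hgs, hgs] at hval ⊢
          exact Fin.succAbove_lt_succAbove_iff.2 (h2 a b (Fin.succ_lt_succ_iff.1 hab) hval)
  rw [← hσ]
  exact ⟨rfl, fun k => rfl⟩

theorem timeRank_eq_zero_iff {τ : Fin (n + 1) → ℝ} {i : Fin (n + 1)} :
    timeRank τ i = 0 ↔ ∀ k : Fin n, before τ i (i.succAbove k) := by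
  constructor
  · intro h k
    rw [before_iff_timeRank_lt, h, Fin.pos_iff_ne_zero, ← h, timeRank, timeRank, Ne,
      EmbeddingLike.apply_eq_iff_eq]
    exact Fin.succAbove_ne i k
  · intro h
    by_contra h0
    set j := (Tuple.sort fun i => -τ i) 0 with hj
    have hj0 : timeRank τ j = 0 := by rw [timeRank, hj, Equiv.symm_apply_apply]
    have hji : j ≠ i := by rintro hji; rw [hji] at hj0; exact h0 hj0
    obtain ⟨k, hk⟩ := Fin.exists_succAbove_eq hji
    have := h k
    rw [hk, before_iff_timeRank_lt, hj0] at this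
    exact Fin.not_lt_zero _ this

end SortRecursion

section TimeOrderedProduct

variable {A : Type} [Monoid A]

/-- The time-ordered product of the values of `f`. -/
def timeProd (f : ℝ → A) {n : ℕ} (τ : Fin n → ℝ) : A :=
  (List.ofFn fun k => f (τ ((Tuple.sort fun i => -τ i) k))).prod

theorem timeProd_succ (f : ℝ → A) {n : ℕ} {τ : Fin (n + 1) → ℝ} {i : Fin (n + 1)}
    (hi : timeRank τ i = 0) :
    timeProd f τ = f (τ i) * timeProd f fun k => τ (i.succAbove k) := by
  obtain ⟨h0, hs⟩ := sort_of_timeRank_eq_zero hi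
  rw [timeProd, List.ofFn_succ, List.prod_cons, h0]
  simp only [hs]
  rfl

end TimeOrderedProduct

section BoxIntegral

variable {A : Type} [NormedRing A]

theorem measurableSet_sort_eq {n : ℕ} (σ : Equiv.Perm (Fin n)) :
    MeasurableSet {τ : Fin n → ℝ | (Tuple.sort fun i => -τ i) = σ} := by
  have : {τ : Fin n → ℝ | (Tuple.sort fun i => -τ i) = σ} =
      ⋂ i, ⋂ j, {τ | i < j → before τ (σ i) (σ j)} := by
    ext τ
    simp only [Set.mem_ofPred_eq, Set.mem_iInter]
    constructor
    · rintro rfl i j hij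
      rw [before_iff_timeRank_lt]
      simpa [timeRank] using hij
    · intro h
      refine (Tuple.eq_sort_iff.2 ⟨fun i j hij => ?_, fun i j hij he => ?_⟩).symm
      · rcases hij.lt_or_eq with hij | rfl
        · rcases h i j hij with h | h
          · simpa using h.le
          · simpa using h.1.ge
        · exact le_rfl
      · rcases h i j hij with h | h
        · exact absurd (neg_injective he) h.ne'
        · exact h.2
  rw [this]
  refine MeasurableSet.iInter fun i => MeasurableSet.iInter fun j => ?_
  by_cases hij : i < j
  · simpa [hij] using measurableSet_before (σ i) (σ j)
  · simp [hij]

/-- On each of the finitely many regions with a fixed sorting permutation the factors stand in a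
fixed order, so for continuous f measurability and integrability can be checked region by region. -/
theorem timeProd_eq_sum (f : ℝ → A) {n : ℕ} (τ : Fin n → ℝ) :
    timeProd f τ = ∑ σ : Equiv.Perm (Fin n), Set.indicator {τ | (Tuple.sort fun i => -τ i) = σ}
      (fun τ => (List.ofFn fun k => f (τ (σ k))).prod) τ := by
  rw [Finset.sum_eq_single (Tuple.sort fun i => -τ i)]
  · rw [Set.indicator_of_mem (by simp)]; rfl
  · intro σ _ hσ
    exact Set.indicator_of_notMem (fun h => hσ h.symm) _
  · simp

theorem continuous_list_ofFn_prod {X : Type} [TopologicalSpace X] {n : ℕ} {g : Fin n → X → A}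
    (hg : ∀ k, Continuous (g k)) : Continuous fun x => (List.ofFn fun k => g k x).prod := by
  have := continuous_list_prod (List.ofFn fun k : Fin n => k) (f := g) fun k _ => hg k
  simpa [List.map_ofFn, Function.comp_def] using this

theorem integrableOn_timeProd {f : ℝ → A} (hf : Continuous f) (n : ℕ) (β : ℝ) :
    IntegrableOn (fun τ : Fin n → ℝ => timeProd f τ) (timeBox β n) := by
  simp only [timeProd_eq_sum]
  refine integrable_finsetSum _ fun σ _ => Integrable.indicator ?_ (measurableSet_sort_eq σ)
  exact (continuous_list_ofFn_prod fun k =>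
    hf.comp (continuous_apply (σ k))).continuousOn.integrableOn_compact isCompact_Icc

variable [NormedAlgebra ℝ A] {f : ℝ → A}

/-- The integral of the time-ordered product over a box. -/
def boxIntegral (f : ℝ → A) (n : ℕ) (T : ℝ) : A := ∫ τ in timeBox T n, timeProd f τ

/-- The iterated integrals of the Dyson series. -/
def dysonIntegral (f : ℝ → A) : ℕ → ℝ → A
  | 0, _ => 1
  | n + 1, T => ∫ t in (0 : ℝ)..T, f t * dysonIntegral f n t

theorem continuous_dysonIntegral (hf : Continuous f) (n : ℕ) : Continuous (dysonIntegral f n) := by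
  induction n with
  | zero => exact continuous_const
  | succ n ih =>
    exact intervalIntegral.continuous_primitive
      (fun a b => (hf.mul ih).intervalIntegrable a b) 0

/-- By Fubini with the latest time t = τ_i as outer variable: the corresponding factor is leftmost,
and the other times fill the box [0, t]^n up to a null set. -/
theorem setIntegral_timeProd_first [CompleteSpace A] (hf : Continuous f) (n : ℕ) {T : ℝ} (hT : 0 ≤ T)
    (i : Fin (n + 1)) :
    ∫ τ in timeBox T (n + 1), Set.indicator {τ | timeRank τ i = 0} (fun τ => timeProd f τ) τ =
      ∫ t in (0 : ℝ)..T, f t * boxIntegral f n t := by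
  have hA : MeasurableSet {τ : Fin (n + 1) → ℝ | timeRank τ i = 0} := by
    simp only [timeRank_eq_zero_iff, Set.ofPred_forall]
    exact MeasurableSet.iInter fun k => measurableSet_before _ _
  let φ := MeasurableEquiv.piFinSuccAbove (fun _ : Fin (n + 1) => ℝ) i
  have hφ : MeasurePreserving φ volume volume := volume_preserving_piFinSuccAbove (fun _ => ℝ) i
  let S : Set (ℝ × (Fin n → ℝ)) := φ.symm ⁻¹' (timeBox T (n + 1) ∩ {τ | timeRank τ i = 0})
  have hS : MeasurableSet S :=
    φ.symm.measurable ((measurableSet_timeBox _ _).inter hA)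
  -- A tie with the latest time t is allowed exactly for labels larger than i, hence closed
  -- intervals for these and half-open ones otherwise.
  let J : ℝ → Fin n → Set ℝ := fun t k =>
    if i < i.succAbove k then Set.Icc 0 t else Set.Ico 0 t
  have hmemS : ∀ t τ', (t, τ') ∈ S ↔ t ∈ Set.Icc 0 T ∧ ∀ k, τ' k ∈ J t k := by
    intro t τ'
    have hsymm : φ.symm (t, τ') = i.insertNth t τ' := rfl
    simp only [S, Set.mem_preimage, hsymm, Set.mem_inter_iff, timeBox, Set.mem_Icc, Pi.le_def,
      Set.mem_ofPred_eq, timeRank_eq_zero_iff, before, Fin.insertNth_apply_same,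
      Fin.insertNth_apply_succAbove, Fin.forall_iff_succAbove i, J]
    constructor
    · rintro ⟨⟨⟨h1, h2⟩, h3, h4⟩, h5⟩
      refine ⟨⟨h1, h3⟩, fun k => ?_⟩
      split_ifs with hk
      · refine ⟨h2 k, ?_⟩
        rcases h5 k with h | h
        · exact h.le
        · exact h.1.ge
      · refine ⟨h2 k, ?_⟩
        rcases h5 k with h | h
        · exact h
        · exact (hk h.2).elim
    · rintro ⟨⟨h1, h3⟩, h⟩
      have hk : ∀ k, 0 ≤ τ' k ∧ τ' k ≤ t := by
        intro k
        have := h k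
        split_ifs at this
        · exact this
        · exact ⟨this.1, this.2.le⟩
      refine ⟨⟨⟨h1, fun k => (hk k).1⟩, h3, fun k => (hk k).2.trans h3⟩, fun k => ?_⟩
      have := h k
      split_ifs at this with hik
      · rcases this.2.lt_or_eq with hlt | heq
        · exact Or.inl hlt
        · exact Or.inr ⟨heq.symm, hik⟩
      · exact Or.inl this.2
  let g : ℝ × (Fin n → ℝ) → A := fun x => f x.1 * timeProd f x.2
  have hval : ∀ x ∈ S, timeProd f (φ.symm x) = g x := by
    rintro ⟨t, τ'⟩ hx
    have h0 : timeRank (φ.symm (t, τ')) i = 0 := hx.2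
    rw [timeProd_succ f h0]
    have hsymm : φ.symm (t, τ') = i.insertNth t τ' := rfl
    simp [hsymm, g]
  have hint0 : IntegrableOn (fun τ : Fin (n + 1) → ℝ => timeProd f τ)
      (timeBox T (n + 1) ∩ {τ | timeRank τ i = 0}) :=
    (integrableOn_timeProd hf (n + 1) T).mono_set Set.inter_subset_left
  have hpre : φ ⁻¹' S = timeBox T (n + 1) ∩ {τ | timeRank τ i = 0} := by
    ext τ
    simp [S]
  have hint : IntegrableOn g S := by
    rw [← hφ.integrableOn_comp_preimage φ.measurableEmbedding, hpre]
    refine hint0.congr_fun (fun τ hτ => ?_) ((measurableSet_timeBox _ _).inter hA)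
    rw [Function.comp_apply, ← hval _ (by rw [← hpre] at hτ; exact hτ), φ.symm_apply_apply]
  calc _ = ∫ τ in timeBox T (n + 1) ∩ {τ | timeRank τ i = 0}, timeProd f τ := by
        rw [setIntegral_indicator hA]
    _ = ∫ τ in φ ⁻¹' S, g (φ τ) := by
        rw [hpre]
        refine setIntegral_congr_fun ((measurableSet_timeBox _ _).inter hA) fun τ hτ => ?_
        rw [← hval _ (by rw [← hpre] at hτ; exact hτ), φ.symm_apply_apply]
    _ = ∫ x in S, g x := hφ.setIntegral_preimage_emb φ.measurableEmbedding _ _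
    _ = ∫ x, S.indicator g x := (integral_indicator hS).symm
    _ = ∫ t, ∫ τ', S.indicator g (t, τ') := by
        rw [Measure.volume_eq_prod]
        exact integral_prod _ ((integrable_indicator_iff hS).2 hint)
    _ = ∫ t, (Set.Icc 0 T).indicator (fun t => f t * boxIntegral f n t) t := by
        congr 1
        ext t
        by_cases ht : t ∈ Set.Icc 0 T
        · rw [Set.indicator_of_mem ht]
          have h1 : ∀ τ', S.indicator g (t, τ') =
              (Set.univ.pi (J t)).indicator (fun τ' => f t * timeProd f τ') τ' := by
            intro τ'
            by_cases hx : (t, τ') ∈ S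
            · rw [Set.indicator_of_mem hx, Set.indicator_of_mem]
              simpa using ((hmemS _ _).1 hx).2
            · rw [Set.indicator_of_notMem hx, Set.indicator_of_notMem]
              intro h
              exact hx ((hmemS _ _).2 ⟨ht, by simpa using h⟩)
          have hJ : ∀ k, MeasurableSet (J t k) := by
            intro k
            simp only [J]
            split_ifs
            · exact measurableSet_Icc
            · exact measurableSet_Ico
          have hae : Set.univ.pi (J t) =ᵐ[volume] timeBox t n := by
            rw [timeBox, ← Set.pi_univ_Icc]
            refine Measure.ae_eq_set_pi fun k _ => ?_
            simp only [J]
            split_ifs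
            · rfl
            · exact Ico_ae_eq_Icc
          simp only [h1]
          rw [integral_indicator (MeasurableSet.univ_pi hJ), setIntegral_congr_set hae,
            boxIntegral]
          exact integral_const_mul_of_integrable (integrableOn_timeProd hf n t)
        · rw [Set.indicator_of_notMem ht]
          have : ∀ τ', S.indicator g (t, τ') = 0 := fun τ' =>
            Set.indicator_of_notMem (fun h => ht ((hmemS _ _).1 h).1) _
          simp [this]
    _ = ∫ t in Set.Icc 0 T, f t * boxIntegral f n t := integral_indicator measurableSet_Icc
    _ = _ := by
        rw [intervalIntegral.integral_of_le hT, integral_Icc_eq_integral_Ioc]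

/-- Any of the n + 1 variables may be the latest one, and each case contributes the same iterated
integral. -/
theorem boxIntegral_eq [CompleteSpace A] (hf : Continuous f) (n : ℕ) {T : ℝ} (hT : 0 ≤ T) :
    boxIntegral f n T = (n.factorial : ℝ) • dysonIntegral f n T := by
  induction n generalizing T with
  | zero =>
    have h1 : ∀ τ : Fin 0 → ℝ, timeProd f τ = 1 := fun τ => by simp [timeProd]
    simp only [boxIntegral, h1, setIntegral_const, volume_real_timeBox hT]
    simp [dysonIntegral]
  | succ n ih =>
    have hsum : ∀ τ : Fin (n + 1) → ℝ, timeProd f τ = ∑ i,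
        Set.indicator {τ | timeRank τ i = 0} (fun τ => timeProd f τ) τ := by
      intro τ
      rw [Finset.sum_eq_single ((Tuple.sort fun i => -τ i) 0)]
      · rw [Set.indicator_of_mem]
        simp [timeRank]
      · intro i _ hi
        refine Set.indicator_of_notMem (fun h => hi ?_) _
        have h' : timeRank τ i = 0 := h
        rw [← h', timeRank, Equiv.apply_symm_apply]
      · simp
    have hA : ∀ i, MeasurableSet {τ : Fin (n + 1) → ℝ | timeRank τ i = 0} := by
      intro i
      simp only [timeRank_eq_zero_iff, Set.ofPred_forall]
      exact MeasurableSet.iInter fun k => measurableSet_before _ _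
    rw [boxIntegral, setIntegral_congr_fun (measurableSet_timeBox _ _) fun τ _ => hsum τ,
      integral_finsetSum _ fun i _ => (integrableOn_timeProd hf (n + 1) T).indicator (hA i)]
    simp only [setIntegral_timeProd_first hf n hT]
    rw [Finset.sum_const, Finset.card_univ, Fintype.card_fin, dysonIntegral, Nat.factorial_succ]
    have : ∫ t in (0 : ℝ)..T, f t * boxIntegral f n t =
        (n.factorial : ℝ) • ∫ t in (0 : ℝ)..T, f t * dysonIntegral f n t := by
      rw [← intervalIntegral.integral_smul]
      refine intervalIntegral.integral_congr fun t ht => ?_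
      rw [Set.uIcc_of_le hT] at ht
      rw [ih ht.1, mul_smul_comm]
    rw [this, Nat.cast_mul, mul_smul, ← Nat.cast_smul_eq_nsmul ℝ]

end BoxIntegral

end

/-! ### The Dyson series of the partition function. -/

section

open Matrix MeasureTheory

section DysonSeries

variable {A : Type} [NormedRing A] [NormedAlgebra ℝ A] [CompleteSpace A] {f : ℝ → A}

/-- Convergence of the Dyson series. -/
theorem tendsto_sum_dysonIntegral (hf : Continuous f) {W : ℝ → A}
    (hW : ∀ t, HasDerivAt W (f t * W t) t) (hW0 : W 0 = 1) {T : ℝ} (hT : 0 ≤ T) :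
    Filter.Tendsto (fun n => ∑ k ∈ Finset.range n, dysonIntegral f k T) Filter.atTop
      (nhds (W T)) := by
  have hWc : Continuous W := continuous_iff_continuousAt.2 fun t => (hW t).continuousAt
  have hUc := continuous_dysonIntegral hf
  let R : ℕ → ℝ → A := fun n t => W t - ∑ k ∈ Finset.range n, dysonIntegral f k t
  -- The remainders obey the same Volterra iteration as the terms, so by induction they are at most
  -- D (B t)^n / n!.
  have hR : ∀ n t, R (n + 1) t = ∫ u in (0 : ℝ)..t, f u * R n u := by
    intro n t
    have h1 : ∫ u in (0 : ℝ)..t, f u * W u = W t - 1 := by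
      rw [intervalIntegral.integral_eq_sub_of_hasDerivAt (fun u _ => hW u)
        ((hf.mul hWc).intervalIntegrable _ _), hW0]
    have h2 : ∀ u, f u * R n u = f u * W u - ∑ k ∈ Finset.range n, f u * dysonIntegral f k u :=
      fun u => by rw [mul_sub, Finset.mul_sum]
    have hc1 : Continuous fun u => f u * W u := hf.mul hWc
    have hc2 : ∀ k, Continuous fun u => f u * dysonIntegral f k u := fun k => hf.mul (hUc k)
    simp only [h2]
    rw [intervalIntegral.integral_sub (hc1.intervalIntegrable _ _)
      ((continuous_finsetSum _ fun k _ => hc2 k).intervalIntegrable _ _), h1,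
      intervalIntegral.integral_finsetSum fun k _ => (hc2 k).intervalIntegrable _ _]
    simp only [R, Finset.sum_range_succ']
    simp only [dysonIntegral]
    abel
  obtain ⟨B, hB⟩ := isCompact_Icc.exists_bound_of_continuousOn (hf.continuousOn (s := Set.Icc 0 T))
  obtain ⟨D, hD⟩ := isCompact_Icc.exists_bound_of_continuousOn (hWc.continuousOn (s := Set.Icc 0 T))
  have hB0 : 0 ≤ B := (norm_nonneg _).trans (hB 0 ⟨le_rfl, hT⟩)
  have hD0 : 0 ≤ D := (norm_nonneg _).trans (hD 0 ⟨le_rfl, hT⟩)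
  have hbound : ∀ n, ∀ t ∈ Set.Icc 0 T, ‖R n t‖ ≤ D * (B ^ n * t ^ n / n.factorial) := by
    intro n
    induction n with
    | zero => intro t ht; simpa [R] using hD t ht
    | succ n ih =>
      intro t ht
      rw [hR]
      refine (intervalIntegral.norm_integral_le_of_norm_le ht.1
        (g := fun u => B * (D * (B ^ n * u ^ n / n.factorial)))
        (Filter.Eventually.of_forall fun u hu => ?_)
        (Continuous.intervalIntegrable (by fun_prop) _ _)).trans (le_of_eq ?_)
      · have hu' : u ∈ Set.Icc 0 T := ⟨hu.1.le, hu.2.trans ht.2⟩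
        exact (norm_mul_le _ _).trans (mul_le_mul (hB u hu') (ih u hu') (norm_nonneg _) hB0)
      · have : ∀ u : ℝ, B * (D * (B ^ n * u ^ n / n.factorial)) =
            (B * D * B ^ n / n.factorial) * u ^ n := fun u => by ring
        simp only [this]
        rw [intervalIntegral.integral_const_mul, integral_pow, Nat.factorial_succ]
        push_cast
        have : (n.factorial : ℝ) ≠ 0 := Nat.cast_ne_zero.2 n.factorial_ne_zero
        field_simp
        ring
  rw [tendsto_iff_norm_sub_tendsto_zero]
  have hlim : Filter.Tendsto (fun n : ℕ => D * ((B * T) ^ n / n.factorial)) Filter.atTop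
      (nhds 0) := by
    simpa using (FloorSemiring.tendsto_pow_div_factorial_atTop (B * T)).const_mul D
  refine squeeze_zero (fun n => norm_nonneg _) (fun n => ?_) hlim
  rw [norm_sub_rev, mul_pow]
  exact hbound n T ⟨hT, le_rfl⟩

theorem dysonIntegral_smul {A : Type} [NormedRing A] [NormedAlgebra ℂ A]
    (f : ℝ → A) (c : ℂ) (n : ℕ) (T : ℝ) :
    dysonIntegral (fun t => c • f t) n T = c ^ n • dysonIntegral f n T := by
  induction n generalizing T with
  | zero => simp [dysonIntegral]
  | succ n ih =>
    simp only [dysonIntegral, ih, smul_mul_smul_comm]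
    rw [intervalIntegral.integral_smul, pow_succ']

end DysonSeries

variable {Ω : Type} [LinearOrder Ω] [Fintype Ω] {ι : Type} [Fintype ι]

/-- The `n`-th moment of the perturbation. -/
def momentSum (h : Matrix Ω Ω ℂ) (v : ι → ℂ) (P : ι → MultiIndex Ω) (β : ℝ) (n : ℕ) : ℂ :=
  ∑ p : Fin n → ι, (∏ k, v (p k)) * ∫ τ in timeBox β n, moment h β (fun k => P (p k)) τ

/-- The `n`-th cumulant of the perturbation. -/
def cumulantSum (h : Matrix Ω Ω ℂ) (v : ι → ℂ) (P : ι → MultiIndex Ω) (β : ℝ) (n : ℕ) : ℂ :=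
  ∑ p : Fin n → ι, (∏ k, v (p k)) * ∫ τ in timeBox β n, cumulant h β (fun k => P (p k)) τ

/-- Multilinear expansion assigns labels to positions in the ordered product; reindexing by the
sorting permutation assigns them to the time variables instead. -/
theorem freeExpect_timeProd (h : Matrix Ω Ω ℂ) (v : ι → ℂ) (P : ι → MultiIndex Ω) (β : ℝ) {n : ℕ}
    (τ : Fin n → ℝ) :
    freeExpect h β (timeProd (fun t => evolve h t (potential v P)) τ) =
      ∑ p : Fin n → ι, (∏ k, v (p k)) * moment h β (fun k => P (p k)) τ := by
  set σ : Equiv.Perm (Fin n) := Tuple.sort fun i => -τ i with hσ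
  have h1 : timeProd (fun t => evolve h t (potential v P)) τ =
      MultilinearMap.mkPiAlgebraFin ℂ n (FockOp Ω)
        fun k => ∑ i, v i • evolve h (τ (σ k)) (monomial (P i)) := by
    rw [MultilinearMap.mkPiAlgebraFin_apply, timeProd]
    congr 2
    ext1 k
    rw [potential, evolve_sum]
    simp only [evolve_smul]
    rfl
  rw [h1, MultilinearMap.map_sum, ← freeExpectₗ_apply, map_sum]
  simp only [MultilinearMap.map_smul_univ, map_smul, MultilinearMap.mkPiAlgebraFin_apply]
  rw [← Equiv.sum_comp (Equiv.arrowCongr σ.symm (Equiv.refl ι))]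
  refine Finset.sum_congr rfl fun p _ => ?_
  simp only [Equiv.arrowCongr_apply, Function.comp_apply, Equiv.refl_apply, Equiv.symm_symm,
    smul_eq_mul]
  rw [Equiv.prod_comp σ fun k => v (p k)]
  rfl

open scoped Matrix.Norms.L2Operator

theorem continuous_evolve (h : Matrix Ω Ω ℂ) (A : FockOp Ω) :
    Continuous fun t : ℝ => evolve h t A := by
  simp only [evolve_eq]
  exact (((continuous_expm (freeHam h)).comp Complex.continuous_ofReal).mul continuous_const).mul
    ((continuous_expm (freeHam h)).comp (Complex.continuous_ofReal.neg))

theorem freeExpect_dysonIntegral {h : Matrix Ω Ω ℂ} (hh : h.IsHermitian) (v : ι → ℂ)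
    (P : ι → MultiIndex Ω) {β : ℝ} (hβ : 0 ≤ β) (n : ℕ) :
    freeExpect h β (dysonIntegral (fun t => evolve h t (potential v P)) n β) =
      momentSum h v P β n / n.factorial := by
  have hf := continuous_evolve h (potential v P)
  have hn : (n.factorial : ℂ) ≠ 0 := Nat.cast_ne_zero.2 n.factorial_ne_zero
  rw [eq_div_iff hn]
  have h1 := boxIntegral_eq hf n hβ
  let φ : FockOp Ω →L[ℂ] ℂ := LinearMap.toContinuousLinearMap (freeExpectₗ h β)
  have hφ : ∀ A, φ A = freeExpect h β A := fun A => rfl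
  have h2 : φ (boxIntegral (fun t => evolve h t (potential v P)) n β) = momentSum h v P β n := by
    rw [boxIntegral, ← ContinuousLinearMap.integral_comp_comm φ (integrableOn_timeProd hf n β)]
    simp only [hφ, freeExpect_timeProd]
    rw [integral_finsetSum _ fun p _ => (integrableOn_moment hh β _).const_mul _, momentSum]
    exact Finset.sum_congr rfl fun p _ => integral_const_mul _ _
  rw [← h2, h1, ← hφ]
  have : ((n.factorial : ℝ) • dysonIntegral (fun t => evolve h t (potential v P)) n β) =
      (n.factorial : ℂ) • dysonIntegral (fun t => evolve h t (potential v P)) n β := by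
    rw [Nat.cast_smul_eq_nsmul ℝ, Nat.cast_smul_eq_nsmul ℂ]
  rw [this, map_smul, smul_eq_mul, mul_comm]

/-- Interaction picture: W(t) = e^{tH₀} e^{-t(H₀ + zV)} solves W' = -z V(t) W with W(0) = 1, and its
free expectation at t = β is the ratio of the partition functions. -/
theorem tendsto_partitionFunction_series {h : Matrix Ω Ω ℂ} (hh : h.IsHermitian) (v : ι → ℂ)
    (P : ι → MultiIndex Ω) {β : ℝ} (hβ : 0 ≤ β) (z : ℂ) :
    Filter.Tendsto (fun n => ∑ k ∈ Finset.range n, (-z) ^ k * (momentSum h v P β k / k.factorial))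
      Filter.atTop (nhds (partitionFunction β (freeHam h + z • potential v P) /
        partitionFunction β (freeHam h))) := by
  set V := potential v P
  set H := freeHam h
  have hf : Continuous fun t : ℝ => -z • evolve h t V :=
    (continuous_evolve h V).const_smul (-z)
  let W : ℝ → FockOp Ω := fun t => expm H t * expm (H + z • V) (-t)
  have hW : ∀ t, HasDerivAt W ((-z • evolve h t V) * W t) t := by
    intro t
    have h1 : HasDerivAt (fun t : ℝ => expm H t) (expm H t * H) t := by
      simpa [Function.comp_def] using
        (hasDerivAt_expm H (t : ℂ)).scomp t Complex.ofRealCLM.hasDerivAt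
    have h2 : HasDerivAt (fun t : ℝ => expm (H + z • V) (-t))
        (-((H + z • V) * expm (H + z • V) (-t))) t := by
      have h3 : HasDerivAt (fun t : ℝ => -(t : ℂ)) (-1) t := by
        simpa using ((hasDerivAt_id t).ofReal_comp).fun_neg
      simpa [Function.comp_def] using (hasDerivAt_expm' (H + z • V) (-(t : ℂ))).scomp t h3
    refine (h1.mul h2).congr_deriv ?_
    have h4 : expm H (-(t : ℂ)) * (expm H t * expm (H + z • V) (-t)) = expm (H + z • V) (-t) := by
      rw [← mul_assoc, expm_neg_mul, one_mul]
    simp only [evolve_eq, W]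
    rw [show (-z • (expm (freeHam h) t * V * expm (freeHam h) (-t))) *
      (expm H t * expm (H + z • V) (-t)) = -z • (expm H t * V * (expm H (-(t : ℂ)) *
        (expm H t * expm (H + z • V) (-t)))) by simp only [smul_mul_assoc, mul_assoc]; rfl, h4]
    simp only [mul_neg, add_mul, mul_add, smul_mul_assoc, mul_smul_comm, neg_smul, mul_assoc]
    abel
  have hlim := tendsto_sum_dysonIntegral hf hW (by simp [W, expm_zero]) hβ
  let φ : FockOp Ω →L[ℂ] ℂ := LinearMap.toContinuousLinearMap (freeExpectₗ h β)
  have hφ : ∀ A, φ A = freeExpect h β A := fun A => rfl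
  have hφW : φ (W β) = partitionFunction β (H + z • V) / partitionFunction β H := by
    rw [hφ, freeExpect_eq]
    have : (W β * expm (freeHam h) (-β)).trace = (expm (H + z • V) (-β)).trace := by
      rw [Matrix.trace_mul_comm, ← mul_assoc, expm_neg_mul, one_mul]
    rw [this]
    rfl
  rw [← hφW]
  refine ((φ.continuous.tendsto _).comp hlim).congr fun n => ?_
  rw [Function.comp_apply, map_sum]
  refine Finset.sum_congr rfl fun k _ => ?_
  rw [dysonIntegral_smul, map_smul, hφ, freeExpect_dysonIntegral hh v P hβ, smul_eq_mul]

end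

/-! ### The moment–cumulant recursion after integration. -/

section

open Matrix MeasureTheory

section Factorization

variable {ι : Type} [Fintype ι] {m l s : ℕ}

theorem setIntegral_timeBox_split (e : Fin m ⊕ Fin l ≃ Fin s) (β : ℝ) (F : (Fin m → ℝ) → ℂ)
    (G : (Fin l → ℝ) → ℂ) :
    ∫ τ in timeBox β s, F (fun a => τ (e (Sum.inl a))) * G (fun b => τ (e (Sum.inr b))) =
      (∫ τ in timeBox β m, F τ) * ∫ τ in timeBox β l, G τ := by
  let ψ : (Fin s → ℝ) ≃ᵐ (Fin m → ℝ) × (Fin l → ℝ) :=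
    (MeasurableEquiv.piCongrLeft (fun _ => ℝ) e).symm.trans
      (MeasurableEquiv.sumPiEquivProdPi fun _ => ℝ)
  have hψ : MeasurePreserving ψ volume volume :=
    (volume_measurePreserving_sumPiEquivProdPi fun _ => ℝ).comp
      ((volume_measurePreserving_piCongrLeft (fun _ => ℝ) e).symm)
  have hval : ∀ τ, ψ τ = (fun a => τ (e (Sum.inl a)), fun b => τ (e (Sum.inr b))) := fun τ => rfl
  have hpre : ψ ⁻¹' (timeBox β m ×ˢ timeBox β l) = timeBox β s := by
    ext τ
    simp only [Set.mem_preimage, hval, Set.mem_prod, timeBox, Set.mem_Icc, Pi.le_def]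
    rw [← e.forall_congr_right (q := fun k => 0 ≤ τ k), ← e.forall_congr_right (q := fun k => τ k ≤ β),
      Sum.forall, Sum.forall]
    tauto
  rw [← setIntegral_prod_mul, ← Measure.volume_eq_prod,
    ← hψ.setIntegral_preimage_emb ψ.measurableEmbedding, hpre]
  rfl

theorem sum_mul_setIntegral_split (e : Fin m ⊕ Fin l ≃ Fin s) (β : ℝ) (v : ι → ℂ)
    (F : (Fin m → ι) → (Fin m → ℝ) → ℂ) (G : (Fin l → ι) → (Fin l → ℝ) → ℂ) :
    ∑ p : Fin s → ι, (∏ k, v (p k)) * ∫ τ in timeBox β s,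
        F (fun a => p (e (Sum.inl a))) (fun a => τ (e (Sum.inl a))) *
          G (fun b => p (e (Sum.inr b))) (fun b => τ (e (Sum.inr b))) =
      (∑ q : Fin m → ι, (∏ k, v (q k)) * ∫ τ in timeBox β m, F q τ) *
        ∑ q : Fin l → ι, (∏ k, v (q k)) * ∫ τ in timeBox β l, G q τ := by
  let E : (Fin s → ι) ≃ (Fin m → ι) × (Fin l → ι) :=
    (Equiv.arrowCongr e.symm (Equiv.refl ι)).trans (Equiv.sumArrowEquivProdArrow _ _ _)
  have hE : ∀ p, E p = (fun a => p (e (Sum.inl a)), fun b => p (e (Sum.inr b))) := fun p => rfl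
  rw [Finset.sum_mul_sum, ← Fintype.sum_prod_type', ← Equiv.sum_comp E]
  refine Finset.sum_congr rfl fun p _ => ?_
  rw [hE, setIntegral_timeBox_split, ← Equiv.prod_comp e, Fintype.prod_sum_type]
  ring

end Factorization

variable {Ω : Type} [LinearOrder Ω] [Fintype Ω] {ι : Type} [Fintype ι]

/-- The labels and times in X and in its complement vary independently, so sum and integral
factorise. The result depends only on the size of X, which produces the binomial coefficients in the
recursion. -/
theorem sum_integral_cumul_mul_momentOn {h : Matrix Ω Ω ℂ} (hh : h.IsHermitian) (v : ι → ℂ)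
    (P : ι → MultiIndex Ω) (β : ℝ) {s m l : ℕ} {X : Finset (Fin s)} (hX : X.Nonempty)
    (hm : X.card = m) (hl : Xᶜ.card = l) :
    ∑ p : Fin s → ι, (∏ k, v (p k)) * ∫ τ in timeBox β s,
        cumul (momentOn h β (fun k => P (p k)) τ) X * momentOn h β (fun k => P (p k)) τ Xᶜ =
      cumulantSum h v P β m * momentSum h v P β l := by
  have := sum_mul_setIntegral_split (finSumEquivOfFinset hm hl) β v
    (fun q τ => cumulant h β (fun k => P (q k)) τ) (fun q τ => moment h β (fun k => P (q k)) τ)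
  simp only [finSumEquivOfFinset_inl, finSumEquivOfFinset_inr] at this
  rw [cumulantSum, momentSum, ← this]
  refine Finset.sum_congr rfl fun p _ => ?_
  congr 2
  ext τ
  rw [cumul_momentOn_orderEmb hh β _ τ hX hm, momentOn_orderEmb hh β _ τ hl]

/-- The recursion between the moments and the cumulants of the perturbation. -/
theorem momentSum_succ {h : Matrix Ω Ω ℂ} (hh : h.IsHermitian) (v : ι → ℂ)
    (P : ι → MultiIndex Ω) (β : ℝ) (n : ℕ) :
    momentSum h v P β (n + 1) = ∑ k ∈ Finset.range (n + 1),
      (n.choose k : ℂ) * (cumulantSum h v P β (k + 1) * momentSum h v P β (n - k)) := by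
  let Y : Finset (Fin (n + 1)) := Finset.univ.erase 0
  have hY : Y.card = n := by simp [Y]
  have hrY : (0 : Fin (n + 1)) ∉ Y := by simp [Y]
  have hins : insert 0 Y = Finset.univ := Finset.insert_erase (Finset.mem_univ _)
  have hcompl : ∀ Z, Y \ Z = (insert 0 Z)ᶜ := by
    intro Z
    ext x
    simp [Y]
  have hint : ∀ (p : Fin (n + 1) → ι) (Z : Finset (Fin (n + 1))), IntegrableOn (fun τ =>
      cumul (momentOn h β (fun k => P (p k)) τ) (insert 0 Z) *
        momentOn h β (fun k => P (p k)) τ (Y \ Z)) (timeBox β (n + 1)) := by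
    intro p Z
    refine Integrable.mul_bdd (c := 1) (integrableOn_cumul_momentOn hh β _ _)
      (measurable_momentOn h β _ _).aestronglyMeasurable ?_
    exact (ae_restrict_iff' (measurableSet_timeBox _ _)).2
      (Filter.Eventually.of_forall fun τ hτ => norm_momentOn_le_one hh _ hτ _)
  have h1 : ∀ p : Fin (n + 1) → ι,
      ∫ τ in timeBox β (n + 1), moment h β (fun k => P (p k)) τ =
      ∑ Z ∈ Y.powerset, ∫ τ in timeBox β (n + 1),
        cumul (momentOn h β (fun k => P (p k)) τ) (insert 0 Z) *
          momentOn h β (fun k => P (p k)) τ (Y \ Z) := by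
    intro p
    rw [← integral_finsetSum _ fun Z _ => hint p Z]
    congr 1
    ext τ
    rw [← momentOn_univ hh, ← hins]
    exact moment_cumul_recursion (momentOn_empty h β _ τ) hrY
  rw [momentSum]
  simp only [h1, Finset.mul_sum]
  rw [Finset.sum_comm]
  have h2 : ∀ Z ∈ Y.powerset, ∑ p : Fin (n + 1) → ι, (∏ k, v (p k)) *
      ∫ τ in timeBox β (n + 1), cumul (momentOn h β (fun k => P (p k)) τ) (insert 0 Z) *
        momentOn h β (fun k => P (p k)) τ (Y \ Z) =
      cumulantSum h v P β (Z.card + 1) * momentSum h v P β (n - Z.card) := by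
    intro Z hZ
    rw [Finset.mem_powerset] at hZ
    have h0 : (0 : Fin (n + 1)) ∉ Z := fun h => hrY (hZ h)
    rw [hcompl Z]
    refine sum_integral_cumul_mul_momentOn hh v P β (Finset.insert_nonempty _ _)
      (Finset.card_insert_of_notMem h0) ?_
    rw [← hcompl, Finset.card_sdiff_of_subset hZ, hY]
  rw [Finset.sum_congr rfl h2, Finset.sum_powerset_apply_card
    (fun k => cumulantSum h v P β (k + 1) * momentSum h v P β (n - k)), hY]
  exact Finset.sum_congr rfl fun k _ => nsmul_eq_mul _ _

end

/-! ### Exponentials and logarithms of power series. -/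

section

section PowerSeries

theorem summable_mul_pow {a : ℕ → ℂ} (ha : Summable fun n => ‖a n‖ * 4 ^ n) {z : ℂ}
    (hz : ‖z‖ ≤ 4) : Summable fun n => ‖a n * z ^ n‖ := by
  refine Summable.of_nonneg_of_le (fun n => norm_nonneg _) (fun n => ?_) ha
  rw [norm_mul, norm_pow]
  gcongr

/-- The weight 4^n leaves room for differentiation on |z| ≤ 2: one factor 2^n dominates n, the other
the power of z. The open disc of radius 2 contains the segment [0, 1]. -/
theorem norm_derivTerm_le {a : ℕ → ℂ} {z : ℂ} (hz : ‖z‖ ≤ 2) (n : ℕ) :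
    ‖a n * (n * z ^ (n - 1))‖ ≤ ‖a n‖ * 4 ^ n := by
  rw [norm_mul, norm_mul, norm_pow, Complex.norm_natCast]
  refine mul_le_mul_of_nonneg_left ?_ (norm_nonneg _)
  have h1 : (n : ℝ) ≤ 2 ^ n := by exact_mod_cast n.lt_two_pow_self.le
  have h2 : ‖z‖ ^ (n - 1) ≤ 2 ^ n :=
    (pow_le_pow_left₀ (norm_nonneg _) hz _).trans (pow_le_pow_right₀ one_le_two (Nat.sub_le _ _))
  calc (n : ℝ) * ‖z‖ ^ (n - 1) ≤ 2 ^ n * 2 ^ n :=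
        mul_le_mul h1 h2 (by positivity) (by positivity)
    _ = 4 ^ n := by rw [← mul_pow]; norm_num

theorem summable_derivTerm {a : ℕ → ℂ} (ha : Summable fun n => ‖a n‖ * 4 ^ n) {z : ℂ}
    (hz : ‖z‖ ≤ 2) : Summable fun n => ‖((n + 1 : ℕ) : ℂ) * a (n + 1) * z ^ n‖ := by
  have h1 : Summable fun n => ‖a n * (n * z ^ (n - 1))‖ :=
    Summable.of_nonneg_of_le (fun n => norm_nonneg _) (norm_derivTerm_le hz) ha
  refine ((summable_nat_add_iff 1).2 h1).congr fun n => ?_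
  rw [Nat.add_sub_cancel]
  congr 1
  ring

theorem hasDerivAt_tsum_pow {a : ℕ → ℂ} (ha : Summable fun n => ‖a n‖ * 4 ^ n) {z : ℂ}
    (hz : ‖z‖ < 2) : HasDerivAt (fun z => ∑' n, a n * z ^ n)
      (∑' n, ((n + 1 : ℕ) : ℂ) * a (n + 1) * z ^ n) z := by
  have hmem : ∀ {y : ℂ}, y ∈ Metric.ball (0 : ℂ) 2 → ‖y‖ ≤ 2 := fun hy =>
    (mem_ball_zero_iff.1 hy).le
  have h := hasDerivAt_tsum_of_isPreconnected (g := fun n z => a n * z ^ n)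
    (g' := fun n z => a n * (n * z ^ (n - 1))) (y₀ := 0) (y := z) ha
    (Metric.isOpen_ball (x := (0 : ℂ)) (ε := 2)) (convex_ball _ _).isPreconnected
    (fun n y _ => (hasDerivAt_pow n y).const_mul _) (fun n y hy => norm_derivTerm_le (hmem hy) n)
    (Metric.mem_ball_self two_pos) (summable_mul_pow ha (by simp)).of_norm
    (mem_ball_zero_iff.2 hz)
  refine h.congr_deriv ?_
  have h1 : Summable fun n => a n * (n * z ^ (n - 1)) :=
    (Summable.of_nonneg_of_le (fun n => norm_nonneg _) (norm_derivTerm_le hz.le) ha).of_norm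
  rw [h1.tsum_eq_zero_add]
  simp only [Nat.cast_zero, zero_mul, mul_zero, zero_add, Nat.add_sub_cancel]
  exact tsum_congr fun n => by ring

/-- Two power series related by the recursion between moments and cumulants. -/
structure IsLogSeries (a b : ℕ → ℂ) : Prop where
  summable_left : Summable fun n => ‖a n‖ * 4 ^ n
  summable_right : Summable fun n => ‖b n‖ * 4 ^ n
  left_zero : a 0 = 1
  right_zero : b 0 = 0
  recursion : ∀ n, ((n + 1 : ℕ) : ℂ) * a (n + 1) =
    ∑ k ∈ Finset.range (n + 1), ((k + 1 : ℕ) : ℂ) * b (k + 1) * a (n - k)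

variable {a b : ℕ → ℂ}

theorem tsum_at_zero (a : ℕ → ℂ) : ∑' n, a n * (0 : ℂ) ^ n = a 0 := by
  rw [tsum_eq_single 0 fun n hn => by simp [hn]]
  simp

/-- The recursion is the identity of Taylor coefficients in A' = B' A, read through the Cauchy
product. -/
theorem IsLogSeries.deriv_eq (hab : IsLogSeries a b) {z : ℂ} (hz : ‖z‖ ≤ 2) :
    ∑' n, ((n + 1 : ℕ) : ℂ) * a (n + 1) * z ^ n =
      (∑' n, ((n + 1 : ℕ) : ℂ) * b (n + 1) * z ^ n) * ∑' n, a n * z ^ n := by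
  rw [tsum_mul_tsum_eq_tsum_sum_range_of_summable_norm (summable_derivTerm hab.summable_right hz)
    (summable_mul_pow hab.summable_left (hz.trans (by norm_num)))]
  refine tsum_congr fun n => ?_
  rw [hab.recursion, Finset.sum_mul]
  refine Finset.sum_congr rfl fun k hk => ?_
  rw [← Nat.add_sub_of_le (Nat.lt_succ_iff.1 (Finset.mem_range.1 hk))]
  rw [Nat.add_sub_cancel_left, pow_add]
  ring

theorem IsLogSeries.hasDerivAt_left (hab : IsLogSeries a b) {t : ℝ} (ht : t ∈ Set.Icc (0 : ℝ) 1) :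
    HasDerivAt (fun t : ℝ => ∑' n, a n * (t : ℂ) ^ n)
      ((∑' n, ((n + 1 : ℕ) : ℂ) * b (n + 1) * (t : ℂ) ^ n) * ∑' n, a n * (t : ℂ) ^ n) t := by
  have hz : ‖(t : ℂ)‖ < 2 := by
    rw [Complex.norm_real, Real.norm_of_nonneg ht.1]; linarith [ht.2]
  rw [← hab.deriv_eq hz.le]
  exact (hasDerivAt_tsum_pow hab.summable_left hz).comp_ofReal

theorem IsLogSeries.hasDerivAt_right (hab : IsLogSeries a b) {t : ℝ}
    (ht : t ∈ Set.Icc (0 : ℝ) 1) :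
    HasDerivAt (fun t : ℝ => ∑' n, b n * (t : ℂ) ^ n)
      (∑' n, ((n + 1 : ℕ) : ℂ) * b (n + 1) * (t : ℂ) ^ n) t := by
  have hz : ‖(t : ℂ)‖ < 2 := by
    rw [Complex.norm_real, Real.norm_of_nonneg ht.1]; linarith [ht.2]
  exact (hasDerivAt_tsum_pow hab.summable_right hz).comp_ofReal

theorem eq_of_hasDerivAt_zero {g : ℝ → ℂ} (hg : ∀ t ∈ Set.Icc (0 : ℝ) 1, HasDerivAt g 0 t) :
    g 1 = g 0 :=
  constant_of_has_deriv_right_zero (fun t ht => (hg t ht).continuousAt.continuousWithinAt)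
    (fun t ht => (hg t ⟨ht.1, ht.2.le⟩).hasDerivWithinAt) 1 ⟨zero_le_one, le_rfl⟩

/-- By A' = B' A the function A e^{-B} has zero derivative on [0, 1], and it equals 1 at 0. -/
theorem IsLogSeries.exp_tsum (hab : IsLogSeries a b) : Complex.exp (∑' n, b n) = ∑' n, a n := by
  have h := eq_of_hasDerivAt_zero (g := fun t : ℝ => (∑' n, a n * (t : ℂ) ^ n) *
      Complex.exp (-∑' n, b n * (t : ℂ) ^ n)) fun t ht => by
    refine ((hab.hasDerivAt_left ht).mul (hab.hasDerivAt_right ht).fun_neg.cexp).congr_deriv ?_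
    ring
  simp only [Complex.ofReal_one, one_pow, mul_one, Complex.ofReal_zero, tsum_at_zero,
    hab.left_zero, hab.right_zero, neg_zero, Complex.exp_zero] at h
  rw [Complex.exp_neg] at h
  exact ((mul_inv_eq_one₀ (Complex.exp_ne_zero _)).1 h).symm

/-- As long as A avoids the branch cut along [0, 1], B - log A is differentiable with zero
derivative, and it vanishes at 0. -/
theorem IsLogSeries.tsum_eq_log (hab : IsLogSeries a b)
    (hpos : ∀ t ∈ Set.Icc (0 : ℝ) 1, ∑' n, a n * (t : ℂ) ^ n ∈ Complex.slitPlane) :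
    ∑' n, b n = Complex.log (∑' n, a n) := by
  have h := eq_of_hasDerivAt_zero (g := fun t : ℝ => (∑' n, b n * (t : ℂ) ^ n) -
      Complex.log (∑' n, a n * (t : ℂ) ^ n)) fun t ht => by
    refine ((hab.hasDerivAt_right ht).sub
      ((hab.hasDerivAt_left ht).clog_real (hpos t ht))).congr_deriv ?_
    rw [mul_div_cancel_right₀ _ (Complex.slitPlane_ne_zero (hpos t ht)), sub_self]
  simp only [Complex.ofReal_one, one_pow, mul_one, Complex.ofReal_zero, tsum_at_zero,
    hab.left_zero, hab.right_zero, Complex.log_one, sub_zero] at h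
  exact sub_eq_zero.1 h

end PowerSeries

end

/-! ### The cumulant expansion of the logarithm and its truncation. -/

section

open Matrix MeasureTheory

variable {Ω : Type} [LinearOrder Ω] [Fintype Ω] {ι : Type} [Fintype ι]

theorem cumulantTerm_eq (h : Matrix Ω Ω ℂ) (v : ι → ℂ) (P : ι → MultiIndex Ω) (β : ℝ) (s : ℕ) :
    cumulantTerm h v P β s = (-1) ^ s / (s.factorial : ℂ) * cumulantSum h v P β s := rfl

theorem norm_cumulantTerm_le (h : Matrix Ω Ω ℂ) (v : ι → ℂ) (P : ι → MultiIndex Ω) (β : ℝ)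
    (s : ℕ) : ‖cumulantTerm h v P β s‖ ≤ absCumulantTerm h v P β s := by
  rw [cumulantTerm, absCumulantTerm, norm_mul, norm_div, norm_pow, norm_neg, norm_one, one_pow,
    Complex.norm_natCast]
  refine mul_le_mul_of_nonneg_left ((norm_sum_le _ _).trans (Finset.sum_le_sum fun p _ => ?_))
    (by positivity)
  rw [norm_mul]
  exact mul_le_mul_of_nonneg_left (norm_integral_le_integral_norm _) (norm_nonneg _)

theorem norm_momentSum_le {h : Matrix Ω Ω ℂ} (hh : h.IsHermitian) (v : ι → ℂ)
    (P : ι → MultiIndex Ω) {β : ℝ} (hβ : 0 ≤ β) (n : ℕ) :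
    ‖momentSum h v P β n‖ ≤ (β * ∑ i, ‖v i‖) ^ n := by
  have h1 : ∀ p : Fin n → ι, ‖∫ τ in timeBox β n, moment h β (fun k => P (p k)) τ‖ ≤ β ^ n := by
    intro p
    have := norm_setIntegral_le_of_norm_le_const (volume_timeBox_lt_top β n)
      (f := fun τ => moment h β (fun k => P (p k)) τ) (C := 1) fun τ hτ => by
        rw [← momentOn_univ hh]
        exact norm_momentOn_le_one hh _ hτ _
    rwa [one_mul, volume_real_timeBox hβ] at this
  calc ‖momentSum h v P β n‖ ≤ ∑ p : Fin n → ι, (∏ k, ‖v (p k)‖) * β ^ n := by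
        refine (norm_sum_le _ _).trans (Finset.sum_le_sum fun p _ => ?_)
        rw [norm_mul, norm_prod]
        exact mul_le_mul_of_nonneg_left (h1 p) (Finset.prod_nonneg fun _ _ => norm_nonneg _)
    _ = (β * ∑ i, ‖v i‖) ^ n := by
        rw [← Finset.sum_mul, mul_pow, mul_comm]
        congr 1
        have := Finset.prod_univ_sum (fun _ : Fin n => (Finset.univ : Finset ι))
          fun _ i => ‖v i‖
        rw [Fintype.piFinset_univ] at this
        rw [← this, Finset.prod_const, Finset.card_univ, Fintype.card_fin]

theorem momentSum_zero {h : Matrix Ω Ω ℂ} (hh : h.IsHermitian) (v : ι → ℂ)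
    (P : ι → MultiIndex Ω) {β : ℝ} (hβ : 0 ≤ β) : momentSum h v P β 0 = 1 := by
  have h1 : ∀ (p : Fin 0 → ι) (τ : Fin 0 → ℝ), moment h β (fun k => P (p k)) τ = 1 := by
    intro p τ
    simp [moment, freeExpect_one hh]
  simp only [momentSum, h1, setIntegral_const, volume_real_timeBox hβ]
  simp

/-- The coefficients of the partition function as a power series in the coupling. -/
def momentCoeff (h : Matrix Ω Ω ℂ) (v : ι → ℂ) (P : ι → MultiIndex Ω) (β : ℝ) (n : ℕ) : ℂ :=
  (-1) ^ n * (momentSum h v P β n / n.factorial)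

/-- The coefficients of the logarithm of the partition function. -/
def cumulantCoeff (h : Matrix Ω Ω ℂ) (v : ι → ℂ) (P : ι → MultiIndex Ω) (β : ℝ) (n : ℕ) : ℂ :=
  -- At n = 0 the formula for the cumulant term would give 1, from the empty partition, whereas a
  -- logarithm normalised at zero coupling has no constant term.
  if n = 0 then 0 else cumulantTerm h v P β n

theorem summable_momentCoeff {h : Matrix Ω Ω ℂ} (hh : h.IsHermitian) (v : ι → ℂ)
    (P : ι → MultiIndex Ω) {β : ℝ} (hβ : 0 ≤ β) :
    Summable fun n => ‖momentCoeff h v P β n‖ * 4 ^ n := by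
  refine Summable.of_nonneg_of_le (fun n => by positivity) (fun n => ?_)
    (Real.summable_pow_div_factorial (β * (∑ i, ‖v i‖) * 4))
  rw [momentCoeff, norm_mul, norm_pow, norm_neg, norm_one, one_pow, one_mul, norm_div,
    Complex.norm_natCast, mul_pow, div_mul_eq_mul_div]
  gcongr
  exact norm_momentSum_le hh v P hβ n

/-- The condition q < 1/4 makes the cumulant series summable with weight 4^n; the moment series
always is, by its factorials. The recursion is that of `momentSum_succ` divided by n!. -/
theorem isLogSeries_coeff {h : Matrix Ω Ω ℂ} (hh : h.IsHermitian) (v : ι → ℂ)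
    (P : ι → MultiIndex Ω) {β : ℝ} (hβ : 0 ≤ β) {N q : ℝ} (hq0 : 0 ≤ q) (hq : q < 1 / 4)
    (hbound : ∀ s, 1 ≤ s → ‖cumulantTerm h v P β s‖ ≤ N * q ^ s) :
    IsLogSeries (momentCoeff h v P β) (cumulantCoeff h v P β) where
  summable_left := summable_momentCoeff hh v P hβ
  summable_right := by
    have hs : Summable fun n : ℕ => N * (q * 4) ^ n :=
      (summable_geometric_of_lt_one (by positivity) (by linarith)).mul_left _
    rw [← summable_nat_add_iff 1] at hs ⊢
    refine Summable.of_nonneg_of_le (fun n => by positivity) (fun n => ?_) hs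
    rw [cumulantCoeff, if_neg (Nat.succ_ne_zero n), mul_pow, ← mul_assoc]
    gcongr
    exact hbound (n + 1) (Nat.le_add_left 1 n)
  left_zero := by simp [momentCoeff, momentSum_zero hh v P hβ]
  right_zero := if_pos rfl
  recursion n := by
    have hfac : ∀ k : ℕ, (k.factorial : ℂ) ≠ 0 := fun k => Nat.cast_ne_zero.2 k.factorial_ne_zero
    have hsucc : ∀ k : ℕ, ((k + 1 : ℕ) : ℂ) ≠ 0 := fun k => Nat.cast_ne_zero.2 k.succ_ne_zero
    rw [momentCoeff, momentSum_succ hh, Nat.factorial_succ, Nat.cast_mul, Finset.sum_div,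
      Finset.mul_sum, Finset.mul_sum]
    refine Finset.sum_congr rfl fun k hk => ?_
    have hkn : k ≤ n := Nat.lt_succ_iff.1 (Finset.mem_range.1 hk)
    have hchoose : (n.choose k : ℂ) * k.factorial * (n - k).factorial = n.factorial := by
      exact_mod_cast Nat.choose_mul_factorial_mul_factorial hkn
    have hpow : (-1 : ℂ) ^ (n + 1) = (-1) ^ (k + 1) * (-1) ^ (n - k) := by
      rw [← pow_add]
      congr 1
      omega
    rw [cumulantCoeff, if_neg (Nat.succ_ne_zero k), cumulantTerm_eq, momentCoeff, hpow,
      ← hchoose, Nat.factorial_succ, Nat.cast_mul]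
    have h1 := hfac k
    have h2 := hfac (n - k)
    have h3 : (n.choose k : ℂ) ≠ 0 := Nat.cast_ne_zero.2 (Nat.choose_pos hkn).ne'
    have h4 := hsucc k
    have h5 := hsucc n
    field_simp

theorem tsum_momentCoeff_mul_pow {h : Matrix Ω Ω ℂ} (hh : h.IsHermitian) (v : ι → ℂ)
    (P : ι → MultiIndex Ω) {β : ℝ} (hβ : 0 ≤ β) {z : ℂ} (hz : ‖z‖ ≤ 4) :
    ∑' n, momentCoeff h v P β n * z ^ n =
      partitionFunction β (freeHam h + z • potential v P) / partitionFunction β (freeHam h) := by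
  have h1 := (summable_mul_pow (summable_momentCoeff hh v P hβ) hz).of_norm.hasSum.tendsto_sum_nat
  refine tendsto_nhds_unique h1 ((tendsto_partitionFunction_series hh v P hβ z).congr fun n => ?_)
  refine Finset.sum_congr rfl fun k _ => ?_
  rw [momentCoeff, neg_pow]
  ring

-- Both partition functions are traces of positive definite matrices, so the ratio is positive for
-- every real coupling t, and the branch cut is never met.
open scoped ComplexOrder in
theorem partitionFunction_ratio_mem_slitPlane {h : Matrix Ω Ω ℂ} (hh : h.IsHermitian)
    {V : FockOp Ω} (hV : V.IsHermitian) (β t : ℝ) :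
    partitionFunction β (freeHam h + (t : ℂ) • V) / partitionFunction β (freeHam h) ∈
      Complex.slitPlane := by
  have h1 : (freeHam h + (t : ℂ) • V).IsHermitian := by
    refine (freeHam_isHermitian hh).add ?_
    rw [IsHermitian, conjTranspose_smul, hV.eq]
    simp
  have h2 : 0 < partitionFunction β (freeHam h + (t : ℂ) • V) := by
    have := trace_expm_pos h1 (-β)
    rwa [Complex.ofReal_neg] at this
  have h3 : 0 < partitionFunction β (freeHam h) := by
    have := trace_expm_pos (freeHam_isHermitian hh) (-β)
    rwa [Complex.ofReal_neg] at this
  have h4 := div_pos h2 h3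
  exact Complex.mem_slitPlane_iff.2 (Or.inl (Complex.pos_iff.1 h4).1)

/-- The tail starts at order S + 1, and for q ≤ 1/2 its extra factor q pays for the geometric
constant 1 / (1 - q). -/
theorem norm_tsum_sub_sum_Icc_le {b : ℕ → ℂ} (hb0 : b 0 = 0) {N q : ℝ} (hN : 0 ≤ N) (hq0 : 0 ≤ q)
    (hq : q ≤ 1 / 2) (hb : ∀ s, 1 ≤ s → ‖b s‖ ≤ N * q ^ s) (S : ℕ) :
    ‖∑' n, b n - ∑ s ∈ Finset.Icc 1 S, b s‖ ≤ N * q ^ S := by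
  have hb' : ∀ s, ‖b s‖ ≤ N * q ^ s := by
    intro s
    rcases Nat.eq_zero_or_pos s with rfl | hs
    · rw [hb0, norm_zero]; positivity
    · exact hb s hs
  have hgeo : Summable fun n : ℕ => q ^ n := summable_geometric_of_lt_one hq0 (by linarith)
  have hsum : Summable b := Summable.of_norm_bounded (hgeo.mul_left N) hb'
  have h1 : ∑ s ∈ Finset.Icc 1 S, b s = ∑ s ∈ Finset.range (S + 1), b s := by
    rw [Finset.sum_range_succ', hb0, add_zero, ← Nat.Ico_zero_eq_range,
      Finset.sum_Ico_add' b 0 S 1]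
    rfl
  rw [h1, ← hsum.sum_add_tsum_nat_add (S + 1), add_sub_cancel_left]
  have h2 : HasSum (fun n : ℕ => N * q ^ (S + 1) * q ^ n) (N * q ^ (S + 1) * (1 - q)⁻¹) :=
    (hasSum_geometric_of_lt_one hq0 (by linarith)).mul_left _
  refine (tsum_of_norm_bounded h2 fun n => ?_).trans ?_
  · refine (hb' _).trans (le_of_eq ?_)
    ring
  · have h3 : q * (1 - q)⁻¹ ≤ 1 := by
      rw [mul_inv_le_iff₀ (by linarith)]; linarith
    calc N * q ^ (S + 1) * (1 - q)⁻¹ = N * q ^ S * (q * (1 - q)⁻¹) := by ring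
      _ ≤ N * q ^ S * 1 := mul_le_mul_of_nonneg_left h3 (by positivity)
      _ = N * q ^ S := mul_one _

/-- Since 1/4 ≤ 1/e, the geometric decay is at least exponential with rate one, which permits K = 1.
-/
theorem pow_le_exp_neg {q : ℝ} (hq0 : 0 ≤ q) (hq : q ≤ 1 / 4) (S : ℕ) :
    q ^ S ≤ Real.exp (-S) := by
  have h1 : q ≤ Real.exp (-1) := by
    rw [Real.exp_neg]
    refine hq.trans ?_
    rw [one_div]
    exact inv_anti₀ (Real.exp_pos 1) (by linarith [Real.exp_one_lt_d9])
  calc q ^ S ≤ Real.exp (-1) ^ S := pow_le_pow_left₀ hq0 h1 S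
    _ = Real.exp (-S) := by rw [← Real.exp_nat_mul]; ring_nf

/-- The cumulant expansion of the logarithm of the partition function. -/
theorem exists_log_of_cumulantTerm_le {h : Matrix Ω Ω ℂ} (hh : h.IsHermitian) (v : ι → ℂ)
    (P : ι → MultiIndex Ω) {β : ℝ} (hβ : 0 ≤ β) {q : ℝ} (hq0 : 0 ≤ q) (hq : q < 1 / 4)
    (hbound : ∀ s, 1 ≤ s → ‖cumulantTerm h v P β s‖ ≤ Fintype.card Ω * q ^ s) :
    ∃ ℓ : ℂ, Complex.exp ℓ = partitionFunction β (freeHam h + potential v P) /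
        partitionFunction β (freeHam h) ∧
      ((potential v P).IsHermitian → ℓ = Complex.log (partitionFunction β
        (freeHam h + potential v P) / partitionFunction β (freeHam h))) ∧
      ∀ S : ℕ, ‖ℓ - ∑ s ∈ Finset.Icc 1 S, cumulantTerm h v P β s‖ ≤
        Fintype.card Ω * Real.exp (-S) := by
  have hab := isLogSeries_coeff hh v P hβ hq0 hq hbound
  have hone := tsum_momentCoeff_mul_pow hh v P hβ (z := 1) (by simp)
  simp only [one_pow, mul_one, one_smul] at hone
  refine ⟨∑' n, cumulantCoeff h v P β n, ?_, fun hV => ?_, fun S => ?_⟩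
  · rw [hab.exp_tsum, hone]
  · rw [hab.tsum_eq_log, hone]
    intro t ht
    rw [tsum_momentCoeff_mul_pow hh v P hβ]
    · exact partitionFunction_ratio_mem_slitPlane hh hV β t
    · rw [Complex.norm_real, Real.norm_of_nonneg ht.1]; linarith [ht.2]
  · have hcoeff : ∀ s, 1 ≤ s → cumulantCoeff h v P β s = cumulantTerm h v P β s := fun s hs =>
      if_neg (by omega)
    rw [Finset.sum_congr rfl fun s hs => (hcoeff s (Finset.mem_Icc.1 hs).1).symm]
    refine (norm_tsum_sub_sum_Icc_le hab.right_zero (Nat.cast_nonneg _) hq0 (by linarith)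
      (fun s hs => by rw [hcoeff s hs]; exact hbound s hs) S).trans ?_
    exact mul_le_mul_of_nonneg_left (pow_le_exp_neg hq0 hq.le S) (Nat.cast_nonneg _)

theorem mul_exp_neg_le {N : ℕ} {ε : ℝ} (hε : 0 < ε) {S : ℕ} (hS : Real.log (N / ε) ≤ S) :
    N * Real.exp (-S) ≤ ε := by
  rcases Nat.eq_zero_or_pos N with rfl | hN
  · simpa using hε.le
  have hN' : (0 : ℝ) < N := Nat.cast_pos.2 hN
  have h1 : (N : ℝ) / ε ≤ Real.exp S := (Real.log_le_iff_le_exp (by positivity)).1 hS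
  rw [Real.exp_neg, ← div_eq_mul_inv, div_le_iff₀ (Real.exp_pos _)]
  rw [div_le_iff₀ hε] at h1
  linarith

/-- This passes from the effective coupling of the tree bound to that of the theorem, by e ≤ 3 and M
≤ 2^(2M). -/
theorem coupling_le {M : ℕ} {β Lg LV : ℝ} (hβ : 0 ≤ β) (hLg : 0 ≤ Lg) (hLV : 0 ≤ LV) :
    Real.exp 1 * β * M ^ 2 * Lg * LV ≤ 3 * (β * M * 2 ^ (2 * M) * Lg * LV) := by
  have h1 : Real.exp 1 ≤ 3 := by linarith [Real.exp_one_lt_d9]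
  have h2 : (M : ℝ) ^ 2 ≤ M * 2 ^ (2 * M) := by
    have : (M : ℝ) ≤ 2 ^ (2 * M) := by
      exact_mod_cast (M.lt_two_pow_self.le).trans (Nat.pow_le_pow_right two_pos (by omega))
    rw [pow_two]
    gcongr
  calc Real.exp 1 * β * M ^ 2 * Lg * LV ≤ 3 * β * (M * 2 ^ (2 * M)) * Lg * LV := by gcongr
    _ = _ := by ring

end

end Fermion

end

/-! ### The theorem. -/

theorem theorem3p1 :
    ∃ C : ℝ, 0 < C ∧ ∃ K : ℝ, 0 < K ∧
      ∀ (Ω : Type) [Fintype Ω] [LinearOrder Ω] (ι : Type) [Fintype ι]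
        (h : Matrix Ω Ω ℂ) (v : ι → ℂ) (P : ι → Fermion.MultiIndex Ω)
        (β Lg LV : ℝ) (M : ℕ),
        h.IsHermitian → 0 ≤ β → (∀ i, (P i).m ≤ M) →
        Fermion.GreenSummable h β Lg → Fermion.PotentialSummable v P LV →
        -- the bound on the `s`-th order term (whose integrals converge absolutely)
        (∀ s : ℕ, 1 ≤ s →
          (∀ p : Fin s → ι, MeasureTheory.IntegrableOn
            (fun τ => Fermion.cumulant h β (fun k => P (p k)) τ) (Fermion.timeBox β s)) ∧
          Fermion.absCumulantTerm h v P β s ≤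
            (Fintype.card Ω : ℝ) * (C * β * M * 2 ^ (2 * M) * Lg * LV) ^ s) ∧
        -- the truncation error; `ℓ` is `log (Z / Z₀)`, the ordinary logarithm of a positive
        -- number when `V` is Hermitian and a branch of the complex logarithm otherwise
        (C * β * M * 2 ^ (2 * M) * LV * Lg < 0.99 →
          ∃ ℓ : ℂ,
            Complex.exp ℓ =
              Fermion.partitionFunction β (Fermion.freeHam h + Fermion.potential v P) /
                Fermion.partitionFunction β (Fermion.freeHam h) ∧
            ((Fermion.potential v P).IsHermitian →
              ℓ = Complex.log
                (Fermion.partitionFunction β (Fermion.freeHam h + Fermion.potential v P) /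
                  Fermion.partitionFunction β (Fermion.freeHam h))) ∧
            ∀ ε : ℝ, 0 < ε → ε < 1 → ∀ S : ℕ,
              (K * Real.log (1 / ε) ≤ S →
                ‖ℓ - ∑ s ∈ Finset.Icc 1 S, Fermion.cumulantTerm h v P β s‖ ≤
                  (Fintype.card Ω : ℝ) * ε) ∧
              (K * Real.log ((Fintype.card Ω : ℝ) / ε) ≤ S →
                ‖ℓ - ∑ s ∈ Finset.Icc 1 S, Fermion.cumulantTerm h v P β s‖ ≤ ε)) := by
  -- 12 = 3 · 4: the 3 comes from `coupling_le`, and the 4 turns a coupling below 0.99 into a ratio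
  -- q < 1/4.
  refine ⟨12, by norm_num, 1, one_pos, ?_⟩
  intro Ω _ _ ι _ h v P β Lg LV M hh hβ hM hG hV
  have habs := fun n => Fermion.absCumulantTerm_le hh hβ hM hG hV n
  -- The hypotheses determine the signs of L_g and L_V only if there is at least one site. Without
  -- sites the factor N = 0 settles the bounds.
  have hnonneg : ∀ _ : Ω, 0 ≤ Lg ∧ 0 ≤ LV := by
    intro x
    have h1 := Fermion.half_le_of_greenSummable hh hβ hG x
    have h2 := (Finset.sum_nonneg fun i _ => norm_nonneg (v i)).trans (hV.1 x)
    exact ⟨by linarith, by linarith⟩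
  refine ⟨fun s hs => ⟨fun p => Fermion.integrableOn_cumulant hh β _, ?_⟩, fun hsmall => ?_⟩
  · obtain ⟨n, rfl⟩ := Nat.exists_eq_add_of_le' hs
    refine (habs n).trans ?_
    rcases isEmpty_or_nonempty Ω with hΩ | ⟨⟨x⟩⟩
    · simp
    obtain ⟨hLg, hLV⟩ := hnonneg x
    refine mul_le_mul_of_nonneg_left (pow_le_pow_left₀ (by positivity) ?_ _) (Nat.cast_nonneg _)
    refine (Fermion.coupling_le hβ hLg hLV).trans ?_
    have : 0 ≤ β * M * 2 ^ (2 * M) * Lg * LV := by positivity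
    linarith
  · have hq : ∃ q : ℝ, 0 ≤ q ∧ q < 1 / 4 ∧ ∀ s, 1 ≤ s →
        ‖Fermion.cumulantTerm h v P β s‖ ≤ Fintype.card Ω * q ^ s := by
      have hterm : ∀ s, 1 ≤ s → ‖Fermion.cumulantTerm h v P β s‖ ≤
          Fintype.card Ω * (Real.exp 1 * β * M ^ 2 * Lg * LV) ^ s := by
        intro s hs
        obtain ⟨n, rfl⟩ := Nat.exists_eq_add_of_le' hs
        exact (Fermion.norm_cumulantTerm_le h v P β _).trans (habs n)
      rcases isEmpty_or_nonempty Ω with hΩ | ⟨⟨x⟩⟩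
      · refine ⟨0, le_rfl, by norm_num, fun s hs => ?_⟩
        simpa using hterm s hs
      obtain ⟨hLg, hLV⟩ := hnonneg x
      refine ⟨_, by positivity, ?_, hterm⟩
      refine (Fermion.coupling_le hβ hLg hLV).trans_lt ?_
      linarith
    obtain ⟨q, hq0, hq, hbound⟩ := hq
    obtain ⟨ℓ, h1, h2, h3⟩ := Fermion.exists_log_of_cumulantTerm_le hh v P hβ hq0 hq hbound
    refine ⟨ℓ, h1, h2, fun ε hε _ S => ⟨fun hS => ?_, fun hS => ?_⟩⟩
    · refine (h3 S).trans (mul_le_mul_of_nonneg_left ?_ (Nat.cast_nonneg _))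
      have := Fermion.mul_exp_neg_le (N := 1) hε (S := S) (by simpa using hS)
      simpa using this
    · exact (h3 S).trans (Fermion.mul_exp_neg_le hε (by simpa using hS))
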